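/- Manifolds are smooth, finite-dimensional, Hausdorff and second countable. Let $X_1\rightrightarrows X_0$ be a Lie groupoid with source $s$, target $t$, inversion $i$ and multiplication $m:X_2\to X_1$, $m(p,q)=pq$ for $s(p)=t(q)$, and assume it is proper, i.e. $(s,t):X_1\to X_0\times X_0$ is a proper map. Let $\eta=\eta^{(2)}$ be a Riemannian groupoid metric: a Riemannian metric on the manifold $X_2$ of composable pairs that is invariant under the $S_3$-action permuting the vertices of commutative triangles and transverse to $m$; let $\eta^{(1)}=m_*\eta^{(2)}$ and $\eta^{(0)}=s_*\eta^{(1)}$ be the induced metrics on $X_1$ and $X_0$. For a vector field $v$ on $X_0$, say that $v$ is transversally Killing if for every $x\in X_0$ and every $\tau$ for which its flow $\varphi_\tau$ is defined at $x$, the map induced by $d\varphi_\tau(x)$ from the normal space $T_xX_0/T_x\mathcal O_x$ of the groupoid orbit through $x$ to that of the orbit through $\varphi_\tau(x)$ is a well-defined linear isometry, the normal spaces carrying the inner products of $(T\mathcal O)^\perp$ with respect to $\eta^{(0)}$. A vector field $\xi_1$ on $X_1$ is projectable of Killing type if it is both $s$-related and $t$-related to one transversally Killing vector field $v_1$ on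 $X_0$; the set of these is $\Gamma^{\mathrm{proj}}_\eta(X_1)$. Let $\mathfrak o^{\mathrm w}_m(X,\eta)$ be the set of weak multiplicative Killing vector fields, i.e. of pairs $(\xi,v)$ with $\xi:X_1\to TX_1$ a groupoid morphism over $v:X_0\to TX_0$ into the tangent groupoid and $v$ transversally Killing. A proper Haar measure system $\{\mu^x\}_{x\in X_0}$ is a family of Borel probability measures on $X_1$ with $\mu^x$ concentrated on $t^{-1}(x)$, left invariant ($(L_g)_*\mu^{s(g)}=\mu^{t(g)}$ for all $g\in X_1$), smooth ($x\mapsto\int f\,d\mu^x$ is smooth for all $f\in C_c^\infty(X_1)$), and such that $t$ is proper on the support (for every compact $K\subseteq X_0$ there is a compact $L\subseteq X_1$ with $\mu^x(X_1\setminus L)=0$ for all $x\in K$). Theorem. Let $\{\mu^x\}$ be any proper Haar measure system for $X_1\rightrightarrows X_0$. Then $\Gamma^{\mathrm{proj}}_\eta(X_1)$ and $\mathfrak o^{\mathrm w}_m(X,\eta)$ are real vector spaces (linear subspaces of $\mathfrak X(X_1)$ and $\mathfrak X(X_1)\times\mathfrak X(X_0)$), and $\xi_1\mapsto(\xi,v)$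 with $$\xi(p)=\int_{a\in t^{-1}(s(p))}dm_{(pa,a^{-1})}\bigl(\xi_1(pa),\,di_a(\xi_1(a))\bigr)\,d\mu^{s(p)}(a),\qquad v(x)=\int_{a\in t^{-1}(x)}dt_a(\xi_1(a))\,d\mu^x(a)$$ is a well-defined linear map $\Gamma^{\mathrm{proj}}_\eta(X_1)\to\mathfrak o^{\mathrm w}_m(X,\eta)$: all the integrands are integrable, and $\xi$ and $v$ are smooth vector fields. -/

import Mathlib

open scoped Manifold ContDiff Topology
open MeasureTheory

noncomputable section

section VectorFieldsAndMetrics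

variable (E : Type*) [NormedAddCommGroup E] [NormedSpace ℝ E]
  (M : Type*) [TopologicalSpace M] [ChartedSpace E M] [IsManifold 𝓘(ℝ, E) ∞ M]

/-- Smooth vector fields on a manifold `M` without boundary modelled on `E`. -/
abbrev SmoothVectorField : Type _ :=
  ContMDiffSection 𝓘(ℝ, E) E ∞ (fun x : M => TangentSpace 𝓘(ℝ, E) x)

/-- Smooth Riemannian metrics on a manifold `M` without boundary modelled on `E`. -/
abbrev SmoothRiemannianMetric : Type _ :=
  Bundle.ContMDiffRiemannianMetric 𝓘(ℝ, E) ∞ E (fun x : M => TangentSpace 𝓘(ℝ, E) x)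

end VectorFieldsAndMetrics

section Submersions

variable {E : Type*} [NormedAddCommGroup E] [NormedSpace ℝ E]
  {M : Type*} [TopologicalSpace M] [ChartedSpace E M] [IsManifold 𝓘(ℝ, E) ∞ M]
  {F : Type*} [NormedAddCommGroup F] [NormedSpace ℝ F]
  {N : Type*} [TopologicalSpace N] [ChartedSpace F N] [IsManifold 𝓘(ℝ, F) ∞ N]

/-- `π : (M, g) → (N, h)` is a Riemannian submersion: `dπ` restricts, at each point `e`, to a
linear isometry from the orthogonal complement of `ker dπ(e)` onto the tangent space at `π e`.
For a surjective submersion `π` such an `h` exists exactly when `g` is transverse to `π`, and it is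
then unique: it is the push-forward metric of `g` along `π`. -/
def IsRiemannianSubmersion (π : M → N) (g : SmoothRiemannianMetric E M)
    (h : SmoothRiemannianMetric F N) : Prop :=
  ContMDiff 𝓘(ℝ, E) 𝓘(ℝ, F) ∞ π ∧
  ∀ e : M, Function.Surjective (mfderiv 𝓘(ℝ, E) 𝓘(ℝ, F) π e) ∧
    ∀ w₁ w₂ : TangentSpace 𝓘(ℝ, E) e,
      (∀ k : TangentSpace 𝓘(ℝ, E) e, mfderiv 𝓘(ℝ, E) 𝓘(ℝ, F) π e k = 0 →
        g.inner e w₁ k = 0 ∧ g.inner e w₂ k = 0) →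
      h.inner (π e) (mfderiv 𝓘(ℝ, E) 𝓘(ℝ, F) π e w₁) (mfderiv 𝓘(ℝ, E) 𝓘(ℝ, F) π e w₂) =
        g.inner e w₁ w₂

/-- The vector fields `ξ` and `v` are `π`-related. -/
def VectorFieldsRelated (π : M → N) (ξ : SmoothVectorField E M) (v : SmoothVectorField F N) :
    Prop :=
  ∀ p : M, mfderiv 𝓘(ℝ, E) 𝓘(ℝ, F) π p (ξ p) = v (π p)

/-- `φ` is a local flow of `v`, defined for times in the open interval `J` around `0` and starting
points in the open set `U`. (A `C^1` local flow of a smooth vector field is automatically smooth,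
and each `(τ, x)` in the domain of the maximal flow lies in such a product `J × U`.) -/
def IsLocalFlow (v : SmoothVectorField E M) (J : Set ℝ) (U : Set M) (φ : ℝ → M → M) : Prop :=
  IsOpen J ∧ IsPreconnected J ∧ (0 : ℝ) ∈ J ∧ IsOpen U ∧
  (∀ x ∈ U, φ 0 x = x ∧ IsMIntegralCurveOn (I := 𝓘(ℝ, E)) (fun τ => φ τ x) (fun y => v y) J) ∧
  ContMDiffOn (𝓘(ℝ, ℝ).prod 𝓘(ℝ, E)) 𝓘(ℝ, E) 1 (fun q : ℝ × M => φ q.1 q.2) (J ×ˢ U)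

/-- For subspaces `S ⊆ T_x M` and `S' ⊆ T_y M` and a linear map `L : T_x M → T_y M`: the map `L`
sends `S` into `S'`, and the induced map `T_x M / S → T_y M / S'` preserves inner products, where
the quotients carry the inner products of the orthogonal complements of `S` and `S'`. -/
def InducesNormalIsometry (g : SmoothRiemannianMetric E M) {x y : M}
    (S : Set (TangentSpace 𝓘(ℝ, E) x)) (S' : Set (TangentSpace 𝓘(ℝ, E) y))
    (L : TangentSpace 𝓘(ℝ, E) x →L[ℝ] TangentSpace 𝓘(ℝ, E) y) : Prop :=
  (∀ w ∈ S, L w ∈ S') ∧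
  ∀ (w₁ w₂ : TangentSpace 𝓘(ℝ, E) x) (n₁ n₂ : TangentSpace 𝓘(ℝ, E) y),
    (∀ k ∈ S, g.inner x w₁ k = 0 ∧ g.inner x w₂ k = 0) →
    (∀ k ∈ S', g.inner y n₁ k = 0 ∧ g.inner y n₂ k = 0) →
    L w₁ - n₁ ∈ S' → L w₂ - n₂ ∈ S' →
    g.inner y n₁ n₂ = g.inner x w₁ w₂

end Submersions

/-- A groupoid with objects `X₀` and arrows `X₁`; `mul (p, q)` is the composition `p * q`
of arrows with `src p = tgt q`. -/
structure ArrowGroupoid (X₀ X₁ : Type*) where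
  src : X₁ → X₀
  tgt : X₁ → X₀
  unit : X₀ → X₁
  inv : X₁ → X₁
  mul : {c : X₁ × X₁ // src c.1 = tgt c.2} → X₁
  src_unit : ∀ x, src (unit x) = x
  tgt_unit : ∀ x, tgt (unit x) = x
  src_inv : ∀ p, src (inv p) = tgt p
  tgt_inv : ∀ p, tgt (inv p) = src p
  src_mul : ∀ c, src (mul c) = src c.1.2
  tgt_mul : ∀ c, tgt (mul c) = tgt c.1.1
  mul_assoc : ∀ (p q r : X₁) (h : src p = tgt q) (h' : src q = tgt r),
    mul ⟨(mul ⟨(p, q), h⟩, r), (src_mul ⟨(p, q), h⟩).trans h'⟩ =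
      mul ⟨(p, mul ⟨(q, r), h'⟩), h.trans (tgt_mul ⟨(q, r), h'⟩).symm⟩
  unit_mul : ∀ p, mul ⟨(unit (tgt p), p), src_unit (tgt p)⟩ = p
  mul_unit : ∀ p, mul ⟨(p, unit (src p)), (tgt_unit (src p)).symm⟩ = p
  mul_inv : ∀ p, mul ⟨(p, inv p), (tgt_inv p).symm⟩ = unit (tgt p)
  inv_mul : ∀ p, mul ⟨(inv p, p), src_inv p⟩ = unit (src p)

namespace ArrowGroupoid

section Algebra

variable {X₀ X₁ : Type*} (G : ArrowGroupoid X₀ X₁)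

/-- The set `X₂` of composable pairs `(p, q)`, `src p = tgt q`. -/
abbrev Comp : Type _ := {c : X₁ × X₁ // G.src c.1 = G.tgt c.2}

/-- A composable pair `(p, q)` is a commutative triangle with vertices `src q`, `tgt q = src p`
and `tgt p`; `leg c i` is its arrow from the vertex `0` to the vertex `i`. -/
def leg (c : G.Comp) : Fin 3 → X₁ := ![G.unit (G.src c.1.2), c.1.2, G.mul c]

lemma src_leg (c : G.Comp) (i : Fin 3) : G.src (G.leg c i) = G.src c.1.2 := by
  fin_cases i
  · exact G.src_unit _
  · rfl
  · exact G.src_mul c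

/-- The arrow of the commutative triangle `c` from the vertex `i` to the vertex `j`. -/
def edge (c : G.Comp) (i j : Fin 3) : X₁ :=
  G.mul ⟨(G.leg c j, G.inv (G.leg c i)),
    ((G.src_leg c j).trans (G.src_leg c i).symm).trans (G.tgt_inv _).symm⟩

lemma src_edge (c : G.Comp) (i j : Fin 3) : G.src (G.edge c i j) = G.tgt (G.leg c i) :=
  (G.src_mul _).trans (G.src_inv _)

lemma tgt_edge (c : G.Comp) (i j : Fin 3) : G.tgt (G.edge c i j) = G.tgt (G.leg c j) :=
  G.tgt_mul _

/-- The action of permutations of the three vertices on commutative triangles. -/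
def permute (σ : Equiv.Perm (Fin 3)) (c : G.Comp) : G.Comp :=
  ⟨(G.edge c (σ 1) (σ 2), G.edge c (σ 0) (σ 1)),
    (G.src_edge c _ _).trans (G.tgt_edge c _ _).symm⟩

end Algebra

variable {E₀ : Type*} [NormedAddCommGroup E₀] [NormedSpace ℝ E₀]
  {E₁ : Type*} [NormedAddCommGroup E₁] [NormedSpace ℝ E₁]
  {X₀ : Type*} [TopologicalSpace X₀] [ChartedSpace E₀ X₀]
  {X₁ : Type*} [TopologicalSpace X₁] [ChartedSpace E₁ X₁]
  (G : ArrowGroupoid X₀ X₁)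
  (E₂ : Type*) [NormedAddCommGroup E₂] [NormedSpace ℝ E₂] [ChartedSpace E₂ G.Comp]

/-- `X₁ ⇉ X₀` is a Lie groupoid: source and target are (surjective, because of the units)
submersions, the structure maps are smooth, and the manifold structure on the space `X₂` of
composable pairs is that of an embedded submanifold of `X₁ × X₁`. -/
structure IsLie : Prop where
  submersion_src : Manifold.IsSubmersion 𝓘(ℝ, E₁) 𝓘(ℝ, E₀) ∞ G.src
  submersion_tgt : Manifold.IsSubmersion 𝓘(ℝ, E₁) 𝓘(ℝ, E₀) ∞ G.tgt
  smooth_unit : ContMDiff 𝓘(ℝ, E₀) 𝓘(ℝ, E₁) ∞ G.unit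
  smooth_inv : ContMDiff 𝓘(ℝ, E₁) 𝓘(ℝ, E₁) ∞ G.inv
  embedding_comp : Manifold.IsSmoothEmbedding 𝓘(ℝ, E₂) (𝓘(ℝ, E₁).prod 𝓘(ℝ, E₁)) ∞
    (fun c : G.Comp => (c : X₁ × X₁))
  smooth_mul : ContMDiff 𝓘(ℝ, E₂) 𝓘(ℝ, E₁) ∞ G.mul

/-- The groupoid is proper: the map `(src, tgt) : X₁ → X₀ × X₀` is proper. -/
def IsProper (G : ArrowGroupoid X₀ X₁) : Prop :=
  IsProperMap (fun p : X₁ => (G.src p, G.tgt p))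

/-- `z` is the tangent vector `(w, w')` to the space of composable pairs. -/
def IsTangentPair (c : G.Comp) (w : TangentSpace 𝓘(ℝ, E₁) c.1.1)
    (w' : TangentSpace 𝓘(ℝ, E₁) c.1.2) (z : TangentSpace 𝓘(ℝ, E₂) c) : Prop :=
  mfderiv 𝓘(ℝ, E₂) 𝓘(ℝ, E₁) (fun d : G.Comp => d.1.1) c z = w ∧
  mfderiv 𝓘(ℝ, E₂) 𝓘(ℝ, E₁) (fun d : G.Comp => d.1.2) c z = w'

open Classical in
/-- The multiplication `dm_{(p, q)}(w, w')` of the tangent groupoid, for `w ∈ T_p X₁` and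
`w' ∈ T_q X₁` with `ds(w) = dt(w')`. (The value `0` is used for pairs that are not composable.) -/
def tangentMul (c : G.Comp) (w : TangentSpace 𝓘(ℝ, E₁) c.1.1)
    (w' : TangentSpace 𝓘(ℝ, E₁) c.1.2) : TangentSpace 𝓘(ℝ, E₁) (G.mul c) :=
  if h : ∃ z : TangentSpace 𝓘(ℝ, E₂) c, G.IsTangentPair E₂ c w w' z then
    mfderiv 𝓘(ℝ, E₂) 𝓘(ℝ, E₁) G.mul c h.choose
  else 0

/-- The tangent space at `x` to the orbit of `x`: the image of the anchor, i.e. all `dt(z)` with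
`z` tangent at the unit of `x` to the source fibre. -/
def orbitTangent (x : X₀) : Set (TangentSpace 𝓘(ℝ, E₀) x) :=
  {w | ∃ z : TangentSpace 𝓘(ℝ, E₁) (G.unit x),
    mfderiv 𝓘(ℝ, E₁) 𝓘(ℝ, E₀) G.src (G.unit x) z = 0 ∧
    (show E₀ from mfderiv 𝓘(ℝ, E₁) 𝓘(ℝ, E₀) G.tgt (G.unit x) z) = w}

variable [IsManifold 𝓘(ℝ, E₀) ∞ X₀] [IsManifold 𝓘(ℝ, E₁) ∞ X₁] [IsManifold 𝓘(ℝ, E₂) ∞ G.Comp]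

/-- A Riemannian structure on a Lie groupoid: a metric `η₂` on the space of composable pairs that
is invariant under the `S₃`-action and transverse to the composition, together with its (uniquely
determined) push-forwards `η₁` along the composition and `η₀` along the source. -/
structure RiemannianStructure where
  η₂ : SmoothRiemannianMetric E₂ G.Comp
  η₁ : SmoothRiemannianMetric E₁ X₁
  η₀ : SmoothRiemannianMetric E₀ X₀
  invariant : ∀ (σ : Equiv.Perm (Fin 3)) (c : G.Comp) (z z' : TangentSpace 𝓘(ℝ, E₂) c),
    η₂.inner (G.permute σ c)
      (mfderiv 𝓘(ℝ, E₂) 𝓘(ℝ, E₂) (G.permute σ) c z)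
      (mfderiv 𝓘(ℝ, E₂) 𝓘(ℝ, E₂) (G.permute σ) c z') = η₂.inner c z z'
  pushforward_mul : IsRiemannianSubmersion G.mul η₂ η₁
  pushforward_src : IsRiemannianSubmersion G.src η₁ η₀

variable {G E₂}

/-- `(ξ, v)` is a multiplicative vector field: `ξ : X₁ → TX₁` and `v : X₀ → TX₀` form a morphism of
groupoids from `X₁ ⇉ X₀` to its tangent groupoid. -/
def IsMultiplicative (G : ArrowGroupoid X₀ X₁) (E₂ : Type*) [NormedAddCommGroup E₂]
    [NormedSpace ℝ E₂] [ChartedSpace E₂ G.Comp]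
    (ξ : SmoothVectorField E₁ X₁) (v : SmoothVectorField E₀ X₀) : Prop :=
  VectorFieldsRelated G.src ξ v ∧ VectorFieldsRelated G.tgt ξ v ∧
  ∀ c : G.Comp, G.tangentMul E₂ c (ξ c.1.1) (ξ c.1.2) = ξ (G.mul c)

/-- The flow of `v` consists of (local) transversal isometries of `(X₀, η₀)`: it induces linear
isometries between the normal spaces of the groupoid orbits. -/
def IsTransversallyIsometric (G : ArrowGroupoid X₀ X₁) (η₀ : SmoothRiemannianMetric E₀ X₀)
    (v : SmoothVectorField E₀ X₀) : Prop :=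
  ∀ (J : Set ℝ) (U : Set X₀) (φ : ℝ → X₀ → X₀), IsLocalFlow v J U φ → ∀ τ ∈ J, ∀ x ∈ U,
    InducesNormalIsometry η₀ (G.orbitTangent (E₀ := E₀) (E₁ := E₁) x)
      (G.orbitTangent (E₀ := E₀) (E₁ := E₁) (φ τ x))
      (mfderiv 𝓘(ℝ, E₀) 𝓘(ℝ, E₀) (φ τ) x)

/-- `ξ` is a projectable vector field of Killing type on `X₁`. -/
def IsProjectableOfKillingType (η : G.RiemannianStructure (E₀ := E₀) (E₁ := E₁) E₂)
    (ξ : SmoothVectorField E₁ X₁) : Prop :=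
  ∃ v : SmoothVectorField E₀ X₀, VectorFieldsRelated G.src ξ v ∧ VectorFieldsRelated G.tgt ξ v ∧
    G.IsTransversallyIsometric (E₁ := E₁) η.η₀ v

/-- `(ξ, v)` is a weak multiplicative Killing vector field. -/
def IsWeakMultiplicativeKilling (η : G.RiemannianStructure (E₀ := E₀) (E₁ := E₁) E₂)
    (ξ : SmoothVectorField E₁ X₁) (v : SmoothVectorField E₀ X₀) : Prop :=
  G.IsMultiplicative E₂ ξ v ∧ G.IsTransversallyIsometric (E₁ := E₁) η.η₀ v

/-- A proper (normalized) Haar measure system: a smooth left-invariant family of probability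
measures `μ x` on the target fibres `tgt⁻¹(x)`, such that the target map is proper on the support
of the family. -/
structure IsProperHaarSystem (G : ArrowGroupoid X₀ X₁) [MeasurableSpace X₁]
    (μ : X₀ → Measure X₁) : Prop where
  isProbability : ∀ x, IsProbabilityMeasure (μ x)
  fibre : ∀ x, μ x {a | G.tgt a ≠ x} = 0
  leftInvariant : ∀ (g : X₁) (A : Set X₁), MeasurableSet A →
    μ (G.tgt g) A = μ (G.src g) {a | ∃ h : G.src g = G.tgt a, G.mul ⟨(g, a), h⟩ ∈ A}
  smooth : ∀ f : X₁ → ℝ, ContMDiff 𝓘(ℝ, E₁) 𝓘(ℝ, ℝ) ∞ f → HasCompactSupport f →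
    ContMDiff 𝓘(ℝ, E₀) 𝓘(ℝ, ℝ) ∞ (fun x => ∫ a, f a ∂(μ x))
  proper : ∀ K : Set X₀, IsCompact K → ∃ L : Set X₁, IsCompact L ∧ ∀ x ∈ K, μ x Lᶜ = 0

open Classical in
/-- The integrand `a ↦ dm_{(pa, a⁻¹)}(ξ(pa), di_a(ξ(a)))` at the arrow `p`, for arrows `a` with
target `src p`; the value `0` is used for all other `a`. Since `(pa)a⁻¹ = p`, the values lie in the
single vector space `T_p X₁`, a copy of `E₁`. -/
def averageIntegrand (G : ArrowGroupoid X₀ X₁) (E₂ : Type*) [NormedAddCommGroup E₂]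
    [NormedSpace ℝ E₂] [ChartedSpace E₂ G.Comp]
    (ξ : SmoothVectorField E₁ X₁) (p a : X₁) : E₁ :=
  if h : G.src p = G.tgt a then
    G.tangentMul E₂ ⟨(G.mul ⟨(p, a), h⟩, G.inv a), (G.src_mul ⟨(p, a), h⟩).trans (G.tgt_inv a).symm⟩
      (ξ (G.mul ⟨(p, a), h⟩)) (mfderiv 𝓘(ℝ, E₁) 𝓘(ℝ, E₁) G.inv a (ξ a))
  else 0

/-- The integrand `a ↦ dt_a(ξ(a))`; for `a` with target `x` its value lies in `T_x X₀`, a copy of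
`E₀`. -/
def averageIntegrandBase (G : ArrowGroupoid X₀ X₁)
    (ξ : SmoothVectorField E₁ X₁) (a : X₁) : E₀ :=
  mfderiv 𝓘(ℝ, E₁) 𝓘(ℝ, E₀) G.tgt a (ξ a)

end ArrowGroupoid

end

/-!
Averaging a projectable vector field over a proper Haar system.

A vector field `ξ` on the space of arrows that is source and target related to the same field `v`
has values that can be divided in the tangent groupoid: for arrows `q`, `a` with the same source the
vectors `ξ q`, `ξ a` have the same image under the differential of the source map, so `ξ q (ξ a)⁻¹`
is a tangent vector at `q a⁻¹`. The average of `ξ` at `p` is the mean of `ξ (p a) (ξ a)⁻¹` over the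
arrows `a` ending where `p` starts. Since `dt (ξ a) = v (t a)` and the measures are probability
measures on the target fibres, the averaged field on the objects is `v` itself; in particular it is
smooth and transversally Killing. Four points need an argument.

*Linearity of the two spaces.* The Killing condition is stated through flows. For a field `v` related
to a field on the arrows, local flows preserve the orbit spaces, because they lift to flows on the
arrows that preserve the source fibres. The derivative along the flow of the metric on the normal
spaces is then the Lie derivative of the metric restricted to the orthogonal complements of the
orbits, and the condition becomes the linear one that this restriction vanishes
(`IsLie.isTransversallyIsometric_iff`).

*The tangent groupoid.* Composable tangent vectors are velocities of curves of composable arrows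
(`exists_common_curves`), so identities of the groupoid can be differentiated along curves. This
gives the source and target of a quotient, and `(α β⁻¹)(β γ⁻¹) = α γ⁻¹`
(`IsLie.tmul_tdiv_tdiv`).

*Multiplicativity.* By left invariance the average at `p` is also the integral of
`ξ (p q b) (ξ (q b))⁻¹` over the arrows `b` composable with `q`. Multiplied by
`ξ (q b) (ξ b)⁻¹` this is the integrand at `p q`, and multiplication in the tangent groupoid over a
fixed pair of arrows is linear, hence commutes with the integral (`tmul_average`).

*Smoothness.* In submersion coordinates `p = (x, z)` of the source map the coordinate expression of
the integrand is a smooth function of `z` and of the arrow `a`, which is integrated against `μ x`.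
The hypothesis on the Haar system only says that `x ↦ ∫ f dμ x` is smooth for a fixed test
function `f`; that the same holds for a test function depending on parameters requires uniformity.
The functionals `f ↦ ∫ f dμ x`, and their derivatives in `x`, are controlled on
absolutely convergent series of test functions, so that the uniform boundedness principle on the
space of summable sequences applies: derivatives of a smooth family of functionals are again such a
family (`SmoothFunctionals.deriv`), and families are uniformly bounded over compact sets of
parameters (`SmoothFunctionals.exists_bound`). Smoothness in all parameters then follows by
induction on the order of differentiability (`SmoothFunctionals.contDiffOn_uncurry`).
-/


noncomputable section

set_option linter.unusedSectionVars false

/-! ### Differentiable dependence of solutions of an ODE on the initial point -/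

section NormedSpaceFlow

open Set Metric

variable {E : Type*} [NormedAddCommGroup E] [NormedSpace ℝ E]

/-- A two-sided Grönwall inequality for functions vanishing at time `0`. -/
lemma norm_le_of_norm_deriv_le_mul_add {f f' : ℝ → E} {K c ε : ℝ} (hK : 0 < K)
    (hf : ∀ t ∈ Ioo (-ε) ε, HasDerivAt f (f' t) t) (h0 : f 0 = 0)
    (hb : ∀ t ∈ Ioo (-ε) ε, ‖f' t‖ ≤ K * ‖f t‖ + c) {t : ℝ} (ht : t ∈ Ioo (-ε) ε) :
    ‖f t‖ ≤ c / K * (Real.exp (K * |t|) - 1) := by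
  -- the inequality for non-negative times, to be applied to `f` and to its time reversal
  have key : ∀ (h h' : ℝ → E), (∀ t ∈ Ioo (-ε) ε, HasDerivAt h (h' t) t) → h 0 = 0 →
      (∀ t ∈ Ioo (-ε) ε, ‖h' t‖ ≤ K * ‖h t‖ + c) → ∀ t ∈ Ico 0 ε,
      ‖h t‖ ≤ c / K * (Real.exp (K * t) - 1) := by
    intro h h' hh hh0 hhb t ht
    have hsub : ∀ x ∈ Icc 0 t, x ∈ Ioo (-ε) ε := fun x hx =>
      ⟨by linarith [hx.1, hx.2, ht.2], by linarith [hx.2, ht.2]⟩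
    have := norm_le_gronwallBound_of_norm_deriv_right_le (f := h) (f' := h') (δ := 0) (K := K)
      (ε := c) (a := 0) (b := t)
      (fun x hx => (hh x (hsub x hx)).continuousAt.continuousWithinAt)
      (fun x hx => (hh x (hsub x ⟨hx.1, hx.2.le⟩)).hasDerivWithinAt)
      (by simp [hh0]) (fun x hx => hhb x (hsub x ⟨hx.1, hx.2.le⟩)) t ⟨ht.1, le_rfl⟩
    rw [gronwallBound_of_K_ne_0 hK.ne'] at this
    simpa using this
  rcases le_or_gt 0 t with h | h
  · rw [abs_of_nonneg h]
    exact key f f' hf h0 hb t ⟨h, ht.2⟩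
  · rw [abs_of_neg h]
    have hneg : ∀ t ∈ Ioo (-ε) ε, -t ∈ Ioo (-ε) ε := fun t ht =>
      ⟨by linarith [ht.2], by linarith [ht.1]⟩
    have := key (fun t => f (-t)) (fun t => -f' (-t))
      (fun t ht => by
        have := (hf (-t) (hneg t ht)).scomp t (hasDerivAt_neg t)
        simpa [Function.comp_def] using this) (by simpa using h0)
      (fun t ht => by simpa using hb (-t) (hneg t ht)) (-t) ⟨by linarith, by linarith [ht.1]⟩
    simpa using this

/-- The local flow of a `C²` vector field is differentiable in the initial point; its derivative
`W` solves the variational equation. -/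
theorem exists_local_flow_hasFDerivAt [CompleteSpace E] {v : E → E} {x₀ : E}
    (hv : ContDiffAt ℝ 2 v x₀) {s : Set E} (hs : s ∈ 𝓝 x₀) :
    ∃ r > 0, ∃ ε > 0, ∃ (Φ : ℝ → E → E) (W : ℝ → E → E →L[ℝ] E),
      (∀ x ∈ ball x₀ r, Φ 0 x = x ∧ W 0 x = ContinuousLinearMap.id ℝ E) ∧
      (∀ t ∈ Ioo (-ε) ε, ∀ x ∈ ball x₀ r, Φ t x ∈ s ∧ HasDerivAt (fun τ => Φ τ x) (v (Φ t x)) t ∧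
        HasDerivAt (fun τ => W τ x) ((fderiv ℝ v (Φ t x)).comp (W t x)) t ∧
        HasFDerivAt (Φ t) (W t x) x) ∧
      ContDiffOn ℝ 1 (fun q : ℝ × E => Φ q.1 q.2) (Ioo (-ε) ε ×ˢ ball x₀ r) := by
  have hv' : ContDiffAt ℝ 1 (fderiv ℝ v) x₀ := hv.fderiv_right (by norm_num)
  -- the flow and its derivative in the initial point solve this augmented system
  let g : E × (E →L[ℝ] E) → E × (E →L[ℝ] E) := fun q => (v q.1, (fderiv ℝ v q.1).comp q.2)
  have hg : ContDiffAt ℝ 1 g (x₀, ContinuousLinearMap.id ℝ E) := by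
    refine ContDiffAt.prodMk ?_ ?_
    · exact (hv.of_le (by norm_num)).comp (x₀, ContinuousLinearMap.id ℝ E) contDiffAt_fst
    · exact ContDiffAt.clm_comp (hv'.comp (x₀, ContinuousLinearMap.id ℝ E) contDiffAt_fst)
        contDiffAt_snd
  obtain ⟨ε₀, hε₀, a, r₀, _, _, hr₀, hpl⟩ := IsPicardLindelof.of_contDiffAt_one hg
  obtain ⟨α, hα, L', hL'⟩ :=
    (hpl 0).exists_forall_mem_closedBall_eq_hasDerivWithinAt_lipschitzOnWith
  simp only [zero_sub, zero_add] at hα hL'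
  have hcont : ContinuousOn (fun q : (E × (E →L[ℝ] E)) × ℝ => α q.1 q.2)
      (closedBall (x₀, ContinuousLinearMap.id ℝ E) r₀ ×ˢ Icc (-ε₀) ε₀) :=
    continuousOn_prod_of_continuousOn_lipschitzOnWith (fun q : (E × (E →L[ℝ] E)) × ℝ => α q.1 q.2)
      L' (fun x hx => HasDerivWithinAt.continuousOn (hα x hx).2) hL'
  let j : E → E × (E →L[ℝ] E) := fun x => (x, ContinuousLinearMap.id ℝ E)
  have hj : ∀ x ∈ closedBall x₀ (r₀ : ℝ), j x ∈ closedBall (x₀, ContinuousLinearMap.id ℝ E) r₀ := by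
    intro x hx
    simp only [j, mem_closedBall, Prod.dist_eq, dist_self] at hx ⊢
    simpa using hx
  -- a ball on which `v` is differentiable and its derivative is bounded and Lipschitz
  obtain ⟨C, u, hu, hCu⟩ := hv'.exists_lipschitzOnWith
  have hdiff : ∀ᶠ x in 𝓝 x₀, DifferentiableAt ℝ v x :=
    (hv.eventually (by simp)).mono fun x hx => hx.differentiableAt (by norm_num)
  have hbdd : ∀ᶠ x in 𝓝 x₀, ‖fderiv ℝ v x‖ < ‖fderiv ℝ v x₀‖ + 1 :=
    hv'.continuousAt.norm.eventually_lt continuousAt_const (by linarith)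
  obtain ⟨ρ, hρ, hρs⟩ := Metric.mem_nhds_iff.mp
    (Filter.inter_mem hs (Filter.inter_mem hu (hdiff.and hbdd)))
  set K : ℝ := ‖fderiv ℝ v x₀‖ + 1 with hKdef
  have hK : 0 < K := by positivity
  -- shrink the domain so that all solutions stay in that ball
  have hin : ∀ᶠ q : E × ℝ in 𝓝 (x₀, (0 : ℝ)), q ∈ closedBall x₀ (r₀ : ℝ) ×ˢ Icc (-ε₀) ε₀ →
      (α (j q.1) q.2).1 ∈ ball x₀ ρ := by
    have h1 : ContinuousWithinAt (fun q : E × ℝ => (α (j q.1) q.2).1)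
        (closedBall x₀ (r₀ : ℝ) ×ˢ Icc (-ε₀) ε₀) (x₀, (0 : ℝ)) := by
      have : ContinuousOn (fun q : E × ℝ => (α (j q.1) q.2).1)
          (closedBall x₀ (r₀ : ℝ) ×ˢ Icc (-ε₀) ε₀) := by
        refine continuous_fst.comp_continuousOn (hcont.comp (f := fun q : E × ℝ => (j q.1, q.2))
          (by fun_prop) ?_)
        intro q hq
        exact ⟨hj _ hq.1, hq.2⟩
      exact this _ ⟨mem_closedBall_self r₀.2, by constructor <;> linarith⟩
    have h2 : ball x₀ ρ ∈ 𝓝 ((α (j x₀) 0).1) := by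
      rw [(hα (j x₀) (hj x₀ (mem_closedBall_self r₀.2))).1]
      exact ball_mem_nhds _ hρ
    exact eventually_nhdsWithin_iff.mp (h1.eventually h2)
  rw [nhds_prod_eq, Filter.eventually_prod_iff] at hin
  obtain ⟨pa, hpa, pb, hpb, hin⟩ := hin
  obtain ⟨r₁, hr₁, hpa⟩ := Metric.mem_nhds_iff.mp hpa
  obtain ⟨ε₁, hε₁, hpb⟩ := Metric.mem_nhds_iff.mp hpb
  refine ⟨min r₀ r₁, lt_min hr₀ hr₁, min ε₀ ε₁, lt_min hε₀ hε₁, fun t x => (α (j x) t).1,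
    fun t x => (α (j x) t).2, ?_⟩
  set r := min (r₀ : ℝ) r₁
  set ε := min ε₀ ε₁
  have hr : ∀ x ∈ ball x₀ r, x ∈ closedBall x₀ (r₀ : ℝ) := fun x hx =>
    ball_subset_closedBall (ball_subset_ball (min_le_left _ _) hx)
  have hε : ∀ t ∈ Ioo (-ε) ε, t ∈ Ioo (-ε₀) ε₀ := fun t ht =>
    ⟨by linarith [ht.1, min_le_left ε₀ ε₁], by linarith [ht.2, min_le_left ε₀ ε₁]⟩
  have hball : ∀ t ∈ Ioo (-ε) ε, ∀ x ∈ ball x₀ r, (α (j x) t).1 ∈ ball x₀ ρ := by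
    intro t ht x hx
    refine hin (x := x) (hpa (ball_subset_ball (min_le_right _ _) hx)) (y := t) (hpb ?_)
      ⟨hr x hx, Ioo_subset_Icc_self (hε t ht)⟩
    rw [mem_ball_zero_iff, Real.norm_eq_abs, abs_lt]
    exact ⟨by linarith [ht.1, min_le_right ε₀ ε₁], by linarith [ht.2, min_le_right ε₀ ε₁]⟩
  have hder : ∀ t ∈ Ioo (-ε) ε, ∀ x ∈ ball x₀ r, HasDerivAt (α (j x)) (g (α (j x) t)) t := by
    intro t ht x hx
    have := (hα (j x) (hj x (hr x hx))).2 t (Ioo_subset_Icc_self (hε t ht))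
    exact this.hasDerivAt (Icc_mem_nhds (hε t ht).1 (hε t ht).2)
  have h0 : ∀ x ∈ ball x₀ r, α (j x) 0 = j x := fun x hx => (hα (j x) (hj x (hr x hx))).1
  have hder1 : ∀ t ∈ Ioo (-ε) ε, ∀ x ∈ ball x₀ r,
      HasDerivAt (fun τ => (α (j x) τ).1) (v (α (j x) t).1) t := fun t ht x hx =>
    (hasFDerivAt_fst (𝕜 := ℝ) (p := α (j x) t)).comp_hasDerivAt t (hder t ht x hx)
  have hder2 : ∀ t ∈ Ioo (-ε) ε, ∀ x ∈ ball x₀ r,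
      HasDerivAt (fun τ => (α (j x) τ).2) ((fderiv ℝ v (α (j x) t).1).comp (α (j x) t).2) t :=
    fun t ht x hx =>
    (hasFDerivAt_snd (𝕜 := ℝ) (p := α (j x) t)).comp_hasDerivAt t (hder t ht x hx)
  -- second order Taylor estimate for `v`
  have htaylor : ∀ y ∈ ball x₀ ρ, ∀ z ∈ ball x₀ ρ,
      ‖v z - v y - fderiv ℝ v y (z - y)‖ ≤ C * ‖z - y‖ * ‖z - y‖ := by
    intro y hy z hz
    have hseg : segment ℝ y z ⊆ ball x₀ ρ := (convex_ball x₀ ρ).segment_subset hy hz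
    refine (convex_segment y z).norm_image_sub_le_of_norm_hasFDerivWithin_le'
      (f := v) (f' := fun w => fderiv ℝ v w)
      (fun w hw => (hρs (hseg hw)).2.2.1.hasFDerivAt.hasFDerivWithinAt) (fun w hw => ?_)
      (left_mem_segment ℝ y z) (right_mem_segment ℝ y z)
    refine (hCu.norm_sub_le (hρs (hseg hw)).2.1 (hρs hy).2.1).trans ?_
    gcongr
    obtain ⟨θ, hθ, rfl⟩ := (segment_eq_image' ℝ y z ▸ hw : w ∈ (fun θ : ℝ => y + θ • (z - y)) '' Icc 0 1)
    simp only [add_sub_cancel_left, norm_smul, Real.norm_eq_abs, abs_of_nonneg hθ.1]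
    exact mul_le_of_le_one_left (norm_nonneg _) hθ.2
  have hfd : ∀ t ∈ Ioo (-ε) ε, ∀ x ∈ ball x₀ r,
      HasFDerivAt (fun x => (α (j x) t).1) (α (j x) t).2 x := by
    intro t ht x hx
    set c₀ : ℝ := C * L' * L' / K * (Real.exp (K * |t|) - 1) with hc₀
    have hest : ∀ y ∈ ball x₀ r,
        ‖(α (j y) t).1 - (α (j x) t).1 - (α (j x) t).2 (y - x)‖ ≤ c₀ * ‖y - x‖ ^ 2 := by
      intro y hy
      have hLip : ∀ τ ∈ Ioo (-ε) ε, ‖(α (j y) τ).1 - (α (j x) τ).1‖ ≤ L' * ‖y - x‖ := by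
        intro τ hτ
        have := (hL' τ (Ioo_subset_Icc_self (hε τ hτ))).norm_sub_le (hj y (hr y hy))
          (hj x (hr x hx))
        refine ((norm_fst_le (α (j y) τ - α (j x) τ))).trans (this.trans (le_of_eq ?_))
        simp [j, Prod.norm_def]
      have := norm_le_of_norm_deriv_le_mul_add (E := E) (K := K) (ε := ε) (c := C * (L' * ‖y - x‖) * (L' * ‖y - x‖))
        (f := fun τ => (α (j y) τ).1 - (α (j x) τ).1 - (α (j x) τ).2 (y - x))
        (f' := fun τ => v (α (j y) τ).1 - v (α (j x) τ).1 -
          ((fderiv ℝ v (α (j x) τ).1).comp (α (j x) τ).2) (y - x)) hK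
        (fun τ hτ => ((hder1 τ hτ y hy).sub (hder1 τ hτ x hx)).sub
          ((hder2 τ hτ x hx).clm_apply (hasDerivAt_const τ (y - x)) |>.congr_deriv (by simp)))
        (by simp [h0 x hx, h0 y hy, j]) (fun τ hτ => ?_) ht
      · refine this.trans (le_of_eq ?_)
        rw [hc₀]; ring
      · have e1 : v (α (j y) τ).1 - v (α (j x) τ).1 -
            ((fderiv ℝ v (α (j x) τ).1).comp (α (j x) τ).2) (y - x) =
            fderiv ℝ v (α (j x) τ).1 ((α (j y) τ).1 - (α (j x) τ).1 - (α (j x) τ).2 (y - x)) +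
            (v (α (j y) τ).1 - v (α (j x) τ).1 -
              fderiv ℝ v (α (j x) τ).1 ((α (j y) τ).1 - (α (j x) τ).1)) := by
          simp only [ContinuousLinearMap.comp_apply, map_sub]; abel
        rw [e1]
        refine (norm_add_le _ _).trans (add_le_add ?_ ?_)
        · refine (ContinuousLinearMap.le_opNorm _ _).trans ?_
          gcongr
          exact (hρs (hball τ hτ x hx)).2.2.2.le
        · refine (htaylor _ (hball τ hτ x hx) _ (hball τ hτ y hy)).trans ?_
          have := hLip τ hτ
          gcongr
    refine .of_isLittleO ?_
    have hO : (fun y => (α (j y) t).1 - (α (j x) t).1 - (α (j x) t).2 (y - x)) =O[𝓝 x]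
        fun y => ‖y - x‖ ^ 2 := by
      refine Asymptotics.IsBigO.of_bound c₀ ?_
      filter_upwards [isOpen_ball.mem_nhds hx] with y hy
      simpa using hest y hy
    refine hO.trans_isLittleO ?_
    have := Asymptotics.isLittleO_norm_pow_id (E' := E) (n := 2) (by norm_num)
    have h2 : Filter.Tendsto (fun y => y - x) (𝓝 x) (𝓝 0) := by
      have : Filter.Tendsto (fun y => y - x) (𝓝 x) (𝓝 (x - x)) :=
        (continuous_id.sub continuous_const).tendsto x
      simpa using this
    exact this.comp_tendsto h2
  refine ⟨fun x hx => by simp [h0 x hx, j], fun t ht x hx =>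
    ⟨(hρs (hball t ht x hx)).1, hder1 t ht x hx, hder2 t ht x hx, hfd t ht x hx⟩, ?_⟩
  -- the partial derivatives are continuous
  have hαc : ContinuousOn (fun q : ℝ × E => α (j q.2) q.1) (Ioo (-ε) ε ×ˢ ball x₀ r) := by
    refine hcont.comp (f := fun q : ℝ × E => (j q.2, q.1)) (by fun_prop) ?_
    intro q hq
    exact ⟨hj _ (hr _ hq.2), Ioo_subset_Icc_self (hε _ hq.1)⟩
  have hopen : IsOpen (Ioo (-ε) ε ×ˢ ball x₀ r) := isOpen_Ioo.prod isOpen_ball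
  have hvc : ContinuousOn v (ball x₀ ρ) := fun y hy =>
    (hρs hy).2.2.1.continuousAt.continuousWithinAt
  have hc1 : ContinuousOn (fun q : ℝ × E =>
      ContinuousLinearMap.toSpanSingleton ℝ (v (α (j q.2) q.1).1)) (Ioo (-ε) ε ×ˢ ball x₀ r) := by
    have h1 : ContinuousOn (fun q : ℝ × E => v (α (j q.2) q.1).1) (Ioo (-ε) ε ×ˢ ball x₀ r) :=
      hvc.comp (continuous_fst.comp_continuousOn hαc) (fun q hq => hball _ hq.1 _ hq.2)
    exact (ContinuousLinearMap.toSpanSingletonCLE (𝕜 := ℝ) (E := E)).continuous.comp_continuousOn h1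
  have hc2 : ContinuousOn (fun q : ℝ × E => (α (j q.2) q.1).2) (Ioo (-ε) ε ×ˢ ball x₀ r) :=
    continuous_snd.comp_continuousOn hαc
  have hstrict : ∀ q ∈ Ioo (-ε) ε ×ˢ ball x₀ r, HasFDerivAt (fun q : ℝ × E => (α (j q.2) q.1).1)
      ((ContinuousLinearMap.toSpanSingleton ℝ (v (α (j q.2) q.1).1)).coprod (α (j q.2) q.1).2)
      q := by
    intro q hq
    refine (hasStrictFDerivAt_uncurry_coprod (u := q)
      (f := fun t x => (α (j x) t).1)
      (f₁ := fun t x => ContinuousLinearMap.toSpanSingleton ℝ (v (α (j x) t).1))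
      (f₂ := fun t x => (α (j x) t).2) ?_ ?_ ?_ ?_).hasFDerivAt
    · filter_upwards [hopen.mem_nhds hq] with w hw
      exact (hder1 _ hw.1 _ hw.2).hasFDerivAt
    · filter_upwards [hopen.mem_nhds hq] with w hw
      exact hfd _ hw.1 _ hw.2
    · exact hc1.continuousAt (hopen.mem_nhds hq)
    · exact hc2.continuousAt (hopen.mem_nhds hq)
  rw [show (1 : ℕ∞ω) = 0 + 1 by norm_num,
    contDiffOn_succ_iff_hasFDerivWithinAt_of_uniqueDiffOn hopen.uniqueDiffOn]
  refine ⟨by simp, _, contDiffOn_zero.mpr ?_, fun q hq => (hstrict q hq).hasFDerivWithinAt⟩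
  have : (fun q : ℝ × E => (ContinuousLinearMap.toSpanSingleton ℝ (v (α (j q.2) q.1).1)).coprod
      (α (j q.2) q.1).2) = fun q : ℝ × E => (ContinuousLinearMap.coprodEquivL (𝕜 := ℝ) (E := ℝ) (F := E) (G := E) ℝ)
        (ContinuousLinearMap.toSpanSingleton ℝ (v (α (j q.2) q.1).1), (α (j q.2) q.1).2) := rfl
  rw [this]
  exact (ContinuousLinearEquiv.continuous _).comp_continuousOn (hc1.prodMk hc2)

end NormedSpaceFlow

/-! ### Derivatives, vector fields and metrics as plain linear algebra -/

section PlainDerivative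

variable {E : Type*} [NormedAddCommGroup E] [NormedSpace ℝ E]
  {M : Type*} [TopologicalSpace M] [ChartedSpace E M]
  {F : Type*} [NormedAddCommGroup F] [NormedSpace ℝ F]
  {N : Type*} [TopologicalSpace N] [ChartedSpace F N]
  {F' : Type*} [NormedAddCommGroup F'] [NormedSpace ℝ F']
  {N' : Type*} [TopologicalSpace N'] [ChartedSpace F' N']

variable (E F) in
/-- The manifold derivative as a continuous linear map between the model spaces. Every tangent
space of a manifold modelled on `E` is a copy of `E`; forgetting the base points makes the normed
space structure available and avoids casts between tangent spaces at equal points. -/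
def tderiv (f : M → N) (x : M) : E →L[ℝ] F := mfderiv 𝓘(ℝ, E) 𝓘(ℝ, F) f x

/-- `f` is differentiable at `x` with derivative `L`, a map between the model spaces. -/
def HasTDerivAt (f : M → N) (L : E →L[ℝ] F) (x : M) : Prop :=
  HasMFDerivAt 𝓘(ℝ, E) 𝓘(ℝ, F) f x L

/-- The curve `γ` has velocity `w` at time `t`. -/
def HasVelocityAt (γ : ℝ → M) (w : E) (t : ℝ) : Prop :=
  HasTDerivAt γ (ContinuousLinearMap.toSpanSingleton ℝ w) t

lemma HasTDerivAt.tderiv_eq {f : M → N} {L : E →L[ℝ] F} {x : M} (h : HasTDerivAt f L x) :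
    tderiv E F f x = L := h.mfderiv

lemma HasTDerivAt.continuousAt {f : M → N} {L : E →L[ℝ] F} {x : M} (h : HasTDerivAt f L x) :
    ContinuousAt f x := HasMFDerivAt.continuousAt h

lemma MDifferentiableAt.hasTDerivAt {f : M → N} {x : M}
    (h : MDifferentiableAt 𝓘(ℝ, E) 𝓘(ℝ, F) f x) : HasTDerivAt f (tderiv E F f x) x :=
  h.hasMFDerivAt

lemma HasTDerivAt.comp {g : N → N'} {f : M → N} {L' : F →L[ℝ] F'} {L : E →L[ℝ] F} {x : M}
    (hg : HasTDerivAt g L' (f x)) (hf : HasTDerivAt f L x) :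
    HasTDerivAt (fun y => g (f y)) (L'.comp L) x :=
  HasMFDerivAt.comp x hg hf

lemma HasTDerivAt.congr_of_eventuallyEq {f g : M → N} {L : E →L[ℝ] F} {x : M}
    (h : HasTDerivAt f L x) (hfg : g =ᶠ[𝓝 x] f) : HasTDerivAt g L x :=
  HasMFDerivAt.congr_of_eventuallyEq h hfg

lemma HasTDerivAt.congr_deriv {f : M → N} {L L' : E →L[ℝ] F} {x : M}
    (h : HasTDerivAt f L x) (hL : L = L') : HasTDerivAt f L' x := hL ▸ h

lemma HasTDerivAt.unique {f : M → N} {L L' : E →L[ℝ] F} {x : M}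
    (h : HasTDerivAt f L x) (h' : HasTDerivAt f L' x) : L = L' :=
  h.tderiv_eq.symm.trans h'.tderiv_eq

lemma tderiv_congr_of_eventuallyEq {f g : M → N} {x : M} (hfg : f =ᶠ[𝓝 x] g) :
    tderiv E F f x = tderiv E F g x := by
  have := hfg.mfderiv_eq (I := 𝓘(ℝ, E)) (I' := 𝓘(ℝ, F))
  exact this

lemma hasTDerivAt_id (x : M) : HasTDerivAt (fun y : M => y) (ContinuousLinearMap.id ℝ E) x :=
  hasMFDerivAt_id x

lemma HasFDerivAt.hasTDerivAt {f : E → F} {L : E →L[ℝ] F} {x : E} (h : HasFDerivAt f L x) :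
    HasTDerivAt f L x := h.hasMFDerivAt

lemma HasTDerivAt.hasFDerivAt {f : E → F} {L : E →L[ℝ] F} {x : E} (h : HasTDerivAt f L x) :
    HasFDerivAt f L x := hasMFDerivAt_iff_hasFDerivAt.mp h

lemma HasDerivAt.hasVelocityAt {γ : ℝ → E} {w : E} {t : ℝ} (h : HasDerivAt γ w t) :
    HasVelocityAt γ w t := h.hasFDerivAt.hasTDerivAt

lemma HasVelocityAt.comp_left {f : M → N} {L : E →L[ℝ] F} {γ : ℝ → M} {w : E} {t : ℝ}
    (hf : HasTDerivAt f L (γ t)) (h : HasVelocityAt γ w t) :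
    HasVelocityAt (fun τ => f (γ τ)) (L w) t :=
  (HasTDerivAt.comp hf h).congr_deriv (by ext; simp)

lemma HasVelocityAt.unique {γ : ℝ → M} {w w' : E} {t : ℝ} (h : HasVelocityAt γ w t)
    (h' : HasVelocityAt γ w' t) : w = w' := by
  have := congrArg (fun L : ℝ →L[ℝ] E => L 1) (HasTDerivAt.unique h h')
  simpa using this

lemma HasVelocityAt.congr_of_eventuallyEq {γ γ' : ℝ → M} {w : E} {t : ℝ}
    (h : HasVelocityAt γ w t) (h' : γ' =ᶠ[𝓝 t] γ) : HasVelocityAt γ' w t :=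
  HasTDerivAt.congr_of_eventuallyEq h h'

lemma ContMDiffAt.hasTDerivAt {f : M → N} {x : M} {n : ℕ∞ω}
    (h : ContMDiffAt 𝓘(ℝ, E) 𝓘(ℝ, F) n f x) (hn : n ≠ 0) : HasTDerivAt f (tderiv E F f x) x :=
  (h.mdifferentiableAt hn).hasTDerivAt

lemma ContMDiff.hasTDerivAt {f : M → N} (h : ContMDiff 𝓘(ℝ, E) 𝓘(ℝ, F) ∞ f) (x : M) :
    HasTDerivAt f (tderiv E F f x) x :=
  h.contMDiffAt.hasTDerivAt (by simp)

end PlainDerivative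

section Charts

open Set Bundle

variable {E : Type*} [NormedAddCommGroup E] [NormedSpace ℝ E]
  {M : Type*} [TopologicalSpace M] [ChartedSpace E M] [IsManifold 𝓘(ℝ, E) ∞ M]
  {F : Type*} [NormedAddCommGroup F] [NormedSpace ℝ F]
  {N : Type*} [TopologicalSpace N] [ChartedSpace F N] [IsManifold 𝓘(ℝ, F) ∞ N]

/-- The values of a vector field, as elements of the model space. -/
def fieldAt (v : SmoothVectorField E M) (x : M) : E := v x

/-- A Riemannian metric at a point, as a bilinear form on the model space. -/
def metricAt (g : SmoothRiemannianMetric E M) (x : M) : E →L[ℝ] E →L[ℝ] ℝ := g.inner x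

omit [IsManifold 𝓘(ℝ, E) ∞ M] in
lemma extChartAt_nhds_target {y : M} {u : E} (hu : u ∈ (extChartAt 𝓘(ℝ, E) y).target) :
    (extChartAt 𝓘(ℝ, E) y).target ∈ 𝓝 u :=
  (isOpen_extChartAt_target y).mem_nhds hu

lemma hasTDerivAt_extChartAt_symm {y : M} {u : E} (hu : u ∈ (extChartAt 𝓘(ℝ, E) y).target) :
    HasTDerivAt (extChartAt 𝓘(ℝ, E) y).symm (tderiv E E (extChartAt 𝓘(ℝ, E) y).symm u) u := by
  have := mdifferentiableWithinAt_extChartAt_symm (I := 𝓘(ℝ, E)) hu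
  simp only [modelWithCornersSelf_coe, range_id, mdifferentiableWithinAt_univ] at this
  exact this.hasTDerivAt

lemma hasTDerivAt_extChartAt {y x : M} (hx : x ∈ (extChartAt 𝓘(ℝ, E) y).source) :
    HasTDerivAt (extChartAt 𝓘(ℝ, E) y) (tderiv E E (extChartAt 𝓘(ℝ, E) y) x) x :=
  (mdifferentiableAt_extChartAt (by simpa using hx)).hasTDerivAt

lemma tderiv_extChartAt_tderiv_symm {y : M} {u : E} (hu : u ∈ (extChartAt 𝓘(ℝ, E) y).target)
    (w : E) :
    tderiv E E (extChartAt 𝓘(ℝ, E) y) ((extChartAt 𝓘(ℝ, E) y).symm u)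
      (tderiv E E (extChartAt 𝓘(ℝ, E) y).symm u w) = w := by
  have h := (hasTDerivAt_extChartAt ((extChartAt 𝓘(ℝ, E) y).map_target hu)).comp
    (hasTDerivAt_extChartAt_symm hu)
  have h' : HasTDerivAt (fun u' : E => extChartAt 𝓘(ℝ, E) y ((extChartAt 𝓘(ℝ, E) y).symm u'))
      (ContinuousLinearMap.id ℝ E) u :=
    (hasTDerivAt_id u).congr_of_eventuallyEq (by
      filter_upwards [extChartAt_nhds_target hu] with u' hu'
      exact (extChartAt 𝓘(ℝ, E) y).right_inv hu')
  exact congrArg (fun L : E →L[ℝ] E => L w) (h.unique h')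

lemma tderiv_symm_tderiv_extChartAt {y x : M} (hx : x ∈ (extChartAt 𝓘(ℝ, E) y).source) (w : E) :
    tderiv E E (extChartAt 𝓘(ℝ, E) y).symm (extChartAt 𝓘(ℝ, E) y x)
      (tderiv E E (extChartAt 𝓘(ℝ, E) y) x w) = w := by
  have h := HasTDerivAt.comp (f := extChartAt 𝓘(ℝ, E) y)
    (hasTDerivAt_extChartAt_symm ((extChartAt 𝓘(ℝ, E) y).map_source hx))
    (hasTDerivAt_extChartAt hx)
  have h' : HasTDerivAt (fun x' : M => (extChartAt 𝓘(ℝ, E) y).symm (extChartAt 𝓘(ℝ, E) y x'))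
      (ContinuousLinearMap.id ℝ E) x :=
    (hasTDerivAt_id x).congr_of_eventuallyEq (by
      filter_upwards [(isOpen_extChartAt_source y).mem_nhds hx] with x' hx'
      exact (extChartAt 𝓘(ℝ, E) y).left_inv hx')
  exact congrArg (fun L : E →L[ℝ] E => L w) (h.unique h')

lemma tderiv_extChartAt_self (y : M) (w : E) : tderiv E E (extChartAt 𝓘(ℝ, E) y) y w = w := by
  have := mfderiv_extChartAt_self (I := 𝓘(ℝ, E)) (x := y)
  exact congrArg (fun L : E →L[ℝ] E => L w) this

lemma trivializationAt_snd_eq_tderiv {y x : M} (hx : x ∈ (extChartAt 𝓘(ℝ, E) y).source)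
    (w : TangentSpace 𝓘(ℝ, E) x) :
    (trivializationAt E (TangentSpace 𝓘(ℝ, E)) y ⟨x, w⟩).2 =
      tderiv E E (extChartAt 𝓘(ℝ, E) y) x w := by
  have hx' : x ∈ (chartAt E y).source := by simpa using hx
  have h1 := TangentBundle.continuousLinearMapAt_trivializationAt (I := 𝓘(ℝ, E)) (𝕜 := ℝ) hx'
  have h2 := (trivializationAt E (TangentSpace 𝓘(ℝ, E)) y).continuousLinearMapAt_apply_of_mem
    (R := ℝ) (b := x) (by simpa using hx') w
  rw [← h2]
  exact congrArg (fun L : E →L[ℝ] E => L w) h1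

/-- The coordinate expression of a vector field `v` in the chart at `y`. -/
def coordField (v : M → E) (y : M) (u : E) : E :=
  tderiv E E (extChartAt 𝓘(ℝ, E) y) ((extChartAt 𝓘(ℝ, E) y).symm u)
    (v ((extChartAt 𝓘(ℝ, E) y).symm u))

lemma tderiv_symm_coordField (v : M → E) {y : M} {u : E}
    (hu : u ∈ (extChartAt 𝓘(ℝ, E) y).target) :
    tderiv E E (extChartAt 𝓘(ℝ, E) y).symm u (coordField v y u) =
      v ((extChartAt 𝓘(ℝ, E) y).symm u) := by
  have := tderiv_symm_tderiv_extChartAt (E := E)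
    ((extChartAt 𝓘(ℝ, E) y).map_target hu) (v ((extChartAt 𝓘(ℝ, E) y).symm u))
  rwa [(extChartAt 𝓘(ℝ, E) y).right_inv hu] at this

lemma contMDiffOn_section_iff_tderiv {v : ∀ x : M, TangentSpace 𝓘(ℝ, E) x} {y : M} :
    ContMDiffOn 𝓘(ℝ, E) (𝓘(ℝ, E).prod 𝓘(ℝ, E)) ∞
      (fun x => TotalSpace.mk' E (E := fun x : M => TangentSpace 𝓘(ℝ, E) x) x (v x))
      (extChartAt 𝓘(ℝ, E) y).source ↔
    ContMDiffOn 𝓘(ℝ, E) 𝓘(ℝ, E) ∞ (fun x => tderiv E E (extChartAt 𝓘(ℝ, E) y) x (v x))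
      (extChartAt 𝓘(ℝ, E) y).source := by
  refine (Trivialization.contMDiffOn_section_iff
    (trivializationAt E (TangentSpace 𝓘(ℝ, E)) y) (isOpen_extChartAt_source y) (by simp)).trans ?_
  exact contMDiffOn_congr fun x hx => trivializationAt_snd_eq_tderiv hx _

lemma contMDiffOn_tderiv_fieldAt (v : SmoothVectorField E M) (y : M) :
    ContMDiffOn 𝓘(ℝ, E) 𝓘(ℝ, E) ∞ (fun x => tderiv E E (extChartAt 𝓘(ℝ, E) y) x (fieldAt v x))
      (extChartAt 𝓘(ℝ, E) y).source :=
  contMDiffOn_section_iff_tderiv.mp v.contMDiff.contMDiffOn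

lemma contDiffOn_coordField (v : SmoothVectorField E M) (y : M) :
    ContDiffOn ℝ ∞ (coordField (fieldAt v) y) (extChartAt 𝓘(ℝ, E) y).target := by
  have h2 := (contMDiffOn_tderiv_fieldAt v y).comp (contMDiffOn_extChartAt_symm y)
    (fun u hu => (extChartAt 𝓘(ℝ, E) y).map_target hu)
  rwa [contMDiffOn_iff_contDiffOn] at h2

/-- A section of the tangent bundle is smooth at `y` if its coordinate expression in the chart at
`y` is. -/
lemma contMDiffAt_section_of_tderiv {v : ∀ x : M, TangentSpace 𝓘(ℝ, E) x} {y : M}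
    (h : ContMDiffAt 𝓘(ℝ, E) 𝓘(ℝ, E) ∞ (fun x => tderiv E E (extChartAt 𝓘(ℝ, E) y) x (v x)) y) :
    ContMDiffAt 𝓘(ℝ, E) (𝓘(ℝ, E).prod 𝓘(ℝ, E)) ∞
      (fun x => TotalSpace.mk' E (E := fun x : M => TangentSpace 𝓘(ℝ, E) x) x (v x)) y := by
  refine (contMDiffAt_section y).mpr ?_
  refine h.congr_of_eventuallyEq ?_
  filter_upwards [extChartAt_source_mem_nhds (I := 𝓘(ℝ, E)) y] with x hx
  exact trivializationAt_snd_eq_tderiv hx _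

/-- The coordinate expression of a Riemannian metric `g` in the chart at `y`. -/
def coordMetric (g : SmoothRiemannianMetric E M) (y : M) (u : E) : E →L[ℝ] E →L[ℝ] ℝ :=
  (metricAt g ((extChartAt 𝓘(ℝ, E) y).symm u)).bilinearComp
    (tderiv E E (extChartAt 𝓘(ℝ, E) y).symm u) (tderiv E E (extChartAt 𝓘(ℝ, E) y).symm u)

lemma differentiableAt_coordMetric [FiniteDimensional ℝ E] (g : SmoothRiemannianMetric E M)
    (y : M) :
    DifferentiableAt ℝ (coordMetric g y) (extChartAt 𝓘(ℝ, E) y y) := by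
  have hsec : ∀ a : E, ContMDiffOn 𝓘(ℝ, E) (𝓘(ℝ, E).prod 𝓘(ℝ, E)) ∞
      (fun x => TotalSpace.mk' E (E := fun x : M => TangentSpace 𝓘(ℝ, E) x) x
        (tderiv E E (extChartAt 𝓘(ℝ, E) y).symm (extChartAt 𝓘(ℝ, E) y x) a))
      (extChartAt 𝓘(ℝ, E) y).source := by
    intro a
    refine contMDiffOn_section_iff_tderiv.mpr ?_
    refine (contMDiffOn_const (c := a)).congr fun x hx => ?_
    have := tderiv_extChartAt_tderiv_symm (E := E) ((extChartAt 𝓘(ℝ, E) y).map_source hx) a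
    rwa [(extChartAt 𝓘(ℝ, E) y).left_inv hx] at this
  have happ : ∀ a b : E, ContDiffOn ℝ ∞ (fun u => coordMetric g y u a b)
      (extChartAt 𝓘(ℝ, E) y).target := by
    intro a b
    have h1 : ContMDiffOn 𝓘(ℝ, E) 𝓘(ℝ, ℝ) ∞ (fun x => metricAt g x
        (tderiv E E (extChartAt 𝓘(ℝ, E) y).symm (extChartAt 𝓘(ℝ, E) y x) a)
        (tderiv E E (extChartAt 𝓘(ℝ, E) y).symm (extChartAt 𝓘(ℝ, E) y x) b))
        (extChartAt 𝓘(ℝ, E) y).source := by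
      have := ContMDiffOn.clm_bundle_apply₂ (F₁ := E) (F₂ := E) (F₃ := ℝ)
        (E₁ := fun x : M => TangentSpace 𝓘(ℝ, E) x) (E₂ := fun x : M => TangentSpace 𝓘(ℝ, E) x)
        (E₃ := Bundle.Trivial M ℝ) g.contMDiff.contMDiffOn (hsec a) (hsec b)
      intro x hx
      have h2 := this x hx
      simp only [contMDiffWithinAt_totalSpace] at h2
      exact h2.2
    have h2 := h1.comp (contMDiffOn_extChartAt_symm y)
      (fun u hu => (extChartAt 𝓘(ℝ, E) y).map_target hu)
    rw [contMDiffOn_iff_contDiffOn] at h2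
    refine h2.congr fun u hu => ?_
    simp only [Function.comp_apply, (extChartAt 𝓘(ℝ, E) y).right_inv hu]
    rfl
  have : ContDiffOn ℝ ∞ (coordMetric g y) (extChartAt 𝓘(ℝ, E) y).target :=
    contDiffOn_clm_apply.mpr fun a => contDiffOn_clm_apply.mpr fun b => happ a b
  exact (this.contDiffAt (extChartAt_target_mem_nhds y)).differentiableAt (by simp)

end Charts

/-! ### Local flows on manifolds and the Lie derivative of a metric -/

section LieDerivativeInNormedSpace

variable {E : Type*} [NormedAddCommGroup E] [NormedSpace ℝ E]

/-- The Lie derivative at `u` of a field `c` of bilinear forms along a vector field `f` on a normed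
space. -/
def lieBilin (c : E → E →L[ℝ] E →L[ℝ] ℝ) (f : E → E) (u a b : E) : ℝ :=
  fderiv ℝ c u (f u) a b + c u (fderiv ℝ f u a) b + c u a (fderiv ℝ f u b)

lemma lieBilin_add (c : E → E →L[ℝ] E →L[ℝ] ℝ) {f f' : E → E} {u : E}
    (hf : DifferentiableAt ℝ f u) (hf' : DifferentiableAt ℝ f' u) (a b : E) :
    lieBilin c (f + f') u a b = lieBilin c f u a b + lieBilin c f' u a b := by
  simp only [lieBilin, fderiv_add hf hf', Pi.add_apply, map_add, add_apply]
  ring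

lemma lieBilin_smul (c : E → E →L[ℝ] E →L[ℝ] ℝ) (r : ℝ) {f : E → E} {u : E}
    (hf : DifferentiableAt ℝ f u) (a b : E) :
    lieBilin c (r • f) u a b = r * lieBilin c f u a b := by
  simp only [lieBilin, fderiv_const_smul hf, Pi.smul_apply, map_smul, smul_apply, smul_eq_mul]
  ring

lemma HasDerivAt.bilin_comp {c : E → E →L[ℝ] E →L[ℝ] ℝ} {γ A B : ℝ → E} {t : ℝ} {w a b : E}
    (hc : DifferentiableAt ℝ c (γ t)) (hγ : HasDerivAt γ w t) (hA : HasDerivAt A a t)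
    (hB : HasDerivAt B b t) : HasDerivAt (fun s => c (γ s) (A s) (B s))
      (fderiv ℝ c (γ t) w (A t) (B t) + c (γ t) a (B t) + c (γ t) (A t) b) t := by
  have h1 : HasDerivAt (fun s => c (γ s)) (fderiv ℝ c (γ t) w) t :=
    HasFDerivAt.comp_hasDerivAt (E := E →L[ℝ] E →L[ℝ] ℝ) t hc.hasFDerivAt hγ
  exact ((h1.clm_apply hA).clm_apply hB).congr_deriv (by simp)

end LieDerivativeInNormedSpace

section LocalFlows

open Set Bundle

variable {E : Type*} [NormedAddCommGroup E] [NormedSpace ℝ E]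
  {M : Type*} [TopologicalSpace M] [ChartedSpace E M] [IsManifold 𝓘(ℝ, E) ∞ M]

/-- The Lie derivative `L_v g` of the metric `g` at `y`, computed in the chart at `y`. -/
def lieMetric (v : SmoothVectorField E M) (g : SmoothRiemannianMetric E M) (y : M) (a b : E) : ℝ :=
  lieBilin (coordMetric g y) (coordField (fieldAt v) y) (extChartAt 𝓘(ℝ, E) y y) a b

lemma contDiffAt_coordField_self (v : SmoothVectorField E M) (y : M) :
    ContDiffAt ℝ ∞ (coordField (fieldAt v) y) (extChartAt 𝓘(ℝ, E) y y) :=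
  (contDiffOn_coordField v y).contDiffAt (extChartAt_target_mem_nhds y)

lemma lieMetric_add (v v' : SmoothVectorField E M) (g : SmoothRiemannianMetric E M) (y : M)
    (a b : E) : lieMetric (v + v') g y a b = lieMetric v g y a b + lieMetric v' g y a b := by
  have h : coordField (fieldAt (v + v')) y =
      coordField (fieldAt v) y + coordField (fieldAt v') y := by
    funext u
    exact map_add (tderiv E E (extChartAt 𝓘(ℝ, E) y) ((extChartAt 𝓘(ℝ, E) y).symm u))
      (fieldAt v _) (fieldAt v' _)
  have h1 := (contDiffAt_coordField_self v y).differentiableAt (by simp)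
  have h2 := (contDiffAt_coordField_self v' y).differentiableAt (by simp)
  simp only [lieMetric, h, lieBilin_add _ h1 h2]

lemma lieMetric_smul (c : ℝ) (v : SmoothVectorField E M) (g : SmoothRiemannianMetric E M) (y : M)
    (a b : E) : lieMetric (c • v) g y a b = c * lieMetric v g y a b := by
  have h : coordField (fieldAt (c • v)) y = c • coordField (fieldAt v) y := by
    funext u
    exact map_smul (tderiv E E (extChartAt 𝓘(ℝ, E) y) ((extChartAt 𝓘(ℝ, E) y).symm u)) c
      (fieldAt v _)
  have h1 := (contDiffAt_coordField_self v y).differentiableAt (by simp)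
  simp only [lieMetric, h, lieBilin_smul _ _ h1]

lemma lieMetric_zero (g : SmoothRiemannianMetric E M) (y : M) (a b : E) :
    lieMetric (0 : SmoothVectorField E M) g y a b = 0 := by
  simpa using lieMetric_smul (0 : ℝ) (0 : SmoothVectorField E M) g y a b

lemma IsLocalFlow.hasVelocityAt {v : SmoothVectorField E M} {J : Set ℝ} {U : Set M}
    {φ : ℝ → M → M} (h : IsLocalFlow v J U φ) {τ : ℝ} (hτ : τ ∈ J) {x : M} (hx : x ∈ U) :
    HasVelocityAt (fun t => φ t x) (fieldAt v (φ τ x)) τ := by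
  have h1 := ((h.2.2.2.2.1 x hx).2 τ hτ).hasMFDerivAt (h.1.mem_nhds hτ)
  refine HasTDerivAt.congr_deriv (L := (1 : ℝ →L[ℝ] ℝ).smulRight (fieldAt v (φ τ x))) h1 ?_
  ext; simp

/-- Integral curves, given by their velocities, are unique. -/
lemma eqOn_of_hasVelocityAt [FiniteDimensional ℝ E] [T2Space M] {v : SmoothVectorField E M}
    {γ γ' : ℝ → M} {a b t₀ : ℝ} (ht₀ : t₀ ∈ Ioo a b)
    (hγ : ∀ t ∈ Ioo a b, HasVelocityAt γ (fieldAt v (γ t)) t)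
    (hγ' : ∀ t ∈ Ioo a b, HasVelocityAt γ' (fieldAt v (γ' t)) t) (h : γ t₀ = γ' t₀) :
    EqOn γ γ' (Ioo a b) := by
  have key : ∀ γ : ℝ → M, (∀ t ∈ Ioo a b, HasVelocityAt γ (fieldAt v (γ t)) t) →
      IsMIntegralCurveOn (I := 𝓘(ℝ, E)) γ (fun y => v y) (Ioo a b) := by
    intro γ hγ t ht
    have h2 : HasTDerivAt γ ((1 : ℝ →L[ℝ] ℝ).smulRight (fieldAt v (γ t))) t :=
      HasTDerivAt.congr_deriv (hγ t ht) (by ext; simp)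
    exact HasMFDerivAt.hasMFDerivWithinAt h2
  have := IsManifold.of_le (I := 𝓘(ℝ, E)) (M := M) (m := 1) (n := ∞) (by simp)
  exact isMIntegralCurveOn_Ioo_eqOn_of_contMDiff_boundaryless ht₀ (v.contMDiff.of_le (by simp))
    (key γ hγ) (key γ' hγ') h

omit [IsManifold 𝓘(ℝ, E) ∞ M] in
lemma HasVelocityAt.comp_sub_const {γ : ℝ → M} {w : E} {t c : ℝ}
    (h : HasVelocityAt γ w (t - c)) : HasVelocityAt (fun s => γ (s - c)) w t := by
  have h1 : HasTDerivAt (fun s : ℝ => s - c) (ContinuousLinearMap.id ℝ ℝ) t := by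
    have := ((hasDerivAt_id t).sub_const c).hasFDerivAt
    exact (this.congr_fderiv (by ext; simp)).hasTDerivAt
  exact (HasTDerivAt.comp (f := fun s : ℝ => s - c) h h1).congr_deriv (by simp)

lemma IsLocalFlow.contMDiffAt {v : SmoothVectorField E M} {J : Set ℝ} {U : Set M}
    {φ : ℝ → M → M} (h : IsLocalFlow v J U φ) {τ : ℝ} (hτ : τ ∈ J) {x : M} (hx : x ∈ U) :
    ContMDiffAt (𝓘(ℝ, ℝ).prod 𝓘(ℝ, E)) 𝓘(ℝ, E) 1 (fun q : ℝ × M => φ q.1 q.2) (τ, x) :=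
  h.2.2.2.2.2.contMDiffAt ((h.1.prod h.2.2.2.1).mem_nhds ⟨hτ, hx⟩)

lemma IsLocalFlow.hasTDerivAt {v : SmoothVectorField E M} {J : Set ℝ} {U : Set M}
    {φ : ℝ → M → M} (h : IsLocalFlow v J U φ) {τ : ℝ} (hτ : τ ∈ J) {x : M} (hx : x ∈ U) :
    HasTDerivAt (φ τ) (tderiv E E (φ τ) x) x := by
  have : ContMDiffAt 𝓘(ℝ, E) 𝓘(ℝ, E) 1 (φ τ) x :=
    (h.contMDiffAt hτ hx).comp x (contMDiffAt_const.prodMk contMDiffAt_id)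
  exact this.hasTDerivAt (by simp)

/-- The group property of local flows. -/
lemma IsLocalFlow.eventuallyEq_comp [FiniteDimensional ℝ E] [T2Space M]
    {v : SmoothVectorField E M} {J : Set ℝ} {U U' : Set M} {φ χ : ℝ → M → M} {δ a b : ℝ}
    (hφ : IsLocalFlow v J U φ) (hχ : IsLocalFlow v (Ioo (-δ) δ) U' χ)
    (hJ : Ioo a b ⊆ J) (hab : b - a ≤ δ) {τ τ' : ℝ} (hτ : τ ∈ Ioo a b) (hτ' : τ' ∈ Ioo a b)
    {x : M} (hx : x ∈ U) (hxU' : φ τ x ∈ U') :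
    φ τ' =ᶠ[𝓝 x] fun x' => χ (τ' - τ) (φ τ x') := by
  filter_upwards [hφ.2.2.2.1.mem_nhds hx,
    (hφ.hasTDerivAt (hJ hτ) hx).continuousAt.preimage_mem_nhds (hχ.2.2.2.1.mem_nhds hxU')]
    with x' hx' hx'U'
  have hmem : ∀ t ∈ Ioo a b, t - τ ∈ Ioo (-δ) δ := fun t ht =>
    ⟨by linarith [ht.1, hτ.2], by linarith [ht.2, hτ.1]⟩
  refine eqOn_of_hasVelocityAt (v := v) (γ := fun t => φ t x')
    (γ' := fun t => χ (t - τ) (φ τ x')) hτ (fun t ht => hφ.hasVelocityAt (hJ ht) hx')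
    (fun t ht => ?_) ?_ hτ'
  · exact (hχ.hasVelocityAt (hmem t ht) hx'U').comp_sub_const
  · simp only [sub_self]
    exact ((hχ.2.2.2.2.1 _ hx'U').1).symm

lemma IsLocalFlow.tderiv_comp [FiniteDimensional ℝ E] [T2Space M]
    {v : SmoothVectorField E M} {J : Set ℝ} {U U' : Set M} {φ χ : ℝ → M → M} {δ a b : ℝ}
    (hφ : IsLocalFlow v J U φ) (hχ : IsLocalFlow v (Ioo (-δ) δ) U' χ)
    (hJ : Ioo a b ⊆ J) (hab : b - a ≤ δ) {τ τ' : ℝ} (hτ : τ ∈ Ioo a b) (hτ' : τ' ∈ Ioo a b)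
    {x : M} (hx : x ∈ U) (hxU' : φ τ x ∈ U') :
    φ τ' x = χ (τ' - τ) (φ τ x) ∧
    tderiv E E (φ τ') x = (tderiv E E (χ (τ' - τ)) (φ τ x)).comp (tderiv E E (φ τ) x) := by
  have h := hφ.eventuallyEq_comp hχ hJ hab hτ hτ' hx hxU'
  refine ⟨h.self_of_nhds, ?_⟩
  rw [tderiv_congr_of_eventuallyEq h]
  refine ((hχ.hasTDerivAt ?_ hxU').comp (hφ.hasTDerivAt (hJ hτ) hx)).tderiv_eq
  exact ⟨by linarith [hτ'.1, hτ.2], by linarith [hτ'.2, hτ.1]⟩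

/-- Every smooth vector field has local flows; along the flow line through the centre `y`, the
derivative of the pulled back metric at time `0` is the Lie derivative of the metric. -/
theorem exists_isLocalFlow [FiniteDimensional ℝ E] (v : SmoothVectorField E M) (y : M) :
    ∃ δ > 0, ∃ (U : Set M) (χ : ℝ → M → M), y ∈ U ∧ IsLocalFlow v (Ioo (-δ) δ) U χ ∧
      ∀ (g : SmoothRiemannianMetric E M) (a b : E),
        HasDerivAt (fun σ => metricAt g (χ σ y) (tderiv E E (χ σ) y a) (tderiv E E (χ σ) y b))
          (lieMetric v g y a b) 0 := by
  set e := extChartAt 𝓘(ℝ, E) y with he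
  obtain ⟨r, hr, δ, hδ, Φ, W, h0, h1, h2⟩ := exists_local_flow_hasFDerivAt
    ((contDiffAt_coordField_self v y).of_le (by norm_cast))
    (extChartAt_target_mem_nhds (I := 𝓘(ℝ, E)) y)
  set B := Metric.ball (e y) r with hB
  have heyB : e y ∈ B := Metric.mem_ball_self hr
  have h0mem : (0 : ℝ) ∈ Ioo (-δ) δ := ⟨by linarith, hδ⟩
  refine ⟨δ, hδ, e.source ∩ e ⁻¹' B, fun σ x => e.symm (Φ σ (e x)),
    ⟨mem_extChartAt_source y, heyB⟩, ⟨isOpen_Ioo, isPreconnected_Ioo, h0mem, ?_, ?_, ?_⟩, ?_⟩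
  · exact (continuousOn_extChartAt y).isOpen_inter_preimage (isOpen_extChartAt_source y)
      Metric.isOpen_ball
  · rintro x ⟨hx, hxB⟩
    refine ⟨by simp only [(h0 _ hxB).1, e.left_inv hx], fun τ hτ => ?_⟩
    obtain ⟨hτ1, hτ2, -, -⟩ := h1 τ hτ (e x) hxB
    have hvel := HasVelocityAt.comp_left (f := e.symm) (γ := fun τ => Φ τ (e x))
      (hasTDerivAt_extChartAt_symm hτ1) hτ2.hasVelocityAt
    rw [tderiv_symm_coordField _ hτ1, ← he] at hvel
    have h3 : HasTDerivAt (fun τ => e.symm (Φ τ (e x)))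
        ((1 : ℝ →L[ℝ] ℝ).smulRight (fieldAt v (e.symm (Φ τ (e x))))) τ :=
      HasTDerivAt.congr_deriv hvel (by ext; simp)
    exact HasMFDerivAt.hasMFDerivWithinAt h3
  · have hΦ := h2.contMDiffOn
    refine ((contMDiffOn_extChartAt_symm (n := 1) (I := 𝓘(ℝ, E)) y).comp
      (hΦ.comp (f := fun q : ℝ × M => (q.1, e q.2)) ?_ ?_) ?_)
    · refine ContMDiffOn.prodMk_space contMDiffOn_fst ?_
      refine ((contMDiffOn_extChartAt (n := 1) (I := 𝓘(ℝ, E)) (x := y)).comp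
        contMDiffOn_snd (fun q hq => ?_))
      simpa [he] using hq.2.1
    · exact fun q hq => ⟨hq.1, hq.2.2⟩
    · exact fun q hq => (h1 q.1 hq.1 (e q.2) hq.2.2).1
  · intro g a b
    have hder : ∀ σ ∈ Ioo (-δ) δ, tderiv E E (fun x => e.symm (Φ σ (e x))) y =
        ((tderiv E E e.symm (Φ σ (e y))).comp (W σ (e y))).comp (tderiv E E e y) := by
      intro σ hσ
      obtain ⟨hσ1, -, -, hσ4⟩ := h1 σ hσ (e y) heyB
      exact (((hasTDerivAt_extChartAt_symm hσ1).comp hσ4.hasTDerivAt).comp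
        (hasTDerivAt_extChartAt (mem_extChartAt_source y))).tderiv_eq
    have hev : (fun σ => metricAt g (e.symm (Φ σ (e y)))
        (tderiv E E (fun x => e.symm (Φ σ (e x))) y a)
        (tderiv E E (fun x => e.symm (Φ σ (e x))) y b)) =ᶠ[𝓝 0]
        fun σ => coordMetric g y (Φ σ (e y)) (W σ (e y) a) (W σ (e y) b) := by
      filter_upwards [isOpen_Ioo.mem_nhds h0mem] with σ hσ
      rw [hder σ hσ]
      simp only [ContinuousLinearMap.comp_apply, he, tderiv_extChartAt_self]
      rfl
    refine HasDerivAt.congr_of_eventuallyEq ?_ hev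
    obtain ⟨-, hd1, hd2, -⟩ := h1 0 h0mem (e y) heyB
    have hg : DifferentiableAt ℝ (coordMetric g y) (Φ 0 (e y)) := by
      rw [(h0 _ heyB).1]
      exact differentiableAt_coordMetric g y
    have hWa := hd2.clm_apply (hasDerivAt_const (0 : ℝ) a)
    have hWb := hd2.clm_apply (hasDerivAt_const (0 : ℝ) b)
    refine (HasDerivAt.bilin_comp hg hd1 hWa hWb).congr_deriv ?_
    simp only [lieMetric, lieBilin, (h0 _ heyB).1, (h0 _ heyB).2, ← he,
      ContinuousLinearMap.comp_apply, ContinuousLinearMap.id_apply, map_zero, add_zero]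

/-- The derivative of the pulled back metric along any local flow. -/
lemma IsLocalFlow.hasDerivAt_metricAt [FiniteDimensional ℝ E] [T2Space M]
    {v : SmoothVectorField E M} {J : Set ℝ} {U : Set M} {φ : ℝ → M → M}
    (hφ : IsLocalFlow v J U φ) (g : SmoothRiemannianMetric E M) {τ : ℝ} (hτ : τ ∈ J) {x : M}
    (hx : x ∈ U) (a b : E) :
    HasDerivAt (fun t => metricAt g (φ t x) (tderiv E E (φ t) x a) (tderiv E E (φ t) x b))
      (lieMetric v g (φ τ x) (tderiv E E (φ τ) x a) (tderiv E E (φ τ) x b)) τ := by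
  obtain ⟨δ, hδ, U', χ, hyU', hχ, hder⟩ := exists_isLocalFlow v (φ τ x)
  obtain ⟨ε, hε, hεJ⟩ := Metric.mem_nhds_iff.mp (hφ.1.mem_nhds hτ)
  set ε' := min ε (δ / 2) with hε'
  have hε'0 : 0 < ε' := lt_min hε (by linarith)
  have hJ : Ioo (τ - ε') (τ + ε') ⊆ J := by
    rw [← Real.ball_eq_Ioo]
    exact (Metric.ball_subset_ball (min_le_left _ _)).trans hεJ
  have hab : (τ + ε') - (τ - ε') ≤ δ := by linarith [min_le_right ε (δ / 2)]
  have hττ : τ ∈ Ioo (τ - ε') (τ + ε') := ⟨by linarith, by linarith⟩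
  have h1 := hder g (tderiv E E (φ τ) x a) (tderiv E E (φ τ) x b)
  rw [← sub_self τ] at h1
  have h2 := h1.comp_sub_const τ τ
  refine h2.congr_of_eventuallyEq ?_
  filter_upwards [isOpen_Ioo.mem_nhds hττ] with t ht
  obtain ⟨e1, e2⟩ := hφ.tderiv_comp hχ hJ hab hττ ht hx hyU'
  simp only [e1, e2, ContinuousLinearMap.comp_apply]

end LocalFlows

/-! ### Submersions in coordinates -/

section Submersions

open Set Manifold

universe u

variable {E : Type u} [NormedAddCommGroup E] [NormedSpace ℝ E]
  {M : Type*} [TopologicalSpace M] [ChartedSpace E M] [IsManifold 𝓘(ℝ, E) ∞ M]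
  {F : Type*} [NormedAddCommGroup F] [NormedSpace ℝ F]
  {N : Type*} [TopologicalSpace N] [ChartedSpace F N] [IsManifold 𝓘(ℝ, F) ∞ N]

/-- Coordinates near `p` in which `f` is the projection `F × C → F`. -/
structure SubmersionCoords (E F : Type*) [NormedAddCommGroup E] [NormedSpace ℝ E]
    [NormedAddCommGroup F] [NormedSpace ℝ F] {M N : Type*} [TopologicalSpace M] [ChartedSpace E M]
    [TopologicalSpace N] [ChartedSpace F N] (C : Type*) [NormedAddCommGroup C] [NormedSpace ℝ C]
    (f : M → N) (p : M) where
  top : OpenPartialHomeomorph M (F × C)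
  base : OpenPartialHomeomorph N F
  mem_source : p ∈ top.source
  mapsTo : MapsTo f top.source base.source
  top_smooth : ContMDiffOn 𝓘(ℝ, E) 𝓘(ℝ, F × C) ∞ top top.source
  top_symm_smooth : ContMDiffOn 𝓘(ℝ, F × C) 𝓘(ℝ, E) ∞ top.symm top.target
  base_smooth : ContMDiffOn 𝓘(ℝ, F) 𝓘(ℝ, F) ∞ base base.source
  base_symm_smooth : ContMDiffOn 𝓘(ℝ, F) 𝓘(ℝ, F) ∞ base.symm base.target
  fst_top : ∀ q ∈ top.source, (top q).1 = base (f q)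

lemma exists_submersionCoords {f : M → N} {p : M}
    (hf : IsSubmersionAt 𝓘(ℝ, E) 𝓘(ℝ, F) ∞ f p) :
    ∃ (C : Type u) (_ : NormedAddCommGroup C) (_ : NormedSpace ℝ C),
      Nonempty (SubmersionCoords E F C f p) ∧ Nonempty (E ≃L[ℝ] F × C) := by
  refine ⟨hf.complement, inferInstance, inferInstance, ⟨?_⟩, ⟨hf.equiv⟩⟩
  refine
    { top := hf.domChart.transHomeomorph hf.equiv.toHomeomorph
      base := hf.codChart
      mem_source := hf.mem_domChart_source
      mapsTo := hf.source_subset_preimage_source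
      top_smooth := ?_
      top_symm_smooth := ?_
      base_smooth := contMDiffOn_of_mem_maximalAtlas hf.codChart_mem_maximalAtlas
      base_symm_smooth := contMDiffOn_symm_of_mem_maximalAtlas hf.codChart_mem_maximalAtlas
      fst_top := ?_ }
  · exact hf.equiv.contDiff.contMDiff.comp_contMDiffOn
      (contMDiffOn_of_mem_maximalAtlas hf.domChart_mem_maximalAtlas)
  · refine (contMDiffOn_symm_of_mem_maximalAtlas hf.domChart_mem_maximalAtlas).comp
      hf.equiv.symm.contDiff.contMDiff.contMDiffOn ?_
    intro y hy
    simpa using hy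
  · intro q hq
    have hq' : q ∈ hf.domChart.source := hq
    have h0 : hf.domChart q ∈ (hf.domChart.extend 𝓘(ℝ, E)).target := by
      simpa using hf.domChart.map_source hq'
    have h := hf.writtenInCharts h0
    simp only [Function.comp_apply, OpenPartialHomeomorph.extend_coe,
      OpenPartialHomeomorph.extend_coe_symm, modelWithCornersSelf_coe,
      modelWithCornersSelf_coe_symm, id_eq, hf.domChart.left_inv hq'] at h
    exact h.symm

/-- Smooth curves can be lifted along a submersion, with prescribed velocity. -/
lemma exists_lift_curve {f : M → N} {p : M} (hf : IsSubmersionAt 𝓘(ℝ, E) 𝓘(ℝ, F) ∞ f p)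
    {b : ℝ → N} (hb : ContMDiffAt 𝓘(ℝ, ℝ) 𝓘(ℝ, F) ∞ b 0) (hb0 : b 0 = f p) {w : E}
    (hbw : HasVelocityAt b (tderiv E F f p w) 0) :
    ∃ c : ℝ → M, ContMDiffAt 𝓘(ℝ, ℝ) 𝓘(ℝ, E) ∞ c 0 ∧ c 0 = p ∧ HasVelocityAt c w 0 ∧
      ∀ᶠ ε in 𝓝 0, f (c ε) = b ε := by
  obtain ⟨C, _, _, ⟨φ⟩, -⟩ := exists_submersionCoords hf
  have hpt := φ.mem_source
  have hψs : f p ∈ φ.base.source := φ.mapsTo hpt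
  have hψ : ContMDiffAt 𝓘(ℝ, F) 𝓘(ℝ, F) ∞ φ.base (f p) :=
    φ.base_smooth.contMDiffAt (φ.base.open_source.mem_nhds hψs)
  have hφ : ContMDiffAt 𝓘(ℝ, E) 𝓘(ℝ, F × C) ∞ φ.top p :=
    φ.top_smooth.contMDiffAt (φ.top.open_source.mem_nhds hpt)
  have hφ' : ContMDiffAt 𝓘(ℝ, F × C) 𝓘(ℝ, E) ∞ φ.top.symm (φ.top p) :=
    φ.top_symm_smooth.contMDiffAt (φ.top.open_target.mem_nhds (φ.top.map_source hpt))
  set W := tderiv E (F × C) φ.top p w with hW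
  set γ : ℝ → F × C := fun ε => (φ.base (b ε), (φ.top p).2 + ε • W.2) with hγ
  have hγ0 : γ 0 = φ.top p := by
    simp only [hγ, hb0, zero_smul, add_zero]
    exact Prod.ext (φ.fst_top p hpt).symm rfl
  have hbase : ContMDiffAt 𝓘(ℝ, ℝ) 𝓘(ℝ, F) ∞ (fun ε => φ.base (b ε)) 0 :=
    (hb0 ▸ hψ : ContMDiffAt 𝓘(ℝ, F) 𝓘(ℝ, F) ∞ φ.base (b 0)).comp 0 hb
  have hγs : ContMDiffAt 𝓘(ℝ, ℝ) 𝓘(ℝ, F × C) ∞ γ 0 := by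
    refine hbase.prodMk_space ?_
    exact ContDiffAt.contMDiffAt (by fun_prop)
  have hfd : HasTDerivAt f (tderiv E F f p) p := by
    refine ContMDiffAt.hasTDerivAt (n := ∞) ?_ (by simp)
    have h1 : ContMDiffAt 𝓘(ℝ, E) 𝓘(ℝ, F) ∞ (fun q => φ.base.symm (φ.top q).1) p := by
      refine ContMDiffAt.comp (g := φ.base.symm) (f := fun q => (φ.top q).1) p
        (I' := 𝓘(ℝ, F)) ?_ ?_
      · rw [φ.fst_top p hpt]
        exact φ.base_symm_smooth.contMDiffAt
          (φ.base.open_target.mem_nhds (φ.base.map_source hψs))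
      · exact contDiff_fst.contMDiff.contMDiffAt.comp p hφ
    refine h1.congr_of_eventuallyEq ?_
    filter_upwards [φ.top.open_source.mem_nhds hpt] with q hq
    rw [φ.fst_top q hq, φ.base.left_inv (φ.mapsTo hq)]
  have hW1 : W.1 = tderiv F F φ.base (f p) (tderiv E F f p w) := by
    have h1 : HasTDerivAt (fun q => (φ.top q).1)
        ((ContinuousLinearMap.fst ℝ F C).comp (tderiv E (F × C) φ.top p)) p :=
      HasTDerivAt.comp (hasFDerivAt_fst.hasTDerivAt) (hφ.hasTDerivAt (by simp))
    have h2 : HasTDerivAt (fun q => (φ.top q).1)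
        ((tderiv F F φ.base (f p)).comp (tderiv E F f p)) p := by
      refine (HasTDerivAt.comp (hψ.hasTDerivAt (by simp)) hfd).congr_of_eventuallyEq ?_
      filter_upwards [φ.top.open_source.mem_nhds hpt] with q hq using φ.fst_top q hq
    exact congrArg (fun L : E →L[ℝ] F => L w) (h1.unique h2)
  have hγv : HasVelocityAt γ W 0 := by
    have h1 : HasVelocityAt (fun ε => φ.base (b ε)) W.1 0 := by
      rw [hW1]
      refine HasVelocityAt.comp_left (f := φ.base) (L := tderiv F F φ.base (f p)) ?_ hbw
      rw [hb0]
      exact hψ.hasTDerivAt (by simp)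
    have h2 : HasDerivAt (fun ε => φ.base (b ε)) W.1 0 := by
      have := (HasTDerivAt.hasFDerivAt h1).hasDerivAt
      simpa using this
    have h3 : HasDerivAt (fun ε : ℝ => (φ.top p).2 + ε • W.2) W.2 0 := by
      simpa using ((hasDerivAt_id (0 : ℝ)).smul_const W.2).const_add (φ.top p).2
    exact (h2.prodMk h3).hasVelocityAt
  refine ⟨fun ε => φ.top.symm (γ ε), ?_, ?_, ?_, ?_⟩
  · exact (hγ0 ▸ hφ' : ContMDiffAt 𝓘(ℝ, F × C) 𝓘(ℝ, E) ∞ φ.top.symm (γ 0)).comp 0 hγs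
  · simp only [hγ0, φ.top.left_inv hpt]
  · have h1 : HasTDerivAt φ.top.symm (tderiv (F × C) E φ.top.symm (φ.top p)) (γ 0) := by
      rw [hγ0]
      exact hφ'.hasTDerivAt (by simp)
    have h2 := HasVelocityAt.comp_left h1 hγv
    have h3 : HasTDerivAt (fun q => φ.top.symm (φ.top q))
        ((tderiv (F × C) E φ.top.symm (φ.top p)).comp (tderiv E (F × C) φ.top p)) p :=
      HasTDerivAt.comp (hφ'.hasTDerivAt (by simp)) (hφ.hasTDerivAt (by simp))
    have h4 : HasTDerivAt (fun q => φ.top.symm (φ.top q)) (ContinuousLinearMap.id ℝ E) p := by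
      refine (hasTDerivAt_id p).congr_of_eventuallyEq ?_
      filter_upwards [φ.top.open_source.mem_nhds hpt] with q hq using φ.top.left_inv hq
    have h5 := congrArg (fun L : E →L[ℝ] E => L w) (h3.unique h4)
    have h6 : tderiv (F × C) E φ.top.symm (φ.top p) W = w := h5
    rwa [h6] at h2
  · have h1 : ∀ᶠ ε in 𝓝 (0 : ℝ), γ ε ∈ φ.top.target :=
      hγs.continuousAt.preimage_mem_nhds
        (φ.top.open_target.mem_nhds (hγ0 ▸ φ.top.map_source hpt))
    have h2 : ∀ᶠ ε in 𝓝 (0 : ℝ), b ε ∈ φ.base.source :=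
      hb.continuousAt.preimage_mem_nhds (φ.base.open_source.mem_nhds (hb0 ▸ hψs))
    filter_upwards [h1, h2] with ε h1 h2
    have h3 := φ.fst_top _ (φ.top.map_target h1)
    rw [φ.top.right_inv h1] at h3
    exact (φ.base.injOn h2 (φ.mapsTo (φ.top.map_target h1)) h3).symm

omit [IsManifold 𝓘(ℝ, E) ∞ M] in
lemma HasVelocityAt.tderiv_eq {c : ℝ → M} {w : E} {t : ℝ} (h : HasVelocityAt c w t) :
    tderiv ℝ E c t 1 = w := by
  rw [HasTDerivAt.tderiv_eq h]
  simp

/-- Every tangent vector is the velocity of a smooth curve. -/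
lemma exists_curve (x : M) (w : E) :
    ∃ b : ℝ → M, ContMDiffAt 𝓘(ℝ, ℝ) 𝓘(ℝ, E) ∞ b 0 ∧ b 0 = x ∧ HasVelocityAt b w 0 := by
  set e := extChartAt 𝓘(ℝ, E) x with he
  have hx := mem_extChartAt_target (I := 𝓘(ℝ, E)) x
  have h0 : e x + (0 : ℝ) • w = e x := by simp
  refine ⟨fun ε => e.symm (e x + ε • w), ?_, ?_, ?_⟩
  · refine ContMDiffAt.comp (I' := 𝓘(ℝ, E)) (g := e.symm) (f := fun ε : ℝ => e x + ε • w) 0 ?_ ?_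
    · rw [h0]
      exact (contMDiffOn_extChartAt_symm x).contMDiffAt (extChartAt_target_mem_nhds x)
    · exact ContDiffAt.contMDiffAt (by fun_prop)
  · change e.symm (e x + (0 : ℝ) • w) = x
    rw [h0, he, extChartAt_to_inv]
  · have h1 : HasDerivAt (fun ε : ℝ => e x + ε • w) w 0 := by
      simpa using ((hasDerivAt_id (0 : ℝ)).smul_const w).const_add (e x)
    have h2 := HasVelocityAt.comp_left (f := e.symm) (γ := fun ε : ℝ => e x + ε • w)
      (L := tderiv E E e.symm (e x)) (by rw [h0]; exact hasTDerivAt_extChartAt_symm hx)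
      h1.hasVelocityAt
    have h3 := tderiv_symm_tderiv_extChartAt (E := E) (mem_extChartAt_source (I := 𝓘(ℝ, E)) x) w
    rw [tderiv_extChartAt_self] at h3
    rwa [he, h3] at h2

/-- Tangent vectors with the same image under a submersion are the velocities of curves with the
same image under the submersion. -/
lemma exists_common_curves {ι : Type*} [Finite ι] {f : M → N} (hf : IsSubmersion 𝓘(ℝ, E) 𝓘(ℝ, F) ∞ f)
    {p : ι → M} {w : ι → E} {x : N} (hp : ∀ i, f (p i) = x) {u : F}
    (hw : ∀ i, tderiv E F f (p i) (w i) = u) :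
    ∃ (c : ι → ℝ → M), (∀ i, ContMDiffAt 𝓘(ℝ, ℝ) 𝓘(ℝ, E) ∞ (c i) 0 ∧ c i 0 = p i ∧
      HasVelocityAt (c i) (w i) 0) ∧ ∀ i j ε, f (c i ε) = f (c j ε) := by
  classical
  obtain ⟨b, hb, hb0, hbu⟩ := exists_curve (E := F) x u
  have h : ∀ i, ∃ c : ℝ → M, ContMDiffAt 𝓘(ℝ, ℝ) 𝓘(ℝ, E) ∞ c 0 ∧ c 0 = p i ∧
      HasVelocityAt c (w i) 0 ∧ ∀ᶠ ε in 𝓝 0, f (c ε) = b ε := fun i =>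
    exists_lift_curve (hf.isSubmersionAt (p i)) hb (hb0.trans (hp i).symm) (by rw [hw i]; exact hbu)
  choose c hc hc0 hcw hcb using h
  have hall : ∀ᶠ ε in 𝓝 (0 : ℝ), ∀ i, f (c i ε) = b ε := Filter.eventually_all.mpr hcb
  refine ⟨fun i ε => if ∀ i, f (c i ε) = b ε then c i ε else p i, fun i => ?_, fun i j ε => ?_⟩
  · have heq : (fun ε => if ∀ i, f (c i ε) = b ε then c i ε else p i) =ᶠ[𝓝 0] c i := by
      filter_upwards [hall] with ε hε using if_pos hε
    exact ⟨(hc i).congr_of_eventuallyEq heq, heq.self_of_nhds.trans (hc0 i),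
      (hcw i).congr_of_eventuallyEq heq⟩
  · by_cases hε : ∀ i, f (c i ε) = b ε
    · simp only [if_pos hε, hε i, hε j]
    · simp only [if_neg hε, hp i, hp j]

end Submersions

/-! ### The tangent groupoid -/

namespace ArrowGroupoid

section TotalMultiplication

variable {X₀ X₁ : Type*} (G : ArrowGroupoid X₀ X₁)

open Classical in
/-- The composition `p * q`, extended by the value `p` to pairs that are not composable. -/
def comp (p q : X₁) : X₁ := if h : G.src p = G.tgt q then G.mul ⟨(p, q), h⟩ else p

variable {G} {p q r : X₁}

lemma comp_eq (h : G.src p = G.tgt q) : G.comp p q = G.mul ⟨(p, q), h⟩ := dif_pos h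

lemma src_comp (h : G.src p = G.tgt q) : G.src (G.comp p q) = G.src q := by
  rw [comp_eq h, G.src_mul]

lemma tgt_comp (h : G.src p = G.tgt q) : G.tgt (G.comp p q) = G.tgt p := by
  rw [comp_eq h, G.tgt_mul]

lemma comp_assoc (h : G.src p = G.tgt q) (h' : G.src q = G.tgt r) :
    G.comp (G.comp p q) r = G.comp p (G.comp q r) := by
  have h1 : G.src (G.comp p q) = G.tgt r := (src_comp h).trans h'
  have h2 : G.src p = G.tgt (G.comp q r) := h.trans (tgt_comp h').symm
  rw [comp_eq h1, comp_eq h2]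
  simp only [comp_eq h, comp_eq h']
  exact G.mul_assoc p q r h h'

lemma unit_comp (h : G.tgt p = x) : G.comp (G.unit x) p = p := by
  subst h
  rw [comp_eq (G.src_unit _), G.unit_mul]

lemma comp_unit (h : G.src p = x) : G.comp p (G.unit x) = p := by
  subst h
  rw [comp_eq (G.tgt_unit _).symm, G.mul_unit]

lemma comp_inv (p : X₁) : G.comp p (G.inv p) = G.unit (G.tgt p) := by
  rw [comp_eq (G.tgt_inv p).symm, G.mul_inv]

lemma inv_comp (p : X₁) : G.comp (G.inv p) p = G.unit (G.src p) := by
  rw [comp_eq (G.src_inv p), G.inv_mul]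

lemma inv_inv (p : X₁) : G.inv (G.inv p) = p := by
  have h1 : G.src (G.inv (G.inv p)) = G.tgt (G.inv p) := G.src_inv _
  calc G.inv (G.inv p) = G.comp (G.inv (G.inv p)) (G.unit (G.src p)) :=
        (comp_unit (h1.trans (G.tgt_inv p))).symm
    _ = G.comp (G.inv (G.inv p)) (G.comp (G.inv p) p) := by rw [inv_comp]
    _ = G.comp (G.comp (G.inv (G.inv p)) (G.inv p)) p := (comp_assoc h1 (G.src_inv p)).symm
    _ = p := by rw [inv_comp, G.src_inv, unit_comp rfl]

/-- `(α β⁻¹)(β γ⁻¹) = α γ⁻¹`. -/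
lemma comp_comp_inv_comp_inv (h : G.src p = G.src q) (h' : G.src q = G.src r) :
    G.comp (G.comp p (G.inv q)) (G.comp q (G.inv r)) = G.comp p (G.inv r) := by
  have h1 : G.src p = G.tgt (G.inv q) := h.trans (G.tgt_inv q).symm
  have h2 : G.src q = G.tgt (G.inv r) := h'.trans (G.tgt_inv r).symm
  rw [comp_assoc h1 ((G.src_inv q).trans (tgt_comp h2).symm), ← comp_assoc (G.src_inv q) h2,
    inv_comp, unit_comp ((G.tgt_inv r).trans h'.symm)]

/-- `(p a) a⁻¹ = p`. -/
lemma comp_comp_inv (h : G.src p = G.tgt q) : G.comp (G.comp p q) (G.inv q) = p := by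
  rw [comp_assoc h (G.tgt_inv q).symm, comp_inv, comp_unit h]

end TotalMultiplication

universe u

variable {E₀ : Type*} [NormedAddCommGroup E₀] [NormedSpace ℝ E₀]
  {E₁ : Type u} [NormedAddCommGroup E₁] [NormedSpace ℝ E₁]
  {X₀ : Type*} [TopologicalSpace X₀] [ChartedSpace E₀ X₀] [IsManifold 𝓘(ℝ, E₀) ∞ X₀]
  {X₁ : Type*} [TopologicalSpace X₁] [ChartedSpace E₁ X₁] [IsManifold 𝓘(ℝ, E₁) ∞ X₁]
  {G : ArrowGroupoid X₀ X₁}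
  {E₂ : Type*} [NormedAddCommGroup E₂] [NormedSpace ℝ E₂] [ChartedSpace E₂ G.Comp]
  [IsManifold 𝓘(ℝ, E₂) ∞ G.Comp]

section Smoothness

variable {E H M : Type*} [NormedAddCommGroup E] [NormedSpace ℝ E]
  [TopologicalSpace M] [ChartedSpace E M]

open Classical in
/-- A pair of maps into `X₁` as a map into the space of composable pairs; at points where the
values are not composable the value is the given base point `c`. -/
def pairMap (c : G.Comp) (f g : M → X₁) (y : M) : G.Comp :=
  if h : G.src (f y) = G.tgt (g y) then ⟨(f y, g y), h⟩ else c

lemma pairMap_eq {c : G.Comp} {f g : M → X₁} {y : M} (h : G.src (f y) = G.tgt (g y)) :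
    pairMap c f g y = ⟨(f y, g y), h⟩ := dif_pos h

lemma IsLie.contMDiff_src (hG : G.IsLie (E₀ := E₀) (E₁ := E₁) E₂) :
    ContMDiff 𝓘(ℝ, E₁) 𝓘(ℝ, E₀) ∞ G.src := fun p => (hG.submersion_src.isSubmersionAt p).contMDiffAt

lemma IsLie.contMDiff_tgt (hG : G.IsLie (E₀ := E₀) (E₁ := E₁) E₂) :
    ContMDiff 𝓘(ℝ, E₁) 𝓘(ℝ, E₀) ∞ G.tgt := fun p => (hG.submersion_tgt.isSubmersionAt p).contMDiffAt

lemma IsLie.contMDiff_fst (hG : G.IsLie (E₀ := E₀) (E₁ := E₁) E₂) :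
    ContMDiff 𝓘(ℝ, E₂) 𝓘(ℝ, E₁) ∞ (fun c : G.Comp => c.1.1) :=
  _root_.contMDiff_fst.comp hG.embedding_comp.isImmersion.contMDiff

lemma IsLie.contMDiff_snd (hG : G.IsLie (E₀ := E₀) (E₁ := E₁) E₂) :
    ContMDiff 𝓘(ℝ, E₂) 𝓘(ℝ, E₁) ∞ (fun c : G.Comp => c.1.2) :=
  _root_.contMDiff_snd.comp hG.embedding_comp.isImmersion.contMDiff

lemma IsLie.contMDiffAt_pairMap (hG : G.IsLie (E₀ := E₀) (E₁ := E₁) E₂) {f g : M → X₁} {x : M}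
    (c : G.Comp) (hf : ContMDiffAt 𝓘(ℝ, E) 𝓘(ℝ, E₁) ∞ f x) (hg : ContMDiffAt 𝓘(ℝ, E) 𝓘(ℝ, E₁) ∞ g x)
    (h : ∀ᶠ y in 𝓝 x, G.src (f y) = G.tgt (g y)) :
    ContMDiffAt 𝓘(ℝ, E) 𝓘(ℝ, E₂) ∞ (pairMap c f g) x := by
  have heq : (fun y => ((pairMap c f g y : G.Comp) : X₁ × X₁)) =ᶠ[𝓝 x] fun y => (f y, g y) := by
    filter_upwards [h] with y hy
    rw [pairMap_eq hy]
  have h1 : ContMDiffAt 𝓘(ℝ, E) (𝓘(ℝ, E₁).prod 𝓘(ℝ, E₁)) ∞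
      (fun y => ((pairMap c f g y : G.Comp) : X₁ × X₁)) x :=
    (hf.prodMk hg).congr_of_eventuallyEq heq
  refine (ContMDiffAt.iff_comp_isImmersionAt
    (hG.embedding_comp.isImmersion.isImmersionAt (pairMap c f g x))).mpr ⟨?_, h1⟩
  exact hG.embedding_comp.isEmbedding.isInducing.continuousAt_iff.mpr h1.continuousAt

lemma IsLie.contMDiffAt_comp (hG : G.IsLie (E₀ := E₀) (E₁ := E₁) E₂) {f g : M → X₁} {x : M}
    (hf : ContMDiffAt 𝓘(ℝ, E) 𝓘(ℝ, E₁) ∞ f x) (hg : ContMDiffAt 𝓘(ℝ, E) 𝓘(ℝ, E₁) ∞ g x)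
    (h : ∀ᶠ y in 𝓝 x, G.src (f y) = G.tgt (g y)) :
    ContMDiffAt 𝓘(ℝ, E) 𝓘(ℝ, E₁) ∞ (fun y => G.comp (f y) (g y)) x := by
  have hp := hG.contMDiffAt_pairMap ⟨(f x, g x), h.self_of_nhds⟩ hf hg h
  refine (hG.smooth_mul.contMDiffAt.comp x hp).congr_of_eventuallyEq ?_
  filter_upwards [h] with y hy
  rw [comp_eq hy, Function.comp_apply, pairMap_eq hy]

end Smoothness

section TangentMultiplication

/-- The derivatives of the two projections of a space of composable pairs, jointly. -/
def pairDeriv (E₁ E₂ : Type*) [NormedAddCommGroup E₁] [NormedSpace ℝ E₁] [NormedAddCommGroup E₂]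
    [NormedSpace ℝ E₂] {X₀ X₁ : Type*} {G : ArrowGroupoid X₀ X₁} [TopologicalSpace X₁]
    [ChartedSpace E₁ X₁] [ChartedSpace E₂ G.Comp] (c : G.Comp) : E₂ →L[ℝ] E₁ × E₁ :=
  (tderiv E₂ E₁ (fun d : G.Comp => d.1.1) c).prod (tderiv E₂ E₁ (fun d : G.Comp => d.1.2) c)

lemma isTangentPair_iff {c : G.Comp} {w w' : E₁} {z : E₂} :
    G.IsTangentPair E₂ c w w' z ↔ pairDeriv E₁ E₂ c z = (w, w') :=
  Prod.mk_inj.symm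

lemma IsLie.injective_pairDeriv (hG : G.IsLie (E₀ := E₀) (E₁ := E₁) E₂) (c : G.Comp) :
    Function.Injective (pairDeriv E₁ E₂ c) := by
  have hι := hG.embedding_comp.isImmersion.isImmersionAt c
  refine (injective_iff_map_eq_zero (pairDeriv E₁ E₂ c)).mpr fun z hz => ?_
  have hz1 : tderiv E₂ E₁ (fun d : G.Comp => d.1.1) c z = 0 := congrArg Prod.fst hz
  have hz2 : tderiv E₂ E₁ (fun d : G.Comp => d.1.2) c z = 0 := congrArg Prod.snd hz
  have hc := hι.mem_domChart_source
  have hψ : ContMDiffAt (𝓘(ℝ, E₁).prod 𝓘(ℝ, E₁)) 𝓘(ℝ, E₁ × E₁) ∞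
      (hι.codChart.extend (𝓘(ℝ, E₁).prod 𝓘(ℝ, E₁))) c.1 := by
    exact hι.codChart.contMDiffAt_extend hι.codChart_mem_maximalAtlas hι.mem_codChart_source
  -- a smooth left inverse of the inclusion, written in a chart of the space of pairs
  have hk : MDifferentiableAt (𝓘(ℝ, E₁).prod 𝓘(ℝ, E₁)) 𝓘(ℝ, E₂)
      (fun y => (hι.equiv.symm (hι.codChart.extend (𝓘(ℝ, E₁).prod 𝓘(ℝ, E₁)) y)).1) c.1 := by
    have h1 := (contDiff_fst.comp hι.equiv.symm.contDiff).contMDiff.contMDiffAt.comp c.1 hψ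
    exact h1.mdifferentiableAt (by simp)
  have hpair : HasMFDerivAt 𝓘(ℝ, E₂) (𝓘(ℝ, E₁).prod 𝓘(ℝ, E₁)) (fun d : G.Comp => (d.1.1, d.1.2)) c
      (ContinuousLinearMap.prod (tderiv E₂ E₁ (fun d : G.Comp => d.1.1) c)
        (tderiv E₂ E₁ (fun d : G.Comp => d.1.2) c)) :=
    HasMFDerivAt.prodMk (hG.contMDiff_fst.hasTDerivAt c) (hG.contMDiff_snd.hasTDerivAt c)
  obtain ⟨K, hK⟩ : ∃ K : E₁ × E₁ →L[ℝ] E₂, HasMFDerivAt (𝓘(ℝ, E₁).prod 𝓘(ℝ, E₁)) 𝓘(ℝ, E₂)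
      (fun y => (hι.equiv.symm (hι.codChart.extend (𝓘(ℝ, E₁).prod 𝓘(ℝ, E₁)) y)).1) c.1 K :=
    ⟨_, hk.hasMFDerivAt⟩
  have hcomp := HasMFDerivAt.comp c hK hpair
  have hdom : ContMDiffAt 𝓘(ℝ, E₂) 𝓘(ℝ, E₂) ∞ hι.domChart c :=
    (contMDiffOn_of_mem_maximalAtlas hι.domChart_mem_maximalAtlas).contMDiffAt
      (hι.domChart.open_source.mem_nhds hc)
  have hdom' : ContMDiffAt 𝓘(ℝ, E₂) 𝓘(ℝ, E₂) ∞ hι.domChart.symm (hι.domChart c) :=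
    (contMDiffOn_symm_of_mem_maximalAtlas hι.domChart_mem_maximalAtlas).contMDiffAt
      (hι.domChart.open_target.mem_nhds (hι.domChart.map_source hc))
  have hd := hdom.hasTDerivAt (by simp)
  have hd0 : tderiv E₂ E₂ hι.domChart c z = 0 := by
    have heq : (hι.domChart : G.Comp → E₂) =ᶠ[𝓝 c] (fun d : G.Comp =>
        (hι.equiv.symm (hι.codChart.extend (𝓘(ℝ, E₁).prod 𝓘(ℝ, E₁)) (d.1.1, d.1.2))).1) := by
      filter_upwards [hι.domChart.open_source.mem_nhds hc] with d hd
      have h0 : hι.domChart d ∈ (hι.domChart.extend 𝓘(ℝ, E₂)).target := by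
        simpa using hι.domChart.map_source hd
      have h := hι.writtenInCharts h0
      simp only [Function.comp_apply, OpenPartialHomeomorph.extend_coe_symm,
        modelWithCornersSelf_coe_symm, id_eq, hι.domChart.left_inv hd] at h
      have h' : hι.codChart.extend (𝓘(ℝ, E₁).prod 𝓘(ℝ, E₁)) (d.1.1, d.1.2) =
        hι.equiv (hι.domChart d, 0) := h
      rw [h', ContinuousLinearEquiv.symm_apply_apply]
    have h1 := HasTDerivAt.unique hd (HasMFDerivAt.congr_of_eventuallyEq hcomp heq)
    rw [h1]
    exact (congrArg K hz).trans (map_zero K)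
  have hid : HasTDerivAt (fun d => hι.domChart.symm (hι.domChart d)) (ContinuousLinearMap.id ℝ E₂) c := by
    refine (hasTDerivAt_id c).congr_of_eventuallyEq ?_
    filter_upwards [hι.domChart.open_source.mem_nhds hc] with d hd using hι.domChart.left_inv hd
  have h3 := HasTDerivAt.unique hid (HasTDerivAt.comp (hdom'.hasTDerivAt (by simp)) hd)
  have h4 := congrArg (fun L : E₂ →L[ℝ] E₂ => L z) h3
  simpa [hd0] using h4

open Classical in
/-- The multiplication of the tangent groupoid, in terms of the model space, extended by zero to
pairs of arrows that are not composable. -/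
def tmul (G : ArrowGroupoid X₀ X₁) (E₂ : Type*) [NormedAddCommGroup E₂] [NormedSpace ℝ E₂]
    [ChartedSpace E₂ G.Comp] (p q : X₁) (w w' : E₁) : E₁ :=
  if h : G.src p = G.tgt q then G.tangentMul E₂ ⟨(p, q), h⟩ w w' else 0

lemma tmul_eq (p q : X₁) (h : G.src p = G.tgt q) (w w' : E₁) :
    G.tmul E₂ p q w w' = G.tangentMul E₂ ⟨(p, q), h⟩ w w' := dif_pos h

lemma IsLie.tangentMul_pairDeriv (hG : G.IsLie (E₀ := E₀) (E₁ := E₁) E₂) (c : G.Comp) (z : E₂) :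
    G.tmul E₂ c.1.1 c.1.2 (pairDeriv E₁ E₂ c z).1 (pairDeriv E₁ E₂ c z).2 =
      tderiv E₂ E₁ G.mul c z := by
  have hex : ∃ z' : E₂, G.IsTangentPair E₂ c (pairDeriv E₁ E₂ c z).1 (pairDeriv E₁ E₂ c z).2 z' :=
    ⟨z, isTangentPair_iff.mpr rfl⟩
  rw [tmul_eq _ _ c.2]
  refine (dif_pos hex).trans ?_
  have h1 : hex.choose = z := hG.injective_pairDeriv c (isTangentPair_iff.mp hex.choose_spec)
  exact congrArg (tderiv E₂ E₁ G.mul c) h1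

/-- The derivative of a product of two maps into `X₁`. -/
lemma IsLie.hasTDerivAt_comp (hG : G.IsLie (E₀ := E₀) (E₁ := E₁) E₂)
    {E M : Type*} [NormedAddCommGroup E] [NormedSpace ℝ E]
    [TopologicalSpace M] [ChartedSpace E M] {f g : M → X₁} {x : M}
    (hf : ContMDiffAt 𝓘(ℝ, E) 𝓘(ℝ, E₁) ∞ f x) (hg : ContMDiffAt 𝓘(ℝ, E) 𝓘(ℝ, E₁) ∞ g x)
    (h : ∀ᶠ y in 𝓝 x, G.src (f y) = G.tgt (g y)) :
    (∃ L : E →L[ℝ] E₂, ∀ w, pairDeriv E₁ E₂ ⟨(f x, g x), h.self_of_nhds⟩ (L w) =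
      (tderiv E E₁ f x w, tderiv E E₁ g x w)) ∧
    ∀ w, tderiv E E₁ (fun y => G.comp (f y) (g y)) x w =
      G.tmul E₂ (f x) (g x) (tderiv E E₁ f x w) (tderiv E E₁ g x w) := by
  have hx := h.self_of_nhds
  set c : G.Comp := ⟨(f x, g x), hx⟩ with hc
  have hP := (hG.contMDiffAt_pairMap c hf hg h).hasTDerivAt (by simp)
  have hPx : pairMap c f g x = c := pairMap_eq hx
  set L := tderiv E E₂ (pairMap c f g) x with hL
  have h1 : HasTDerivAt f ((tderiv E₂ E₁ (fun d : G.Comp => d.1.1) c).comp L) x := by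
    have h1 := (hG.contMDiff_fst.hasTDerivAt (pairMap c f g x)).congr_deriv
      (L' := tderiv E₂ E₁ (fun d : G.Comp => d.1.1) c) (by rw [hPx])
    refine (HasTDerivAt.comp h1 hP).congr_of_eventuallyEq ?_
    filter_upwards [h] with y hy
    rw [pairMap_eq hy]
  have h2 : HasTDerivAt g ((tderiv E₂ E₁ (fun d : G.Comp => d.1.2) c).comp L) x := by
    have h1 := (hG.contMDiff_snd.hasTDerivAt (pairMap c f g x)).congr_deriv
      (L' := tderiv E₂ E₁ (fun d : G.Comp => d.1.2) c) (by rw [hPx])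
    refine (HasTDerivAt.comp h1 hP).congr_of_eventuallyEq ?_
    filter_upwards [h] with y hy
    rw [pairMap_eq hy]
  have hw : ∀ w, pairDeriv E₁ E₂ c (L w) = (tderiv E E₁ f x w, tderiv E E₁ g x w) := by
    intro w
    rw [h1.tderiv_eq, h2.tderiv_eq]
    rfl
  refine ⟨⟨L, hw⟩, fun w => ?_⟩
  have h3 : HasTDerivAt (fun y => G.comp (f y) (g y)) ((tderiv E₂ E₁ G.mul c).comp L) x := by
    have h1 := (hG.smooth_mul.hasTDerivAt (pairMap c f g x)).congr_deriv
      (L' := tderiv E₂ E₁ G.mul c) (by rw [hPx])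
    refine (HasTDerivAt.comp h1 hP).congr_of_eventuallyEq ?_
    filter_upwards [h] with y hy
    rw [pairMap_eq hy, comp_eq hy]
  rw [h3.tderiv_eq, ContinuousLinearMap.comp_apply, ← hG.tangentMul_pairDeriv, hw]

lemma IsLie.hasTDerivAt_src (hG : G.IsLie (E₀ := E₀) (E₁ := E₁) E₂) (p : X₁) :
    HasTDerivAt G.src (tderiv E₁ E₀ G.src p) p := hG.contMDiff_src.hasTDerivAt p

lemma IsLie.hasTDerivAt_tgt (hG : G.IsLie (E₀ := E₀) (E₁ := E₁) E₂) (p : X₁) :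
    HasTDerivAt G.tgt (tderiv E₁ E₀ G.tgt p) p := hG.contMDiff_tgt.hasTDerivAt p

lemma IsLie.hasTDerivAt_inv (hG : G.IsLie (E₀ := E₀) (E₁ := E₁) E₂) (p : X₁) :
    HasTDerivAt G.inv (tderiv E₁ E₁ G.inv p) p := hG.smooth_inv.hasTDerivAt p

lemma IsLie.tderiv_src_inv (hG : G.IsLie (E₀ := E₀) (E₁ := E₁) E₂) (p : X₁) (w : E₁) :
    tderiv E₁ E₀ G.src (G.inv p) (tderiv E₁ E₁ G.inv p w) = tderiv E₁ E₀ G.tgt p w := by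
  have h := (hG.hasTDerivAt_src (G.inv p)).comp (hG.hasTDerivAt_inv p)
  simp only [G.src_inv] at h
  exact congrArg (fun L : E₁ →L[ℝ] E₀ => L w) (h.unique (hG.hasTDerivAt_tgt p))

lemma IsLie.tderiv_tgt_inv (hG : G.IsLie (E₀ := E₀) (E₁ := E₁) E₂) (p : X₁) (w : E₁) :
    tderiv E₁ E₀ G.tgt (G.inv p) (tderiv E₁ E₁ G.inv p w) = tderiv E₁ E₀ G.src p w := by
  have h := (hG.hasTDerivAt_tgt (G.inv p)).comp (hG.hasTDerivAt_inv p)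
  simp only [G.tgt_inv] at h
  exact congrArg (fun L : E₁ →L[ℝ] E₀ => L w) (h.unique (hG.hasTDerivAt_src p))

lemma IsLie.tderiv_inv_inv (hG : G.IsLie (E₀ := E₀) (E₁ := E₁) E₂) (p : X₁) (w : E₁) :
    tderiv E₁ E₁ G.inv (G.inv p) (tderiv E₁ E₁ G.inv p w) = w := by
  have h := (hG.hasTDerivAt_inv (G.inv p)).comp (hG.hasTDerivAt_inv p)
  simp only [inv_inv] at h
  exact congrArg (fun L : E₁ →L[ℝ] E₁ => L w) (h.unique (hasTDerivAt_id p))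

/-- Composable tangent vectors are the velocities of curves of composable arrows. -/
lemma IsLie.exists_composable_curves (hG : G.IsLie (E₀ := E₀) (E₁ := E₁) E₂) {p q : X₁}
    (h : G.src p = G.tgt q) {w w' : E₁} (hw : tderiv E₁ E₀ G.src p w = tderiv E₁ E₀ G.tgt q w') :
    ∃ c d : ℝ → X₁, ContMDiffAt 𝓘(ℝ, ℝ) 𝓘(ℝ, E₁) ∞ c 0 ∧ ContMDiffAt 𝓘(ℝ, ℝ) 𝓘(ℝ, E₁) ∞ d 0 ∧
      c 0 = p ∧ d 0 = q ∧ HasVelocityAt c w 0 ∧ HasVelocityAt d w' 0 ∧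
      ∀ ε, G.src (c ε) = G.tgt (d ε) := by
  obtain ⟨c, hc, hcc⟩ := exists_common_curves (ι := Bool) hG.submersion_src
    (p := fun i => cond i p (G.inv q)) (w := fun i => cond i w (tderiv E₁ E₁ G.inv q w'))
    (x := G.src p) (u := tderiv E₁ E₀ G.src p w)
    (by rintro (_ | _); exacts [(G.src_inv q).trans h.symm, rfl])
    (by rintro (_ | _); exacts [(hG.tderiv_src_inv q w').trans hw.symm, rfl])
  obtain ⟨h1, h2, h3⟩ := hc true
  obtain ⟨h1', h2', h3'⟩ := hc false
  simp only [cond_true, cond_false] at h2 h3 h2' h3'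
  refine ⟨c true, fun ε => G.inv (c false ε), h1, hG.smooth_inv.contMDiffAt.comp 0 h1', h2, ?_, h3,
    ?_, fun ε => (hcc true false ε).trans (G.tgt_inv _).symm⟩
  · simp only [h2', inv_inv]
  · have := HasVelocityAt.comp_left (hG.hasTDerivAt_inv (c false 0)) h3'
    rwa [h2', hG.tderiv_inv_inv] at this

/-- The tangent multiplication is the derivative of the multiplication of curves. -/
lemma IsLie.hasVelocityAt_comp (hG : G.IsLie (E₀ := E₀) (E₁ := E₁) E₂) {c d : ℝ → X₁} {w w' : E₁}
    (hc : ContMDiffAt 𝓘(ℝ, ℝ) 𝓘(ℝ, E₁) ∞ c 0) (hd : ContMDiffAt 𝓘(ℝ, ℝ) 𝓘(ℝ, E₁) ∞ d 0)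
    (hw : HasVelocityAt c w 0) (hw' : HasVelocityAt d w' 0) (h : ∀ ε, G.src (c ε) = G.tgt (d ε)) :
    HasVelocityAt (fun ε => G.comp (c ε) (d ε)) (G.tmul E₂ (c 0) (d 0) w w') 0 := by
  have h1 := (hG.contMDiffAt_comp hc hd (.of_forall h)).hasTDerivAt (by simp)
  have h2 := (hG.hasTDerivAt_comp hc hd (.of_forall h)).2 1
  rw [HasVelocityAt.tderiv_eq hw, HasVelocityAt.tderiv_eq hw'] at h2
  refine HasTDerivAt.congr_deriv h1 ?_
  ext
  simpa using h2

/-- On composable tangent vectors over a fixed pair of arrows the tangent multiplication is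
linear. -/
lemma IsLie.exists_tmul_eq [FiniteDimensional ℝ E₁] (hG : G.IsLie (E₀ := E₀) (E₁ := E₁) E₂)
    {p q : X₁} (h : G.src p = G.tgt q) :
    ∃ L : E₁ × E₁ →L[ℝ] E₁, ∀ w w' : E₁, tderiv E₁ E₀ G.src p w = tderiv E₁ E₀ G.tgt q w' →
      G.tmul E₂ p q w w' = L (w, w') := by
  obtain ⟨g, hg⟩ := LinearMap.exists_leftInverse_of_injective
    (pairDeriv E₁ E₂ (⟨(p, q), h⟩ : G.Comp)).toLinearMap
    (LinearMap.ker_eq_bot.mpr (hG.injective_pairDeriv _))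
  refine ⟨LinearMap.toContinuousLinearMap
    ((tderiv E₂ E₁ G.mul (⟨(p, q), h⟩ : G.Comp)).toLinearMap.comp g), fun w w' hw => ?_⟩
  obtain ⟨c, d, hc, hd, rfl, rfl, hcw, hdw, hcd⟩ := hG.exists_composable_curves h hw
  obtain ⟨L, hL⟩ := (hG.hasTDerivAt_comp hc hd (.of_forall hcd)).1
  have h1 := hL 1
  rw [HasVelocityAt.tderiv_eq hcw, HasVelocityAt.tderiv_eq hdw] at h1
  have h2 : g (w, w') = L 1 := by
    have := congrArg (fun T : E₂ →ₗ[ℝ] E₂ => T (L 1)) hg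
    simpa [h1] using this
  have h3 := hG.tangentMul_pairDeriv (⟨(c 0, d 0), h⟩ : G.Comp) (L 1)
  rw [h1] at h3
  simp [h2, h3]

lemma IsLie.tderiv_src_tmul (hG : G.IsLie (E₀ := E₀) (E₁ := E₁) E₂) {p q : X₁}
    (h : G.src p = G.tgt q) {w w' : E₁} (hw : tderiv E₁ E₀ G.src p w = tderiv E₁ E₀ G.tgt q w') :
    tderiv E₁ E₀ G.src (G.comp p q) (G.tmul E₂ p q w w') = tderiv E₁ E₀ G.src q w' := by
  obtain ⟨c, d, hc, hd, rfl, rfl, hcw, hdw, hcd⟩ := hG.exists_composable_curves h hw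
  have h1 := HasVelocityAt.comp_left (hG.hasTDerivAt_src _) (hG.hasVelocityAt_comp hc hd hcw hdw hcd)
  simp only [src_comp (hcd _)] at h1
  exact h1.unique (HasVelocityAt.comp_left (hG.hasTDerivAt_src _) hdw)

lemma IsLie.tderiv_tgt_tmul (hG : G.IsLie (E₀ := E₀) (E₁ := E₁) E₂) {p q : X₁}
    (h : G.src p = G.tgt q) {w w' : E₁} (hw : tderiv E₁ E₀ G.src p w = tderiv E₁ E₀ G.tgt q w') :
    tderiv E₁ E₀ G.tgt (G.comp p q) (G.tmul E₂ p q w w') = tderiv E₁ E₀ G.tgt p w := by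
  obtain ⟨c, d, hc, hd, rfl, rfl, hcw, hdw, hcd⟩ := hG.exists_composable_curves h hw
  have h1 := HasVelocityAt.comp_left (hG.hasTDerivAt_tgt _) (hG.hasVelocityAt_comp hc hd hcw hdw hcd)
  simp only [tgt_comp (hcd _)] at h1
  exact h1.unique (HasVelocityAt.comp_left (hG.hasTDerivAt_tgt _) hcw)

/-- The division `(w, w') ↦ w w'⁻¹` of the tangent groupoid, over the arrows `p` and `q`. -/
def tdiv (G : ArrowGroupoid X₀ X₁) (E₂ : Type*) [NormedAddCommGroup E₂] [NormedSpace ℝ E₂]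
    [ChartedSpace E₂ G.Comp] (p q : X₁) (w w' : E₁) : E₁ :=
  G.tmul E₂ p (G.inv q) w (tderiv E₁ E₁ G.inv q w')

lemma IsLie.tderiv_src_tdiv (hG : G.IsLie (E₀ := E₀) (E₁ := E₁) E₂) {p q : X₁}
    (h : G.src p = G.src q) {w w' : E₁} (hw : tderiv E₁ E₀ G.src p w = tderiv E₁ E₀ G.src q w') :
    tderiv E₁ E₀ G.src (G.comp p (G.inv q)) (G.tdiv E₂ p q w w') = tderiv E₁ E₀ G.tgt q w' := by
  rw [tdiv, hG.tderiv_src_tmul (h.trans (G.tgt_inv q).symm)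
    (hw.trans (hG.tderiv_tgt_inv q w').symm), hG.tderiv_src_inv]

lemma IsLie.tderiv_tgt_tdiv (hG : G.IsLie (E₀ := E₀) (E₁ := E₁) E₂) {p q : X₁}
    (h : G.src p = G.src q) {w w' : E₁} (hw : tderiv E₁ E₀ G.src p w = tderiv E₁ E₀ G.src q w') :
    tderiv E₁ E₀ G.tgt (G.comp p (G.inv q)) (G.tdiv E₂ p q w w') = tderiv E₁ E₀ G.tgt p w := by
  rw [tdiv, hG.tderiv_tgt_tmul (h.trans (G.tgt_inv q).symm)
    (hw.trans (hG.tderiv_tgt_inv q w').symm)]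

/-- `(α β⁻¹)(β γ⁻¹) = α γ⁻¹` in the tangent groupoid. -/
lemma IsLie.tmul_tdiv_tdiv (hG : G.IsLie (E₀ := E₀) (E₁ := E₁) E₂) {p : Fin 3 → X₁} {w : Fin 3 → E₁}
    {x : X₀} {u : E₀} (hp : ∀ i, G.src (p i) = x) (hw : ∀ i, tderiv E₁ E₀ G.src (p i) (w i) = u) :
    G.tmul E₂ (G.comp (p 0) (G.inv (p 1))) (G.comp (p 1) (G.inv (p 2)))
        (G.tdiv E₂ (p 0) (p 1) (w 0) (w 1)) (G.tdiv E₂ (p 1) (p 2) (w 1) (w 2)) =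
      G.tdiv E₂ (p 0) (p 2) (w 0) (w 2) := by
  obtain ⟨c, hc, hcc⟩ := exists_common_curves hG.submersion_src hp hw
  obtain rfl : (fun i => c i 0) = p := funext fun i => (hc i).2.1
  have hinv : ∀ i, ContMDiffAt 𝓘(ℝ, ℝ) 𝓘(ℝ, E₁) ∞ (fun ε => G.inv (c i ε)) 0 := fun i =>
    hG.smooth_inv.contMDiffAt.comp 0 (hc i).1
  have hdiv : ∀ i j ε, G.src (c i ε) = G.tgt (G.inv (c j ε)) := fun i j ε =>
    (hcc i j ε).trans (G.tgt_inv _).symm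
  have hs : ∀ i j, ContMDiffAt 𝓘(ℝ, ℝ) 𝓘(ℝ, E₁) ∞ (fun ε => G.comp (c i ε) (G.inv (c j ε))) 0 :=
    fun i j => hG.contMDiffAt_comp (hc i).1 (hinv j) (.of_forall (hdiv i j))
  have hv : ∀ i j, HasVelocityAt (fun ε => G.comp (c i ε) (G.inv (c j ε)))
      (G.tdiv E₂ (c i 0) (c j 0) (w i) (w j)) 0 := fun i j =>
    hG.hasVelocityAt_comp (hc i).1 (hinv j) (hc i).2.2
      (HasVelocityAt.comp_left (hG.hasTDerivAt_inv _) (hc j).2.2) (hdiv i j)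
  have h1 := hG.hasVelocityAt_comp (hs 0 1) (hs 1 2) (hv 0 1) (hv 1 2) fun ε => by
    rw [src_comp (hdiv 0 1 ε), tgt_comp (hdiv 1 2 ε), G.src_inv]
  simp only [comp_comp_inv_comp_inv (hcc 0 1 _) (hcc 1 2 _)] at h1
  exact h1.unique (hv 0 2)

/-- Tangent vectors to the source fibres are mapped by `dt` into the tangent spaces of the
orbits. -/
lemma IsLie.tderiv_tgt_mem_orbitTangent (hG : G.IsLie (E₀ := E₀) (E₁ := E₁) E₂) {p : X₁} {k : E₁}
    (hk : tderiv E₁ E₀ G.src p k = 0) :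
    tderiv E₁ E₀ G.tgt p k ∈ G.orbitTangent (E₀ := E₀) (E₁ := E₁) (G.tgt p) := by
  have hk' : tderiv E₁ E₀ G.src p k = tderiv E₁ E₀ G.src p 0 := by rw [hk, map_zero]
  have h1 := hG.tderiv_src_tdiv rfl hk'
  have h2 := hG.tderiv_tgt_tdiv rfl hk'
  rw [comp_inv, map_zero] at h1
  rw [comp_inv] at h2
  exact ⟨_, h1, h2⟩

end TangentMultiplication

end ArrowGroupoid

/-! ### Orthogonal projections for a varying inner product -/

section VaryingInnerProduct

variable {E : Type*} [NormedAddCommGroup E] [NormedSpace ℝ E] [FiniteDimensional ℝ E]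
  {F : Type*} [NormedAddCommGroup F] [NormedSpace ℝ F]

lemma differentiableAt_clm_of_apply {f : ℝ → E →L[ℝ] F} {t : ℝ}
    (h : ∀ a, DifferentiableAt ℝ (fun s => f s a) t) : DifferentiableAt ℝ f t := by
  let e₁ : (Fin (Module.finrank ℝ E) → ℝ) ≃L[ℝ] E :=
    ContinuousLinearEquiv.ofFinrankEq (Module.finrank_fin_fun ℝ)
  let e₂ := (e₁.symm.arrowCongr (1 : F ≃L[ℝ] F)).trans
    (ContinuousLinearEquiv.piRing (𝕜 := ℝ) (E := F) (Fin (Module.finrank ℝ E)))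
  have h1 : DifferentiableAt ℝ (fun s => e₂ (f s)) t := differentiableAt_pi.mpr fun i => h _
  have h2 := (e₂.symm : _ →L[ℝ] (E →L[ℝ] F)).differentiableAt.comp t h1
  simpa [Function.comp_def] using h2

lemma DifferentiableAt.clm_inverse_apply {V W : Type*} [NormedAddCommGroup V] [NormedSpace ℝ V]
    [CompleteSpace V] [NormedAddCommGroup W] [NormedSpace ℝ W] {T : ℝ → V →L[ℝ] W} {r : ℝ → W}
    {t : ℝ} (hT : DifferentiableAt ℝ T t) (hr : DifferentiableAt ℝ r t) {e : V ≃L[ℝ] W}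
    (he : (e : V →L[ℝ] W) = T t) :
    DifferentiableAt ℝ (fun s => ContinuousLinearMap.inverse (T s) (r s)) t := by
  have h1 : DifferentiableAt ℝ (ContinuousLinearMap.inverse : (V →L[ℝ] W) → (W →L[ℝ] V)) (T t) :=
    he ▸ (contDiffAt_map_inverse (n := 1) e).differentiableAt (by simp)
  exact (h1.comp t hT).clm_apply hr

lemma exists_hasDerivAt_clm_of_apply {f : ℝ → E →L[ℝ] F} {t : ℝ}
    (h : ∀ a, ∃ l, HasDerivAt (fun s => f s a) l t) : ∃ L : E →L[ℝ] F, HasDerivAt f L t :=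
  ⟨_, (differentiableAt_clm_of_apply fun a => (h a).choose_spec.differentiableAt).hasDerivAt⟩

lemma HasDerivAt.bilin_apply {g : ℝ → E →L[ℝ] E →L[ℝ] ℝ} {g' : E →L[ℝ] E →L[ℝ] ℝ}
    {A B : ℝ → E} {t : ℝ} {a b : E} (hg : HasDerivAt g g' t) (hA : HasDerivAt A a t)
    (hB : HasDerivAt B b t) :
    HasDerivAt (fun s => g s (A s) (B s)) (g' (A t) (B t) + g t a (B t) + g t (A t) b) t :=
  ((hg.clm_apply hA).clm_apply hB).congr_deriv (by simp)

open ContinuousLinearMap in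
/-- For a differentiable family of inner products `g`, the inner product of the `g`-orthogonal
projections of two fixed vectors to the `g`-orthogonal complement of a fixed subspace, the range of
`i`, is differentiable, and only the derivative of `g` contributes to its derivative: the
derivatives of the projections lie in the subspace. -/
lemma exists_orthogonal_projections {V : Type*} [NormedAddCommGroup V] [NormedSpace ℝ V]
    [FiniteDimensional ℝ V] (i : V →L[ℝ] E) (hi : Function.Injective i)
    {g : ℝ → E →L[ℝ] E →L[ℝ] ℝ} {J : Set ℝ}
    (hsymm : ∀ σ ∈ J, ∀ a b, g σ a b = g σ b a)
    (hpos : ∀ σ ∈ J, ∀ a, a ≠ 0 → 0 < g σ a a)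
    (hd : ∀ σ ∈ J, ∀ a b, DifferentiableAt ℝ (fun t => g t a b) σ) :
    ∃ s : ℝ → E → V, ∀ σ ∈ J,
      (∀ w k, g σ (w - i (s σ w)) (i k) = 0) ∧
      ∀ w₁ w₂, HasDerivAt (fun t => g t (w₁ - i (s t w₁)) (w₂ - i (s t w₂)))
        (deriv (fun t => g t (w₁ - i (s σ w₁)) (w₂ - i (s σ w₂))) σ) σ := by
  have hgd : ∀ σ ∈ J, ∃ g' : E →L[ℝ] E →L[ℝ] ℝ, HasDerivAt g g' σ := fun σ hσ =>
    exists_hasDerivAt_clm_of_apply (F := E →L[ℝ] ℝ) fun a =>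
      exists_hasDerivAt_clm_of_apply (F := ℝ) fun b => ⟨_, (hd σ hσ a b).hasDerivAt⟩
  -- the values of a functional on a basis of `V`
  let b := Module.finBasis ℝ V
  let T : ℝ → V →L[ℝ] (Fin (Module.finrank ℝ V) → ℝ) := fun σ =>
    ContinuousLinearMap.pi fun j => ((g σ).flip (i (b j))).comp i
  have hT : ∀ σ k j, T σ k j = g σ (i k) (i (b j)) := fun _ _ _ => rfl
  let r : E → ℝ → Fin (Module.finrank ℝ V) → ℝ := fun w σ j => g σ w (i (b j))
  have hb : ∀ (σ : ℝ) (w : E), (∀ j, g σ w (i (b j)) = 0) → ∀ k, g σ w (i k) = 0 := by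
    intro σ w h k
    have : ((g σ w).comp i).toLinearMap = 0 := b.ext h
    exact congrArg (fun L : V →ₗ[ℝ] ℝ => L k) this
  have hTe : ∀ σ ∈ J, ∃ e : V ≃L[ℝ] (Fin (Module.finrank ℝ V) → ℝ),
      (e : V →L[ℝ] (Fin (Module.finrank ℝ V) → ℝ)) = T σ := by
    intro σ hσ
    have hinj : Function.Injective (T σ).toLinearMap := by
      refine (injective_iff_map_eq_zero _).mpr fun k hk => ?_
      by_contra hne
      have h1 := hpos σ hσ (i k) (fun h0 => hne (hi (h0.trans (map_zero i).symm)))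
      exact h1.ne' (hb σ (i k) (fun j => congrFun hk j) k)
    refine ⟨(LinearEquiv.ofInjectiveOfFinrankEq (T σ).toLinearMap hinj
      (Module.finrank_fin_fun ℝ).symm).toContinuousLinearEquiv, ?_⟩
    ext; rfl
  let s : ℝ → E → V := fun σ w => inverse (T σ) (r w σ)
  have horth : ∀ σ ∈ J, ∀ w k, g σ (w - i (s σ w)) (i k) = 0 := by
    intro σ hσ w
    obtain ⟨e, he⟩ := hTe σ hσ
    have h1 : T σ (s σ w) = r w σ := by
      simp only [s, ← he, inverse_equiv, ContinuousLinearEquiv.coe_coe,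
        ContinuousLinearEquiv.apply_symm_apply]
    refine hb σ _ fun j => ?_
    have h2 : g σ (i (s σ w)) (i (b j)) = g σ w (i (b j)) := congrFun h1 j
    rw [map_sub, sub_apply, h2, sub_self]
  have hsd : ∀ σ ∈ J, ∀ w, DifferentiableAt ℝ (fun t => s t w) σ := by
    intro σ hσ w
    obtain ⟨e, he⟩ := hTe σ hσ
    exact DifferentiableAt.clm_inverse_apply
      (differentiableAt_clm_of_apply fun k => differentiableAt_pi.mpr fun j => hd σ hσ _ _)
      (differentiableAt_pi.mpr fun j => hd σ hσ _ _) he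
  refine ⟨s, fun σ hσ => ⟨horth σ hσ, fun w₁ w₂ => ?_⟩⟩
  have hn : ∀ w, HasDerivAt (fun t => w - i (s t w)) (-(i (deriv (fun t => s t w) σ))) σ :=
    fun w => (i.hasFDerivAt.comp_hasDerivAt σ (hsd σ hσ w).hasDerivAt).const_sub w
  obtain ⟨g', hg'⟩ := hgd σ hσ
  have h0 := HasDerivAt.bilin_apply hg' (hasDerivAt_const σ (w₁ - i (s σ w₁)))
    (hasDerivAt_const σ (w₂ - i (s σ w₂)))
  refine (HasDerivAt.bilin_apply hg' (hn w₁) (hn w₂)).congr_deriv ?_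
  rw [h0.deriv, map_neg, map_neg, neg_apply, horth σ hσ w₁, hsymm σ hσ _ (w₂ - _), horth σ hσ w₂,
    map_zero, map_zero, zero_apply, neg_zero]

end VaryingInnerProduct

/-! ### Infinitesimal characterization of transversally isometric flows -/

section Restriction

variable {E : Type*} [NormedAddCommGroup E] [NormedSpace ℝ E]
  {M : Type*} [TopologicalSpace M] [ChartedSpace E M] [IsManifold 𝓘(ℝ, E) ∞ M]

lemma IsLocalFlow.mono {v : SmoothVectorField E M} {J J' : Set ℝ} {U U' : Set M} {φ : ℝ → M → M}
    (h : IsLocalFlow v J U φ) (hJ : J' ⊆ J) (hU : U' ⊆ U) (hJ' : IsOpen J')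
    (hJc : IsPreconnected J') (h0 : (0 : ℝ) ∈ J') (hU' : IsOpen U') : IsLocalFlow v J' U' φ :=
  ⟨hJ', hJc, h0, hU', fun x hx => ⟨(h.2.2.2.2.1 x (hU hx)).1,
    (h.2.2.2.2.1 x (hU hx)).2.mono hJ⟩, h.2.2.2.2.2.mono (Set.prod_mono hJ hU)⟩

lemma IsLocalFlow.tderiv_zero {v : SmoothVectorField E M} {J : Set ℝ} {U : Set M} {φ : ℝ → M → M}
    (h : IsLocalFlow v J U φ) {x : M} (hx : x ∈ U) :
    φ 0 x = x ∧ tderiv E E (φ 0) x = ContinuousLinearMap.id ℝ E := by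
  refine ⟨(h.2.2.2.2.1 x hx).1, ?_⟩
  have heq : φ 0 =ᶠ[𝓝 x] fun y => y := by
    filter_upwards [h.2.2.2.1.mem_nhds hx] with y hy using (h.2.2.2.2.1 y hy).1
  exact (tderiv_congr_of_eventuallyEq heq).trans (hasTDerivAt_id x).tderiv_eq

end Restriction

namespace ArrowGroupoid

open Set

universe u

variable {E₀ : Type*} [NormedAddCommGroup E₀] [NormedSpace ℝ E₀]
  {E₁ : Type u} [NormedAddCommGroup E₁] [NormedSpace ℝ E₁]
  {X₀ : Type*} [TopologicalSpace X₀] [ChartedSpace E₀ X₀] [IsManifold 𝓘(ℝ, E₀) ∞ X₀]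
  {X₁ : Type*} [TopologicalSpace X₁] [ChartedSpace E₁ X₁] [IsManifold 𝓘(ℝ, E₁) ∞ X₁]
  {G : ArrowGroupoid X₀ X₁}
  {E₂ : Type*} [NormedAddCommGroup E₂] [NormedSpace ℝ E₂] [ChartedSpace E₂ G.Comp]
  [IsManifold 𝓘(ℝ, E₂) ∞ G.Comp]

/-- The tangent space to the orbit through `x`, as a subspace of the model space. -/
def orbitSpace (G : ArrowGroupoid X₀ X₁) (E₀ E₁ : Type*) [NormedAddCommGroup E₀] [NormedSpace ℝ E₀]
    [NormedAddCommGroup E₁] [NormedSpace ℝ E₁] [ChartedSpace E₀ X₀] [ChartedSpace E₁ X₁] (x : X₀) :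
    Submodule ℝ E₀ :=
  (tderiv E₁ E₀ G.src (G.unit x)).ker.map (tderiv E₁ E₀ G.tgt (G.unit x)).toLinearMap

lemma mem_orbitSpace {x : X₀} {w : E₀} :
    w ∈ G.orbitSpace E₀ E₁ x ↔ w ∈ G.orbitTangent (E₀ := E₀) (E₁ := E₁) x := Iff.rfl

/-- The condition, for the vector field `v`, that the Lie derivative of the metric vanishes on the
orthogonal complements of the orbits. -/
def IsInfinitesimallyIsometric (G : ArrowGroupoid X₀ X₁) (E₁ : Type*) [NormedAddCommGroup E₁]
    [NormedSpace ℝ E₁] [ChartedSpace E₁ X₁] (η₀ : SmoothRiemannianMetric E₀ X₀)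
    (v : SmoothVectorField E₀ X₀) : Prop :=
  ∀ y, ∀ n n' : E₀, (∀ k ∈ G.orbitSpace E₀ E₁ y, metricAt η₀ y n k = 0 ∧ metricAt η₀ y n' k = 0) →
    lieMetric v η₀ y n n' = 0

variable [FiniteDimensional ℝ E₀] [FiniteDimensional ℝ E₁] [T2Space X₀] [T2Space X₁]
  {ξ : SmoothVectorField E₁ X₁} {v : SmoothVectorField E₀ X₀}

/-- If `v` is both source and target related to a vector field on the space of arrows, whose flow
then consists of local automorphisms of the source and target fibrations, the flow of `v` preserves
the tangent spaces of the orbits: this holds for some local flow near each point. -/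
lemma IsLie.exists_isLocalFlow_mem_orbitSpace (hG : G.IsLie (E₀ := E₀) (E₁ := E₁) E₂)
    (hs : VectorFieldsRelated G.src ξ v) (ht : VectorFieldsRelated G.tgt ξ v) (y₁ : X₀) :
    ∃ δ > 0, ∃ (N : Set X₀) (χ : ℝ → X₀ → X₀), y₁ ∈ N ∧ IsLocalFlow v (Ioo (-δ) δ) N χ ∧
      ∀ σ ∈ Ioo (-δ) δ, ∀ y ∈ N, ∀ w ∈ G.orbitSpace E₀ E₁ y,
        tderiv E₀ E₀ (χ σ) y w ∈ G.orbitSpace E₀ E₁ (χ σ y) := by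
  obtain ⟨δ₀, hδ₀, U, χ, hyU, hχ, -⟩ := exists_isLocalFlow v y₁
  obtain ⟨δ₁, hδ₁, V, ψ, hyV, hψ, -⟩ := exists_isLocalFlow ξ (G.unit y₁)
  have hδ : 0 < min δ₀ δ₁ := lt_min hδ₀ hδ₁
  have hJ₀ : Ioo (-min δ₀ δ₁) (min δ₀ δ₁) ⊆ Ioo (-δ₀) δ₀ :=
    Ioo_subset_Ioo (neg_le_neg (min_le_left _ _)) (min_le_left _ _)
  have hJ₁ : Ioo (-min δ₀ δ₁) (min δ₀ δ₁) ⊆ Ioo (-δ₁) δ₁ :=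
    Ioo_subset_Ioo (neg_le_neg (min_le_right _ _)) (min_le_right _ _)
  have h0 : (0 : ℝ) ∈ Ioo (-min δ₀ δ₁) (min δ₀ δ₁) := ⟨by linarith, hδ⟩
  have hNopen : IsOpen (U ∩ G.unit ⁻¹' V) :=
    hχ.2.2.2.1.inter (hψ.2.2.2.1.preimage hG.smooth_unit.continuous)
  refine ⟨min δ₀ δ₁, hδ, U ∩ G.unit ⁻¹' V, χ, ⟨hyU, hyV⟩,
    hχ.mono hJ₀ inter_subset_left isOpen_Ioo isPreconnected_Ioo h0 hNopen, ?_⟩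
  rintro σ hσ y ⟨hyU, hyV⟩ w ⟨z, hz, rfl⟩
  have hz' : tderiv E₁ E₀ G.src (G.unit y) z = 0 := hz
  -- the structure maps intertwine the two flows
  have key : ∀ f : X₁ → X₀, ContMDiff 𝓘(ℝ, E₁) 𝓘(ℝ, E₀) ∞ f → VectorFieldsRelated f ξ v →
      f (G.unit y) = y → (fun p => f (ψ σ p)) =ᶠ[𝓝 (G.unit y)] fun p => χ σ (f p) := by
    intro f hf hfr hfy
    have hfU : ∀ᶠ p in 𝓝 (G.unit y), f p ∈ U :=
      hf.continuous.continuousAt.preimage_mem_nhds (by rw [hfy]; exact hχ.2.2.2.1.mem_nhds hyU)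
    filter_upwards [hfU, hψ.2.2.2.1.mem_nhds hyV] with p hpU hpV
    refine eqOn_of_hasVelocityAt (v := v) (γ := fun t => f (ψ t p)) (γ' := fun t => χ t (f p)) h0
      (fun t ht' => ?_) (fun t ht' => hχ.hasVelocityAt (hJ₀ ht') hpU) ?_ hσ
    · have h1 := HasVelocityAt.comp_left (hf.hasTDerivAt _) (hψ.hasVelocityAt (hJ₁ ht') hpV)
      have h2 : tderiv E₁ E₀ f (ψ t p) (fieldAt ξ (ψ t p)) = fieldAt v (f (ψ t p)) := hfr (ψ t p)
      rwa [h2] at h1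
    · simp only [(hψ.tderiv_zero hpV).1, (hχ.tderiv_zero hpU).1]
  have key' : ∀ f : X₁ → X₀, ContMDiff 𝓘(ℝ, E₁) 𝓘(ℝ, E₀) ∞ f → VectorFieldsRelated f ξ v →
      f (G.unit y) = y → ∀ z, tderiv E₁ E₀ f (ψ σ (G.unit y)) (tderiv E₁ E₁ (ψ σ) (G.unit y) z) =
        tderiv E₀ E₀ (χ σ) y (tderiv E₁ E₀ f (G.unit y) z) := by
    intro f hf hfr hfy z
    have h1 := (HasTDerivAt.comp (hf.hasTDerivAt _) (hψ.hasTDerivAt (hJ₁ hσ) hyV))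
    have h2 : HasTDerivAt (χ σ) (tderiv E₀ E₀ (χ σ) y) (f (G.unit y)) := by
      rw [hfy]
      exact hχ.hasTDerivAt (hJ₀ hσ) hyU
    have h3 := (h2.comp (hf.hasTDerivAt _)).congr_of_eventuallyEq (key f hf hfr hfy)
    exact congrArg (fun L : E₁ →L[ℝ] E₀ => L z) (h1.unique h3)
  have hsrc := key' G.src hG.contMDiff_src hs (G.src_unit y) z
  have htgt := key' G.tgt hG.contMDiff_tgt ht (G.tgt_unit y) z
  rw [hz', map_zero] at hsrc
  have hmem := mem_orbitSpace.mpr (hG.tderiv_tgt_mem_orbitTangent hsrc)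
  rw [htgt] at hmem
  have hpt := (key G.tgt hG.contMDiff_tgt ht (G.tgt_unit y)).self_of_nhds
  simp only [G.tgt_unit] at hpt
  rw [hpt] at hmem
  exact hmem

/-- Along any local flow of `v`, the derivative of the flow is injective and maps the tangent
spaces of the orbits onto each other. -/
lemma IsLie.tderiv_localFlow_mem_orbitSpace_iff (hG : G.IsLie (E₀ := E₀) (E₁ := E₁) E₂)
    (hs : VectorFieldsRelated G.src ξ v) (ht : VectorFieldsRelated G.tgt ξ v)
    {J : Set ℝ} {U : Set X₀} {φ : ℝ → X₀ → X₀} (hφ : IsLocalFlow v J U φ) {x : X₀} (hx : x ∈ U)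
    {τ : ℝ} (hτ : τ ∈ J) :
    (∀ w, tderiv E₀ E₀ (φ τ) x w ∈ G.orbitSpace E₀ E₁ (φ τ x) ↔ w ∈ G.orbitSpace E₀ E₁ x) ∧
      Function.Injective (tderiv E₀ E₀ (φ τ) x) := by
  set P : ℝ → ℝ → Prop := fun τ τ' =>
    (∀ w, tderiv E₀ E₀ (φ τ) x w ∈ G.orbitSpace E₀ E₁ (φ τ x) →
      tderiv E₀ E₀ (φ τ') x w ∈ G.orbitSpace E₀ E₁ (φ τ' x)) ∧
    ∀ w, tderiv E₀ E₀ (φ τ) x w = 0 → tderiv E₀ E₀ (φ τ') x w = 0 with hP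
  have hall : ∀ {τ τ'}, τ ∈ J → τ' ∈ J → P τ τ' := by
    intro τ τ' hτ hτ'
    refine hφ.2.1.induction₂' P (fun τ₀ hτ₀ => ?_)
      (fun a b c _ _ _ hab hbc => ⟨fun w hw => hbc.1 w (hab.1 w hw),
        fun w hw => hbc.2 w (hab.2 w hw)⟩) hτ hτ'
    obtain ⟨δ, hδ, N, χ, hN, hχ, hχS⟩ := hG.exists_isLocalFlow_mem_orbitSpace hs ht (φ τ₀ x)
    have hcont : ContinuousAt (fun t => φ t x) τ₀ := (hφ.hasVelocityAt hτ₀ hx).continuousAt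
    obtain ⟨ε, hε, hεJ⟩ := Metric.mem_nhds_iff.mp
      (Filter.inter_mem (hφ.1.mem_nhds hτ₀) (hcont.preimage_mem_nhds (hχ.2.2.2.1.mem_nhds hN)))
    set ε' := min ε (δ / 2) with hε'
    have hε'0 : 0 < ε' := lt_min hε (by linarith)
    have hsub : Ioo (τ₀ - ε') (τ₀ + ε') ⊆ J ∩ (fun t => φ t x) ⁻¹' N := by
      rw [← Real.ball_eq_Ioo]
      exact (Metric.ball_subset_ball (min_le_left _ _)).trans hεJ
    have hJ' : Ioo (τ₀ - ε') (τ₀ + ε') ⊆ J := hsub.trans inter_subset_left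
    have hab : (τ₀ + ε') - (τ₀ - ε') ≤ δ := by linarith [min_le_right ε (δ / 2)]
    have hloc : ∀ a ∈ Ioo (τ₀ - ε') (τ₀ + ε'), ∀ b ∈ Ioo (τ₀ - ε') (τ₀ + ε'), P a b := by
      intro a ha b hb
      obtain ⟨e1, e2⟩ := hφ.tderiv_comp hχ hJ' hab ha hb hx (hsub ha).2
      have hba : b - a ∈ Ioo (-δ) δ := ⟨by linarith [ha.2, hb.1], by linarith [ha.1, hb.2]⟩
      refine ⟨fun w hw => ?_, fun w hw => ?_⟩
      · rw [e2, e1]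
        exact hχS _ hba _ (hsub ha).2 _ hw
      · rw [e2, ContinuousLinearMap.comp_apply, hw, map_zero]
    have hτ₀m : τ₀ ∈ Ioo (τ₀ - ε') (τ₀ + ε') := ⟨by linarith, by linarith⟩
    filter_upwards [mem_nhdsWithin_of_mem_nhds (isOpen_Ioo.mem_nhds hτ₀m)] with t ht
    exact ⟨hloc _ hτ₀m _ ht, hloc _ ht _ hτ₀m⟩
  obtain ⟨h01, h02⟩ := hφ.tderiv_zero hx
  have hP1 := hall hφ.2.2.1 hτ
  have hP2 := hall hτ hφ.2.2.1
  simp only [hP, h01, h02, ContinuousLinearMap.id_apply] at hP1 hP2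
  exact ⟨fun w => ⟨hP2.1 w, hP1.1 w⟩, (injective_iff_map_eq_zero _).mpr hP2.2⟩

lemma metricAt_symm (η₀ : SmoothRiemannianMetric E₀ X₀) (y : X₀) (a b : E₀) :
    metricAt η₀ y a b = metricAt η₀ y b a := η₀.symm y a b

lemma metricAt_pos (η₀ : SmoothRiemannianMetric E₀ X₀) (y : X₀) {a : E₀} (ha : a ≠ 0) :
    0 < metricAt η₀ y a a := η₀.pos y a ha

lemma eq_of_metricAt_sub {η₀ : SmoothRiemannianMetric E₀ X₀} {y : X₀} {a b : E₀}
    (ha : metricAt η₀ y a (a - b) = 0) (hb : metricAt η₀ y b (a - b) = 0) : a = b := by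
  by_contra hne
  have h1 := metricAt_pos η₀ y (sub_ne_zero.mpr hne)
  have h2 : metricAt η₀ y (a - b) = metricAt η₀ y a - metricAt η₀ y b := map_sub _ _ _
  rw [h2, sub_apply, ha, hb, sub_zero] at h1
  exact h1.false

/-- The pulled back metric along a local flow, and projections of fixed vectors to the
orthogonal complements, as in `exists_orthogonal_projections`. -/
lemma IsLie.exists_normal_families (hG : G.IsLie (E₀ := E₀) (E₁ := E₁) E₂)
    (hs : VectorFieldsRelated G.src ξ v) (ht : VectorFieldsRelated G.tgt ξ v)
    (η₀ : SmoothRiemannianMetric E₀ X₀)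
    {J : Set ℝ} {U : Set X₀} {φ : ℝ → X₀ → X₀} (hφ : IsLocalFlow v J U φ) {x : X₀} (hx : x ∈ U) :
    ∃ n : ℝ → E₀ → E₀, ∀ σ ∈ J,
      (∀ w, w - n σ w ∈ G.orbitSpace E₀ E₁ x ∧ ∀ k ∈ G.orbitSpace E₀ E₁ (φ σ x),
        metricAt η₀ (φ σ x) (tderiv E₀ E₀ (φ σ) x (n σ w)) k = 0) ∧
      ∀ w₁ w₂, HasDerivAt (fun t => metricAt η₀ (φ t x) (tderiv E₀ E₀ (φ t) x (n t w₁))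
          (tderiv E₀ E₀ (φ t) x (n t w₂)))
        (lieMetric v η₀ (φ σ x) (tderiv E₀ E₀ (φ σ) x (n σ w₁)) (tderiv E₀ E₀ (φ σ) x (n σ w₂)))
        σ := by
  have hder : ∀ σ ∈ J, ∀ a b : E₀, HasDerivAt
      (fun t => metricAt η₀ (φ t x) (tderiv E₀ E₀ (φ t) x a) (tderiv E₀ E₀ (φ t) x b))
      (lieMetric v η₀ (φ σ x) (tderiv E₀ E₀ (φ σ) x a) (tderiv E₀ E₀ (φ σ) x b)) σ :=
    fun σ hσ a b => hφ.hasDerivAt_metricAt η₀ hσ hx a b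
  obtain ⟨g, hg⟩ : ∃ g : ℝ → E₀ →L[ℝ] E₀ →L[ℝ] ℝ, ∀ t a b, g t a b =
      metricAt η₀ (φ t x) (tderiv E₀ E₀ (φ t) x a) (tderiv E₀ E₀ (φ t) x b) :=
    ⟨fun t => (metricAt η₀ (φ t x)).bilinearComp (tderiv E₀ E₀ (φ t) x) (tderiv E₀ E₀ (φ t) x),
      fun _ _ _ => rfl⟩
  simp only [← hg] at hder ⊢
  obtain ⟨s, hn⟩ := exists_orthogonal_projections (G.orbitSpace E₀ E₁ x).subtypeL
    Subtype.val_injective (g := g) (J := J) (fun σ _ a b => by rw [hg, hg, metricAt_symm])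
    (fun σ hσ a ha => (metricAt_pos η₀ _ fun h0 => ha
      ((hG.tderiv_localFlow_mem_orbitSpace_iff hs ht hφ hx hσ).2
        (h0.trans (map_zero _).symm))).trans_eq (hg σ a a).symm)
    (fun σ hσ a b => (hder σ hσ a b).differentiableAt)
  refine ⟨fun σ w => w - (G.orbitSpace E₀ E₁ x).subtypeL (s σ w),
    fun σ hσ => ⟨fun w => ⟨by simp, fun k hk => ?_⟩, fun w₁ w₂ => ?_⟩⟩
  · obtain ⟨hiff, hinj⟩ := hG.tderiv_localFlow_mem_orbitSpace_iff hs ht hφ hx hσ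
    obtain ⟨k', rfl⟩ := (LinearMap.injective_iff_surjective
      (f := (tderiv E₀ E₀ (φ σ) x).toLinearMap)).mp hinj k
    have h1 := (hn σ hσ).1 w ⟨k', (hiff k').mp hk⟩
    rwa [hg] at h1
  · exact ((hn σ hσ).2 w₁ w₂).congr_deriv (hder σ hσ _ _).deriv

/-- A vector field that is source and target related to a vector field on the space of arrows is
transversally Killing if and only if the Lie derivative of the metric vanishes on the orthogonal
complements of the orbits. -/
theorem IsLie.isTransversallyIsometric_iff (hG : G.IsLie (E₀ := E₀) (E₁ := E₁) E₂)
    (hs : VectorFieldsRelated G.src ξ v) (ht : VectorFieldsRelated G.tgt ξ v)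
    (η₀ : SmoothRiemannianMetric E₀ X₀) :
    G.IsTransversallyIsometric (E₁ := E₁) η₀ v ↔ G.IsInfinitesimallyIsometric E₁ η₀ v := by
  constructor
  · intro h y a a' haa
    obtain ⟨δ, hδ, U, φ, hyU, hφ, -⟩ := exists_isLocalFlow v y
    obtain ⟨n, hn⟩ := hG.exists_normal_families hs ht η₀ hφ hyU
    have h0 : (0 : ℝ) ∈ Ioo (-δ) δ := hφ.2.2.1
    obtain ⟨e1, e2⟩ := hφ.tderiv_zero hyU
    have hself : ∀ w, (∀ k ∈ G.orbitSpace E₀ E₁ y, metricAt η₀ y w k = 0) → n 0 w = w := by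
      intro w hw
      obtain ⟨h1, h2⟩ := (hn 0 h0).1 w
      simp only [e1, e2, ContinuousLinearMap.id_apply] at h2
      exact (eq_of_metricAt_sub (hw _ h1) (h2 _ h1)).symm
    have hd := (hn 0 h0).2 a a'
    rw [hself a fun k hk => (haa k hk).1, hself a' fun k hk => (haa k hk).2] at hd
    simp only [e1, e2, ContinuousLinearMap.id_apply] at hd
    have hconst : (fun t => metricAt η₀ (φ t y) (tderiv E₀ E₀ (φ t) y (n t a))
        (tderiv E₀ E₀ (φ t) y (n t a'))) =ᶠ[𝓝 0] fun _ => metricAt η₀ y a a' := by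
      filter_upwards [hφ.1.mem_nhds h0] with t ht'
      obtain ⟨h1, h2⟩ := h _ U φ hφ t ht' y hyU
      refine h2 a a' (tderiv E₀ E₀ (φ t) y (n t a)) (tderiv E₀ E₀ (φ t) y (n t a')) haa
        (fun k hk => ⟨((hn t ht').1 a).2 k hk, ((hn t ht').1 a').2 k hk⟩) ?_ ?_
      · have := h1 _ ((hn t ht').1 a).1
        exact (map_sub (tderiv E₀ E₀ (φ t) y) a (n t a)) ▸ this
      · have := h1 _ ((hn t ht').1 a').1
        exact (map_sub (tderiv E₀ E₀ (φ t) y) a' (n t a')) ▸ this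
    exact hd.unique ((hasDerivAt_const (0 : ℝ) (metricAt η₀ y a a')).congr_of_eventuallyEq hconst)
  · intro h J U φ hφ τ hτ x hx
    obtain ⟨n, hn⟩ := hG.exists_normal_families hs ht η₀ hφ hx
    obtain ⟨hiff, hinj⟩ := hG.tderiv_localFlow_mem_orbitSpace_iff hs ht hφ hx hτ
    refine ⟨fun w hw => (hiff w).mpr hw, fun w₁ w₂ n₁ n₂ hw hn' h1 h2 => ?_⟩
    obtain ⟨e1, e2⟩ := hφ.tderiv_zero hx
    -- both pairs of normal vectors are values of one family of projections of `w₁` and `w₂`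
    have huniq : ∀ σ ∈ J, ∀ w m : E₀, (∀ k ∈ G.orbitSpace E₀ E₁ (φ σ x), metricAt η₀ (φ σ x) m k = 0) →
        tderiv E₀ E₀ (φ σ) x w - m ∈ G.orbitSpace E₀ E₁ (φ σ x) →
        tderiv E₀ E₀ (φ σ) x (n σ w) = m := by
      intro σ hσ w m hm hmw
      obtain ⟨h3, h4⟩ := (hn σ hσ).1 w
      have h5 := ((hG.tderiv_localFlow_mem_orbitSpace_iff hs ht hφ hx hσ).1 _).mpr h3
      rw [map_sub] at h5
      have h6 := (G.orbitSpace E₀ E₁ (φ σ x)).sub_mem hmw h5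
      rw [sub_sub_sub_cancel_left] at h6
      exact eq_of_metricAt_sub (h4 _ h6) (hm _ h6)
    have hτ1 := huniq τ hτ w₁ n₁ (fun k hk => (hn' k hk).1) h1
    have hτ2 := huniq τ hτ w₂ n₂ (fun k hk => (hn' k hk).2) h2
    have h00 : ∀ w : E₀, tderiv E₀ E₀ (φ 0) x w - w ∈ G.orbitSpace E₀ E₁ (φ 0 x) := fun w => by
      rw [e2, ContinuousLinearMap.id_apply, sub_self]
      exact zero_mem _
    have h01 := huniq 0 hφ.2.2.1 w₁ w₁ (fun k hk => by rw [e1] at hk ⊢; exact (hw k hk).1)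
      (h00 w₁)
    have h02 := huniq 0 hφ.2.2.1 w₂ w₂ (fun k hk => by rw [e1] at hk ⊢; exact (hw k hk).2)
      (h00 w₂)
    have hd : ∀ σ ∈ J, HasDerivAt (fun t => metricAt η₀ (φ t x) (tderiv E₀ E₀ (φ t) x (n t w₁))
        (tderiv E₀ E₀ (φ t) x (n t w₂))) 0 σ := by
      intro σ hσ
      refine ((hn σ hσ).2 w₁ w₂).congr_deriv (h _ _ _ fun k hk => ?_)
      exact ⟨((hn σ hσ).1 w₁).2 k hk, ((hn σ hσ).1 w₂).2 k hk⟩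
    have hc := hφ.1.is_const_of_deriv_eq_zero hφ.2.1
      (fun σ hσ => (hd σ hσ).differentiableAt.differentiableWithinAt)
      (fun σ hσ => (hd σ hσ).deriv) hτ hφ.2.2.1
    simp only [hτ1, hτ2, h01, h02, e1] at hc
    exact hc

end ArrowGroupoid

/-! ### Smooth families of functionals on smooth functions -/

section BoundedFamilies

variable {E : Type*} [NormedAddCommGroup E] [NormedSpace ℝ E]
  {F : Type*} [NormedAddCommGroup F] [NormedSpace ℝ F]
  {C : Type*} [NormedAddCommGroup C] [NormedSpace ℝ C]

/-- A family of smooth functions that is bounded, together with all its derivatives, uniformly in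
the index. -/
structure SmoothBddFamily {ι : Type*} (f : ι → E → ℝ) : Prop where
  contDiff : ∀ i, ContDiff ℝ ∞ (f i)
  bound : ∀ k : ℕ, ∃ M, ∀ i y, ‖iteratedFDeriv ℝ k (f i) y‖ ≤ M

lemma SmoothBddFamily.comp {ι κ : Type*} {f : ι → E → ℝ} (hf : SmoothBddFamily f) (g : κ → ι) :
    SmoothBddFamily fun j => f (g j) :=
  ⟨fun j => hf.contDiff (g j), fun k => (hf.bound k).imp fun _ hM j => hM (g j)⟩

lemma SmoothBddFamily.exists_norm_le {ι : Type*} {f : ι → E → ℝ} (hf : SmoothBddFamily f) :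
    ∃ M, ∀ i y, ‖f i y‖ ≤ M := by
  obtain ⟨M, hM⟩ := hf.bound 0
  exact ⟨M, fun i y => by simpa using hM i y⟩

lemma SmoothBddFamily.contDiff_tsum {f : ℕ → E → ℝ} (hf : SmoothBddFamily f) {c : ℕ → ℝ}
    (hc : Summable fun i => ‖c i‖) : ContDiff ℝ ∞ fun y => ∑' i, c i * f i y := by
  choose M hM using hf.bound
  refine _root_.contDiff_tsum (𝕜 := ℝ) (N := ⊤) (f := fun i y => c i * f i y)
    (v := fun k i => ‖c i‖ * M k)
    (fun i => contDiff_const.mul (hf.contDiff i)) (fun k _ => hc.mul_right _) fun k i y _ => ?_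
  have h1 : iteratedFDeriv ℝ k (c i • f i) y = c i • iteratedFDeriv ℝ k (f i) y :=
    iteratedFDeriv_const_smul_apply
      ((hf.contDiff i).contDiffAt.of_le (by exact_mod_cast le_top))
  change ‖iteratedFDeriv ℝ k (c i • f i) y‖ ≤ _
  rw [h1, norm_smul]
  exact mul_le_mul_of_nonneg_left (hM k i y) (norm_nonneg _)

lemma ContDiff.iteratedFDeriv_top {f : E → F} (hf : ContDiff ℝ ∞ f) (k : ℕ) :
    ContDiff ℝ ∞ (iteratedFDeriv ℝ k f) :=
  contDiff_infty.2 fun n => (hf.of_le (by exact_mod_cast le_top : ((n + k : ℕ) : ℕ∞ω) ≤ ∞)).iteratedFDeriv_right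
    (by norm_cast)

/-- Directional derivatives commute with iterated derivatives. -/
lemma fderiv_iteratedFDeriv_apply {f : E → F} (hf : ContDiff ℝ ∞ f) (k : ℕ) (p w : E) :
    fderiv ℝ (iteratedFDeriv ℝ k f) p w = iteratedFDeriv ℝ k (fun q => fderiv ℝ f q w) p := by
  induction k generalizing p with
  | zero =>
    have h1 : iteratedFDeriv ℝ 0 f =
        (continuousMultilinearCurryFin0 ℝ E F).symm.toContinuousLinearEquiv ∘ f := rfl
    rw [h1, ContinuousLinearEquiv.comp_fderiv]
    rfl
  | succ k ih =>
    set H := iteratedFDeriv ℝ k f with hH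
    have hHs : ContDiff ℝ ∞ H := hf.iteratedFDeriv_top k
    have h1 : iteratedFDeriv ℝ (k + 1) f =
        (continuousMultilinearCurryLeftEquiv ℝ (fun _ : Fin (k + 1) => E)
          F).symm ∘ fderiv ℝ H := iteratedFDeriv_succ_eq_comp_left
    have h2 : iteratedFDeriv ℝ (k + 1) (fun q => fderiv ℝ f q w) =
        (continuousMultilinearCurryLeftEquiv ℝ (fun _ : Fin (k + 1) => E)
          F).symm ∘ fderiv ℝ (fun q => fderiv ℝ H q w) := by
      rw [funext ih]
      exact iteratedFDeriv_succ_eq_comp_left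
    rw [h1, h2]
    refine (DFunLike.congr_fun (LinearIsometryEquiv.comp_fderiv (𝕜 := ℝ)
      (F := ContinuousMultilinearMap ℝ (fun _ : Fin (k + 1) => E) F) (f := fderiv ℝ H) (x := p)
      (continuousMultilinearCurryLeftEquiv ℝ (fun _ : Fin (k + 1) => E) F).symm) w).trans ?_
    have hd : DifferentiableAt ℝ (fderiv ℝ H) p :=
      (hHs.fderiv_right (m := ∞) (by simp)).differentiable (by simp) p
    have h3 : fderiv ℝ (fderiv ℝ H) p w = fderiv ℝ (fun q => fderiv ℝ H q w) p := by
      ext v : 1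
      rw [fderiv_clm_apply hd (differentiableAt_const w)]
      have hsymm := (hHs.contDiffAt (x := p)).isSymmSndFDerivAt
        (by simpa using WithTop.coe_le_coe.2 (le_top : (2 : ℕ∞) ≤ ⊤))
      simpa using hsymm w v
    simp only [ContinuousLinearMap.comp_apply, Function.comp_apply, h3]
    rfl

/-- The restriction to a slice of a function with bounded iterated derivatives. -/
lemma norm_iteratedFDeriv_slice_le {g : C × E → ℝ} (hg : ContDiff ℝ ∞ g) (k : ℕ) (z : C) (y : E) :
    ‖iteratedFDeriv ℝ k (fun y' => g (z, y')) y‖ ≤ ‖iteratedFDeriv ℝ k g (z, y)‖ := by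
  have h1 : (fun y' => g (z, y')) = (fun p => g ((z, 0) + p)) ∘ ContinuousLinearMap.inr ℝ C E := by
    funext y'
    simp
  have hg' : ContDiff ℝ ∞ (fun p => g ((z, 0) + p)) := hg.comp (contDiff_const.add contDiff_id)
  rw [h1, ContinuousLinearMap.iteratedFDeriv_comp_right _ hg' y (i := k) (by exact_mod_cast le_top),
    iteratedFDeriv_comp_add_left]
  refine (ContinuousMultilinearMap.norm_compContinuousLinearMap_le _ _).trans ?_
  have h2 : ∏ _i : Fin k, ‖ContinuousLinearMap.inr ℝ C E‖ ≤ 1 :=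
    Finset.prod_le_one (fun _ _ => norm_nonneg _) fun _ _ => ContinuousLinearMap.norm_inr_le_one ℝ C E
  have h3 : ((z, (0 : E)) + ContinuousLinearMap.inr ℝ C E y) = (z, y) := by simp
  rw [h3]
  exact mul_le_of_le_one_right (norm_nonneg _) h2

lemma exists_bound_of_hasCompactSupport {G : Type*} [NormedAddCommGroup G] {f : E → G}
    (hf : Continuous f) (hc : HasCompactSupport f) : ∃ M, ∀ p, ‖f p‖ ≤ M :=
  hc.exists_bound_of_continuous hf

/-- The second order Taylor remainders in the first variable, divided by the square of the norm of
the increment, form a bounded family. -/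
lemma smoothBddFamily_remainder {g : C × E → ℝ} (hg : ContDiff ℝ ∞ g) (hc : HasCompactSupport g) :
    SmoothBddFamily fun (i : C × C) y =>
      (‖i.2‖ ^ 2)⁻¹ * (g (i.1 + i.2, y) - g (i.1, y) - fderiv ℝ g (i.1, y) (i.2, 0)) := by
  have hD : ∀ w : C × E, ContDiff ℝ ∞ (fun p => fderiv ℝ g p w) := fun w =>
    (hg.fderiv_right (m := ∞) (by simp)).clm_apply contDiff_const
  set G : C → C × E → ℝ := fun w p => g (p + (w, 0)) - g p - fderiv ℝ g p (w, 0) with hG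
  have hshift : ∀ w : C × E, ContDiff ℝ ∞ (fun p => g (p + w)) := fun w =>
    hg.comp (contDiff_id.add contDiff_const)
  have hGs : ∀ w, ContDiff ℝ ∞ (G w) := fun w => ((hshift _).sub hg).sub (hD _)
  have heq : (fun (i : C × C) y =>
      (‖i.2‖ ^ 2)⁻¹ * (g (i.1 + i.2, y) - g (i.1, y) - fderiv ℝ g (i.1, y) (i.2, 0))) =
      fun (i : C × C) y => ((‖i.2‖ ^ 2)⁻¹ • G i.2) (i.1, y) := by
    funext i y
    simp [hG]
  rw [heq]
  have hs : ∀ i : C × C, ContDiff ℝ ∞ ((‖i.2‖ ^ 2)⁻¹ • G i.2) := fun i =>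
    (contDiff_const (c := (‖i.2‖ ^ 2)⁻¹)).smul (hGs i.2)
  refine ⟨fun i => (hs i).comp (contDiff_prodMk_right i.1), fun k => ?_⟩
  set H := iteratedFDeriv ℝ k g with hH
  have hHs : ContDiff ℝ ∞ H := hg.iteratedFDeriv_top k
  have hDH : ContDiff ℝ ∞ (fderiv ℝ H) := hHs.fderiv_right (by simp)
  obtain ⟨M, hM⟩ := exists_bound_of_hasCompactSupport
    (hDH.fderiv_right (m := ∞) (by simp)).continuous
    (((hc.iteratedFDeriv k).fderiv (𝕜 := ℝ)).fderiv (𝕜 := ℝ))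
  refine ⟨M, fun i y => (norm_iteratedFDeriv_slice_le (hs i) k i.1 y).trans ?_⟩
  set p : C × E := (i.1, y) with hp
  set w : C × E := (i.2, 0) with hw
  have hle : ∀ {f : C × E → ℝ}, ContDiff ℝ ∞ f → ContDiffAt ℝ (k : ℕ∞ω) f p := fun hf =>
    hf.contDiffAt.of_le (by exact_mod_cast le_top)
  have h1 : iteratedFDeriv ℝ k (G i.2) p = H (p + w) - H p - fderiv ℝ H p w := by
    have e1 := iteratedFDeriv_sub_apply (hle ((hshift w).sub hg)) (hle (hD w))
    have e2 := iteratedFDeriv_sub_apply (hle (hshift w)) (hle hg)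
    have e3 : iteratedFDeriv ℝ k (fun q => g (q + w)) p = H (p + w) :=
      iteratedFDeriv_comp_add_right k w p
    rw [fderiv_iteratedFDeriv_apply hg, ← e3, hH, ← e2]
    exact e1
  have h2 : iteratedFDeriv ℝ k ((‖i.2‖ ^ 2)⁻¹ • G i.2) p =
      (‖i.2‖ ^ 2)⁻¹ • iteratedFDeriv ℝ k (G i.2) p := iteratedFDeriv_const_smul_apply (hle (hGs i.2))
  rw [h2, h1, norm_smul]
  have hlip : ∀ q q' : C × E, ‖fderiv ℝ H q' - fderiv ℝ H q‖ ≤ M * ‖q' - q‖ := fun q q' =>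
    convex_univ.norm_image_sub_le_of_norm_fderiv_le
      (fun x _ => hDH.differentiable (by simp) x) (fun x _ => hM x) (Set.mem_univ q)
      (Set.mem_univ q')
  have hM0 : 0 ≤ M := (norm_nonneg _).trans (hM 0)
  have h3 : ‖H (p + w) - H p - fderiv ℝ H p (p + w - p)‖ ≤ (M * ‖w‖) * ‖p + w - p‖ := by
    refine (convex_closedBall p ‖w‖).norm_image_sub_le_of_norm_hasFDerivWithin_le'
      (f' := fderiv ℝ H) (fun x _ => (hHs.differentiable (by simp) x).hasFDerivAt.hasFDerivWithinAt)
      (fun x hx => (hlip p x).trans ?_) (Metric.mem_closedBall_self (norm_nonneg _)) ?_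
    · exact mul_le_mul_of_nonneg_left (by simpa [dist_eq_norm] using hx) hM0
    · simp
  have hwn : ‖w‖ = ‖i.2‖ := by simp [hw, Prod.norm_def]
  rw [add_sub_cancel_left, hwn] at h3
  rw [norm_inv, norm_pow, norm_norm]
  by_cases h0 : ‖i.2‖ = 0
  · simp [h0, hM0]
  · rw [inv_mul_le_iff₀ (by positivity)]
    calc _ ≤ M * ‖i.2‖ * ‖i.2‖ := h3
      _ = ‖i.2‖ ^ 2 * M := by ring

end BoundedFamilies

section SmoothFunctionals

variable {B : Type*} [NormedAddCommGroup B] [NormedSpace ℝ B]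
  {E : Type*} [NormedAddCommGroup E] [NormedSpace ℝ E]
  {C : Type*} [NormedAddCommGroup C] [NormedSpace ℝ C]

/-- The first order differences in the first variable, divided by the norm of the increment, form
a bounded family. -/
lemma smoothBddFamily_difference {g : C × E → ℝ} (hg : ContDiff ℝ ∞ g) (hc : HasCompactSupport g) :
    SmoothBddFamily fun (i : C × C) y => (‖i.2‖)⁻¹ * (g (i.1 + i.2, y) - g (i.1, y)) := by
  set G : C → C × E → ℝ := fun w p => g (p + (w, 0)) - g p with hG
  have hshift : ∀ w : C × E, ContDiff ℝ ∞ (fun p => g (p + w)) := fun w =>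
    hg.comp (contDiff_id.add contDiff_const)
  have hGs : ∀ w, ContDiff ℝ ∞ (G w) := fun w => (hshift _).sub hg
  have heq : (fun (i : C × C) y => (‖i.2‖)⁻¹ * (g (i.1 + i.2, y) - g (i.1, y))) =
      fun (i : C × C) y => ((‖i.2‖)⁻¹ • G i.2) (i.1, y) := by
    funext i y
    simp [hG]
  rw [heq]
  have hs : ∀ i : C × C, ContDiff ℝ ∞ ((‖i.2‖)⁻¹ • G i.2) := fun i =>
    (contDiff_const (c := (‖i.2‖)⁻¹)).smul (hGs i.2)
  refine ⟨fun i => (hs i).comp (contDiff_prodMk_right i.1), fun k => ?_⟩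
  set H := iteratedFDeriv ℝ k g with hH
  have hHs : ContDiff ℝ ∞ H := hg.iteratedFDeriv_top k
  obtain ⟨M, hM⟩ := exists_bound_of_hasCompactSupport
    (hHs.fderiv_right (m := ∞) (by simp)).continuous ((hc.iteratedFDeriv k).fderiv (𝕜 := ℝ))
  refine ⟨M, fun i y => (norm_iteratedFDeriv_slice_le (hs i) k i.1 y).trans ?_⟩
  set p : C × E := (i.1, y) with hp
  set w : C × E := (i.2, 0) with hw
  have hle : ∀ {f : C × E → ℝ}, ContDiff ℝ ∞ f → ContDiffAt ℝ (k : ℕ∞ω) f p := fun hf =>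
    hf.contDiffAt.of_le (by exact_mod_cast le_top)
  have h1 : iteratedFDeriv ℝ k (G i.2) p = H (p + w) - H p := by
    have e2 := iteratedFDeriv_sub_apply (hle (hshift w)) (hle hg)
    have e3 : iteratedFDeriv ℝ k (fun q => g (q + w)) p = H (p + w) :=
      iteratedFDeriv_comp_add_right k w p
    rw [← e3, hH, ← e2]
    rfl
  have h2 : iteratedFDeriv ℝ k ((‖i.2‖)⁻¹ • G i.2) p =
      (‖i.2‖)⁻¹ • iteratedFDeriv ℝ k (G i.2) p := iteratedFDeriv_const_smul_apply (hle (hGs i.2))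
  rw [h2, h1, norm_smul]
  have h3 : ‖H (p + w) - H p‖ ≤ M * ‖p + w - p‖ :=
    convex_univ.norm_image_sub_le_of_norm_fderiv_le
      (fun x _ => hHs.differentiable (by simp) x) (fun x _ => hM x) (Set.mem_univ _)
      (Set.mem_univ _)
  have hM0 : 0 ≤ M := (norm_nonneg _).trans (hM 0)
  have hwn : ‖w‖ = ‖i.2‖ := by simp [hw, Prod.norm_def]
  rw [add_sub_cancel_left, hwn] at h3
  rw [norm_inv, norm_norm]
  by_cases h0 : ‖i.2‖ = 0
  · simp [h0, hM0]
  · rw [inv_mul_le_iff₀ (by positivity)]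
    exact h3.trans_eq (mul_comm _ _)

/-- The Banach space of absolutely summable real sequences. -/
abbrev SummableSeq : Type := lp (fun _ : ℕ => ℝ) 1

lemma SummableSeq.summable (c : SummableSeq) : Summable fun i => ‖c i‖ := by
  simpa using (memℓp_gen_iff (p := 1) (by simp)).1 c.2

lemma SummableSeq.norm_eq (c : SummableSeq) : ‖c‖ = ∑' i, ‖c i‖ := by
  simpa using lp.norm_eq_tsum_rpow (p := 1) (by simp) c

/-- A family, parametrized by `b ∈ Ω`, of linear functionals on smooth functions that depends
smoothly on `b` when applied to a fixed function. The continuity of the individual functionals is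
encoded by their behaviour on absolutely convergent combinations of bounded families, which is what
makes the uniform boundedness principle applicable. -/
structure SmoothFunctionals (Ω : Set B) (T : B → (E → ℝ) → ℝ) : Prop where
  contDiffOn : ∀ f, ContDiff ℝ ∞ f → ContDiffOn ℝ ∞ (fun b => T b f) Ω
  add : ∀ b ∈ Ω, ∀ f f', ContDiff ℝ ∞ f → ContDiff ℝ ∞ f' →
    T b (fun y => f y + f' y) = T b f + T b f'
  smul : ∀ b ∈ Ω, ∀ (c : ℝ) f, ContDiff ℝ ∞ f → T b (fun y => c * f y) = c * T b f
  exists_clm : ∀ b ∈ Ω, ∀ F : ℕ → E → ℝ, SmoothBddFamily F →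
    ∃ S : SummableSeq →L[ℝ] ℝ, ∀ c, S c = T b (fun y => ∑' i, c i * F i y)

namespace SmoothFunctionals

variable {Ω : Set B} {T : B → (E → ℝ) → ℝ}

lemma tsum_single (F : ℕ → E → ℝ) (n : ℕ) :
    (fun y => ∑' i, (lp.single 1 n (1 : ℝ) : SummableSeq) i * F i y) = F n := by
  funext y
  rw [tsum_eq_single n]
  · simp
  · intro i hi
    simp [lp.single_apply, hi]

lemma differentiableAt (hT : SmoothFunctionals Ω T) (hΩ : IsOpen Ω) {f : E → ℝ}
    (hf : ContDiff ℝ ∞ f) {b : B} (hb : b ∈ Ω) : DifferentiableAt ℝ (fun b => T b f) b :=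
  ((hT.contDiffOn f hf).differentiableOn (by simp) b hb).differentiableAt (hΩ.mem_nhds hb)

/-- The derivative of a smooth family of functionals in a direction of the parameter space is again
one; the continuity of the derivative is an instance of the uniform boundedness principle. -/
lemma deriv (hT : SmoothFunctionals Ω T) (hΩ : IsOpen Ω) (e : B) :
    SmoothFunctionals Ω fun b f => fderiv ℝ (fun b' => T b' f) b e where
  contDiffOn f hf :=
    ((hT.contDiffOn f hf).fderiv_of_isOpen (m := ∞) hΩ (by simp)).clm_apply contDiffOn_const
  add b hb f f' hf hf' := by
    have h : (fun b' => T b' fun y => f y + f' y) =ᶠ[𝓝 b] fun b' => T b' f + T b' f' := by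
      filter_upwards [hΩ.mem_nhds hb] with b' hb' using hT.add b' hb' f f' hf hf'
    rw [h.fderiv_eq, fderiv_fun_add (hT.differentiableAt hΩ hf hb) (hT.differentiableAt hΩ hf' hb)]
    rfl
  smul b hb c f hf := by
    have h : (fun b' => T b' fun y => c * f y) =ᶠ[𝓝 b] fun b' => c * T b' f := by
      filter_upwards [hΩ.mem_nhds hb] with b' hb' using hT.smul b' hb' c f hf
    rw [h.fderiv_eq, fderiv_const_mul (hT.differentiableAt hΩ hf hb)]
    rfl
  exists_clm b hb F hF := by
    choose! S hS using fun b hb => hT.exists_clm b hb F hF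
    have hmem : ∀ᶠ r : ℝ in Filter.atTop, b + r⁻¹ • e ∈ Ω := by
      have h1 : Filter.Tendsto (fun r : ℝ => b + r⁻¹ • e) Filter.atTop (𝓝 b) := by
        simpa using ((tendsto_inv_atTop_zero (𝕜 := ℝ)).smul_const e).const_add b
      exact h1.eventually (hΩ.mem_nhds hb)
    have hlim : Filter.Tendsto
        (fun (r : ℝ) (c : SummableSeq) => (r • (S (b + r⁻¹ • e) - S b)) c) Filter.atTop
        (𝓝 fun c => fderiv ℝ (fun b' => T b' fun y => ∑' i, c i * F i y) b e) := by
      refine tendsto_pi_nhds.2 fun c => ?_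
      refine ((hT.differentiableAt hΩ (hF.contDiff_tsum c.summable) hb).hasFDerivAt.lim_real
        e).congr' ?_
      filter_upwards [hmem] with r hr
      simp [hS _ hr, hS _ hb]
    exact ⟨continuousLinearMapOfTendsto _ hlim, fun c => rfl⟩

/-- Uniform boundedness over compact sets of parameters. -/
lemma exists_bound (hT : SmoothFunctionals Ω T) {K : Set B} (hK : IsCompact K) (hKΩ : K ⊆ Ω)
    {ι : Type*} {F : ι → E → ℝ} (hF : SmoothBddFamily F) :
    ∃ M, ∀ b ∈ K, ∀ i, |T b (F i)| ≤ M := by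
  by_contra! h
  choose b hb i hi using fun n : ℕ => h n
  have hG := hF.comp i
  choose! S hS using fun b hb => hT.exists_clm b hb _ hG
  obtain ⟨M, hM⟩ := banach_steinhaus (g := fun b : K => S b) fun c => by
    obtain ⟨M, hM⟩ := hK.exists_bound_of_continuousOn
      ((hT.contDiffOn _ (hG.contDiff_tsum c.summable)).continuousOn.mono hKΩ)
    exact ⟨M, fun b => by rw [hS b (hKΩ b.2)]; exact hM b b.2⟩
  obtain ⟨n, hn⟩ := exists_nat_gt M
  have h1 := (S (b n)).le_of_opNorm_le (hM ⟨b n, hb n⟩) (lp.single 1 n 1)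
  rw [hS _ (hKΩ (hb n)), tsum_single, lp.norm_single (by simp)] at h1
  have h2 := hi n
  simp only [Real.norm_eq_abs, norm_one, mul_one] at h1
  linarith

variable {g : C × E → ℝ}

/-- The partial derivative, in the direction `v` of the parameter space, of a function of a
parameter and a point. -/
def sliceDeriv (g : C × E → ℝ) (v : C) (p : C × E) : ℝ := fderiv ℝ g p (v, 0)

lemma contDiff_sliceDeriv (hg : ContDiff ℝ ∞ g) (v : C) : ContDiff ℝ ∞ (sliceDeriv g v) :=
  (hg.fderiv_right (m := ∞) (by simp)).clm_apply contDiff_const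

lemma hasCompactSupport_sliceDeriv (hc : HasCompactSupport g) (v : C) :
    HasCompactSupport (sliceDeriv g v) := hc.fderiv_apply (𝕜 := ℝ) (v, (0 : E))

lemma contDiff_slice (hg : ContDiff ℝ ∞ g) (z : C) : ContDiff ℝ ∞ fun y => g (z, y) :=
  hg.comp (contDiff_prodMk_right z)

lemma apply_sub (hT : SmoothFunctionals Ω T) {b : B} (hb : b ∈ Ω) {f f' : E → ℝ}
    (hf : ContDiff ℝ ∞ f) (hf' : ContDiff ℝ ∞ f') : T b (fun y => f y - f' y) = T b f - T b f' := by
  have h := hT.add b hb (fun y => f y - f' y) f' (hf.sub hf') hf'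
  simp only [sub_add_cancel] at h
  rw [h, add_sub_cancel_right]

lemma continuousOn_uncurry [FiniteDimensional ℝ B] (hT : SmoothFunctionals Ω T) (hΩ : IsOpen Ω)
    (hg : ContDiff ℝ ∞ g) (hc : HasCompactSupport g) :
    ContinuousOn (fun q : B × C => T q.1 fun y => g (q.2, y)) (Ω ×ˢ Set.univ) := by
  rintro ⟨b, z⟩ ⟨hb, -⟩
  refine ContinuousAt.continuousWithinAt ?_
  have : ProperSpace B := FiniteDimensional.proper ℝ B
  obtain ⟨K, hKc, hbK, hKΩ⟩ := exists_compact_subset hΩ hb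
  obtain ⟨M, hM⟩ := hT.exists_bound hKc hKΩ (smoothBddFamily_difference hg hc)
  have h1 : ContinuousAt (fun q : B × C => T q.1 fun y => g (z, y)) (b, z) :=
    ContinuousAt.comp (f := fun q : B × C => q.1) (g := fun b => T b fun y => g (z, y))
      ((hT.contDiffOn _ (contDiff_slice hg z)).continuousOn.continuousAt (hΩ.mem_nhds hb))
      continuousAt_fst
  refine tendsto_of_tendsto_of_dist h1 ?_
  have h2 : Filter.Tendsto (fun q : B × C => M * ‖q.2 - z‖) (𝓝 (b, z)) (𝓝 0) := by
    have : Continuous (fun q : B × C => M * ‖q.2 - z‖) := by fun_prop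
    simpa using this.tendsto (b, z)
  refine squeeze_zero' (Filter.Eventually.of_forall fun _ => dist_nonneg) ?_ h2
  filter_upwards [continuousAt_fst.eventually (mem_interior_iff_mem_nhds.1 hbK)] with q hq
  have hqΩ := hKΩ hq
  by_cases hz : q.2 = z
  · simp [hz]
  have h0 : ‖q.2 - z‖ ≠ 0 := by simpa [sub_eq_zero] using hz
  have h3 := hM q.1 hq (z, q.2 - z)
  simp only [add_sub_cancel] at h3
  rw [hT.smul _ hqΩ _ _ ((contDiff_slice hg _).sub (contDiff_slice hg _)),
    hT.apply_sub hqΩ (contDiff_slice hg _) (contDiff_slice hg _), abs_mul, abs_inv, abs_norm,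
    inv_mul_le_iff₀ (by positivity)] at h3
  rw [dist_comm, Real.dist_eq, mul_comm]
  exact h3

/-- Differentiation under a functional. -/
lemma hasFDerivAt_slice [FiniteDimensional ℝ C] (hT : SmoothFunctionals Ω T) {b : B} (hb : b ∈ Ω)
    (hg : ContDiff ℝ ∞ g) (hc : HasCompactSupport g) (z : C) :
    ∃ D : C →L[ℝ] ℝ, HasFDerivAt (fun z' => T b fun y => g (z', y)) D z ∧
      ∀ v, D v = T b fun y => sliceDeriv g v (z, y) := by
  let D : C →ₗ[ℝ] ℝ :=
    { toFun := fun v => T b fun y => sliceDeriv g v (z, y)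
      map_add' := fun v w => by
        rw [← hT.add b hb _ _ (contDiff_slice (contDiff_sliceDeriv hg v) z)
          (contDiff_slice (contDiff_sliceDeriv hg w) z)]
        congr 1
        funext y
        simp only [sliceDeriv]
        rw [← map_add]
        simp
      map_smul' := fun c v => by
        rw [RingHom.id_apply, smul_eq_mul,
          ← hT.smul b hb _ _ (contDiff_slice (contDiff_sliceDeriv hg v) z)]
        congr 1
        funext y
        simp only [sliceDeriv]
        rw [← smul_eq_mul, ← map_smul]
        simp }
  refine ⟨D.toContinuousLinearMap, ?_, fun v => rfl⟩
  obtain ⟨M, hM⟩ := hT.exists_bound isCompact_singleton (Set.singleton_subset_iff.2 hb)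
    (smoothBddFamily_remainder hg hc)
  have hO : (fun h => T b (fun y => g (z + h, y)) - T b (fun y => g (z, y)) - D h) =O[𝓝 0]
      fun h => ‖h‖ ^ 2 := by
    refine Asymptotics.IsBigO.of_bound M (Filter.Eventually.of_forall fun w => ?_)
    by_cases hw : w = 0
    · subst hw
      simp
    have h0 : ‖w‖ ≠ 0 := norm_ne_zero_iff.2 hw
    have h3 : |T b fun y => (‖w‖ ^ 2)⁻¹ * (g (z + w, y) - g (z, y) - sliceDeriv g w (z, y))| ≤ M :=
      hM b rfl (z, w)
    have e1 := contDiff_slice hg (z + w)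
    have e2 := contDiff_slice hg z
    have e3 := contDiff_slice (contDiff_sliceDeriv hg w) z
    rw [hT.smul b hb _ _ ((e1.sub e2).sub e3), hT.apply_sub hb (e1.sub e2) e3,
      hT.apply_sub hb e1 e2, abs_mul, abs_of_nonneg (by positivity),
      inv_mul_le_iff₀ (by positivity), mul_comm] at h3
    rw [norm_pow, norm_norm]
    exact h3
  rw [hasFDerivAt_iff_isLittleO_nhds_zero]
  refine hO.trans_isLittleO ?_
  simpa using (Asymptotics.isLittleO_norm_pow_id (E' := C) one_lt_two)

/-- The main property of smooth families of functionals: the value at a smooth function depending on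
parameters, compactly supported in all variables, is a smooth function of all parameters. -/
lemma contDiffOn_uncurry [FiniteDimensional ℝ B] [FiniteDimensional ℝ C]
    (hT : SmoothFunctionals Ω T) (hΩ : IsOpen Ω)
    (hg : ContDiff ℝ ∞ g) (hc : HasCompactSupport g) :
    ContDiffOn ℝ ∞ (fun q : B × C => T q.1 fun y => g (q.2, y)) (Ω ×ˢ Set.univ) := by
  have hopen : IsOpen (Ω ×ˢ (Set.univ : Set C)) := hΩ.prod isOpen_univ
  refine contDiffOn_infty.2 fun n => ?_
  induction n generalizing T g with
  | zero => exact contDiffOn_zero.2 (hT.continuousOn_uncurry hΩ hg hc)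
  | succ n ih =>
    set f : B → C → ℝ := fun b z => T b fun y => g (z, y) with hf
    set f₁ : B → C → B →L[ℝ] ℝ := fun b z => fderiv ℝ (fun b' => f b' z) b with hf₁
    set f₂ : B → C → C →L[ℝ] ℝ := fun b z => fderiv ℝ (f b) z with hf₂
    have h₂ : ∀ q ∈ Ω ×ˢ (Set.univ : Set C), HasFDerivAt (f q.1) (f₂ q.1 q.2) q.2 ∧
        ∀ v, f₂ q.1 q.2 v = T q.1 fun y => sliceDeriv g v (q.2, y) := fun q hq => by
      obtain ⟨D, hD, hDv⟩ := hT.hasFDerivAt_slice hq.1 hg hc q.2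
      have : f₂ q.1 q.2 = D := hD.fderiv
      rw [this]
      exact ⟨hD, hDv⟩
    have hd : ∀ q ∈ Ω ×ˢ (Set.univ : Set C),
        HasFDerivAt (fun q : B × C => f q.1 q.2) ((f₁ q.1 q.2).coprod (f₂ q.1 q.2)) q := by
      intro q hq
      refine (hasStrictFDerivAt_uncurry_coprod (u := q) (f := f) (f₁ := f₁) (f₂ := f₂)
        ?_ ?_ ?_ ?_).hasFDerivAt
      · filter_upwards [hopen.mem_nhds hq] with p hp
        exact (hT.differentiableAt hΩ (contDiff_slice hg p.2) hp.1).hasFDerivAt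
      · filter_upwards [hopen.mem_nhds hq] with p hp using (h₂ p hp).1
      · have : ContinuousOn (fun p : B × C => f₁ p.1 p.2) (Ω ×ˢ Set.univ) :=
          continuousOn_clm_apply.2 fun e => (hT.deriv hΩ e).continuousOn_uncurry hΩ hg hc
        exact this.continuousAt (hopen.mem_nhds hq)
      · have : ContinuousOn (fun p : B × C => f₂ p.1 p.2) (Ω ×ˢ Set.univ) :=
          continuousOn_clm_apply.2 fun v => (hT.continuousOn_uncurry hΩ (contDiff_sliceDeriv hg v)
            (hasCompactSupport_sliceDeriv hc v)).congr fun p hp => (h₂ p hp).2 v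
        exact this.continuousAt (hopen.mem_nhds hq)
    rw [Nat.cast_add, Nat.cast_one, contDiffOn_succ_iff_fderiv_of_isOpen hopen]
    refine ⟨fun q hq => (hd q hq).differentiableAt.differentiableWithinAt, by simp, ?_⟩
    refine contDiffOn_clm_apply.2 fun w => ?_
    refine ((ih (hT.deriv hΩ w.1) hg hc).add (ih hT (contDiff_sliceDeriv hg w.2)
      (hasCompactSupport_sliceDeriv hc w.2))).congr fun q hq => ?_
    rw [(hd q hq).fderiv, ContinuousLinearMap.coprod_apply, (h₂ q hq).2]

end SmoothFunctionals

end SmoothFunctionals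

/-! ### Smooth dependence of integrals on parameters -/

section ParametricIntegrals

universe w

variable {E₀ : Type*} [NormedAddCommGroup E₀] [NormedSpace ℝ E₀] [FiniteDimensional ℝ E₀]
  {E₁ : Type*} [NormedAddCommGroup E₁] [NormedSpace ℝ E₁] [FiniteDimensional ℝ E₁]
  {C : Type*} [NormedAddCommGroup C] [NormedSpace ℝ C] [FiniteDimensional ℝ C]
  {X₀ : Type*} [TopologicalSpace X₀] [ChartedSpace E₀ X₀]
  {X₁ : Type w} [TopologicalSpace X₁] [T2Space X₁] [SecondCountableTopology X₁]
  [ChartedSpace E₁ X₁] [IsManifold 𝓘(ℝ, E₁) ∞ X₁]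

/-- A function that is smooth on an open set and vanishes off a closed subset of it is smooth. -/
lemma ContMDiffOn.contMDiff_of_eq_zero {E : Type*} [NormedAddCommGroup E] [NormedSpace ℝ E]
    {M : Type*} [TopologicalSpace M] [ChartedSpace E M] {f : M → ℝ} {U K : Set M}
    (hf : ContMDiffOn 𝓘(ℝ, E) 𝓘(ℝ, ℝ) ∞ f U) (hU : IsOpen U) (hK : IsClosed K) (hKU : K ⊆ U)
    (h0 : ∀ x ∉ K, f x = 0) : ContMDiff 𝓘(ℝ, E) 𝓘(ℝ, ℝ) ∞ f := by
  intro x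
  by_cases hx : x ∈ K
  · exact (hf x (hKU hx)).contMDiffAt (hU.mem_nhds (hKU hx))
  · refine contMDiffAt_const (c := (0 : ℝ)).congr_of_eventuallyEq ?_
    filter_upwards [hK.isOpen_compl.mem_nhds hx] with y hy using h0 y hy

/-- A finite smooth partition of unity near a compact set, with compact supports in chart domains
contained in a given open set. -/
lemma exists_finite_partition {L A : Set X₁} (hL : IsCompact L) (hA : IsOpen A) (hLA : L ⊆ A) :
    ∃ (ι : Type w) (J : Finset ι) (ρ : ι → X₁ → ℝ) (c : ι → X₁),
      (∀ i, ContMDiff 𝓘(ℝ, E₁) 𝓘(ℝ, ℝ) ∞ (ρ i) ∧ HasCompactSupport (ρ i) ∧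
        tsupport (ρ i) ⊆ (chartAt E₁ (c i)).source ∩ A) ∧
      ∀ a ∈ L, ∑ i ∈ J, ρ i a = 1 := by
  have : LocallyCompactSpace X₁ := Manifold.locallyCompact_of_finiteDimensional 𝓘(ℝ, E₁)
  obtain ⟨ι, f, hf⟩ := SmoothBumpCovering.exists_isSubordinate 𝓘(ℝ, E₁) (s := L) (U := fun _ => A)
    hL.isClosed fun x hx => hA.mem_nhds (hLA hx)
  set φ := f.toSmoothPartitionOfUnity
  have hts : ∀ i, tsupport (φ i) ⊆ tsupport (f i) := fun i =>
    closure_mono (f.support_toSmoothPartitionOfUnity_subset i)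
  have hfin := φ.locallyFinite.finite_nonempty_inter_compact hL
  refine ⟨ι, hfin.toFinset, fun i => φ i, f.c, fun i => ⟨(φ i).contMDiff, ?_, ?_⟩, fun a ha => ?_⟩
  · exact (f i).hasCompactSupport.of_isClosed_subset (isClosed_tsupport _) (hts i)
  · exact fun x hx => ⟨(f i).tsupport_subset_chartAt_source (hts i hx), hf i (hts i hx)⟩
  · rw [← φ.sum_eq_one ha]
    refine (finsum_eq_sum_of_support_subset _ fun i hi => ?_).symm
    simp only [Set.Finite.coe_toFinset, Set.mem_ofPred_eq]
    exact ⟨a, hi, ha⟩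

/-- A function that is smooth in charts, jointly in a parameter, is continuous. -/
lemma continuousOn_of_contDiffOn_charts {W : Type*} [NormedAddCommGroup W] [NormedSpace ℝ W]
    {A : Set X₁} (hA : IsOpen A) {O : Set C} {H : C → X₁ → W} {z : C} (hz : z ∈ O)
    (hH : ∀ c, ContDiffOn ℝ ∞ (fun y : C × E₁ => H y.1 ((extChartAt 𝓘(ℝ, E₁) c).symm y.2))
      (O ×ˢ ((extChartAt 𝓘(ℝ, E₁) c).target ∩ (extChartAt 𝓘(ℝ, E₁) c).symm ⁻¹' A))) :
    ContinuousOn (H z) A := by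
  intro a ha
  have hs := extChartAt_source_mem_nhds (I := 𝓘(ℝ, E₁)) a
  set e := extChartAt 𝓘(ℝ, E₁) a with he
  have h1 : ContinuousOn (fun b => H z (e.symm (e b))) (e.source ∩ A) := by
    refine (hH a).continuousOn.comp (f := fun b => (z, e b))
      (continuousOn_const.prodMk ((continuousOn_extChartAt a).mono Set.inter_subset_left))
      fun b hb => ⟨hz, e.map_source hb.1, ?_⟩
    rw [Set.mem_preimage, e.left_inv hb.1]
    exact hb.2
  have h2 : ContinuousOn (H z) (e.source ∩ A) :=
    h1.congr fun b hb => by simp only [e.left_inv hb.1]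
  exact (h2.continuousAt (Filter.inter_mem hs (hA.mem_nhds ha))).continuousWithinAt

variable [MeasurableSpace X₁] [BorelSpace X₁]

lemma ContinuousOn.integrable_of_isCompact {W : Type*} [NormedAddCommGroup W] {f : X₁ → W}
    {L : Set X₁} {μ : Measure X₁} [IsFiniteMeasure μ] (hf : ContinuousOn f L) (hL : IsCompact L)
    (h0 : μ Lᶜ = 0) : Integrable f μ := by
  have h1 : μ.restrict L = μ := Measure.restrict_eq_self_of_ae_mem (mem_ae_iff.2 h0)
  have h2 := hf.integrableOn_compact hL (μ := μ)
  rwa [IntegrableOn, h1] at h2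

/-- The hypotheses on a family of measures under which integrals depend smoothly on parameters. -/
structure IsSmoothProbabilityFamily (E₀ E₁ : Type*) [NormedAddCommGroup E₀] [NormedSpace ℝ E₀]
    [NormedAddCommGroup E₁] [NormedSpace ℝ E₁] [ChartedSpace E₀ X₀] [ChartedSpace E₁ X₁]
    (μ : X₀ → Measure X₁) : Prop where
  isProbability : ∀ x, IsProbabilityMeasure (μ x)
  smooth : ∀ f : X₁ → ℝ, ContMDiff 𝓘(ℝ, E₁) 𝓘(ℝ, ℝ) ∞ f → HasCompactSupport f →
    ContMDiff 𝓘(ℝ, E₀) 𝓘(ℝ, ℝ) ∞ (fun x => ∫ a, f a ∂(μ x))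

namespace IsSmoothProbabilityFamily

variable {μ : X₀ → Measure X₁} (hμ : IsSmoothProbabilityFamily E₀ E₁ μ)
  {ψ : OpenPartialHomeomorph X₀ E₀} (hψ : ContMDiffOn 𝓘(ℝ, E₀) 𝓘(ℝ, E₀) ∞ ψ.symm ψ.target)
include hμ hψ

lemma smoothFunctionals {c : X₁} {χ : X₁ → ℝ} (hχ : ContMDiff 𝓘(ℝ, E₁) 𝓘(ℝ, ℝ) ∞ χ)
    (hχc : HasCompactSupport χ) (hχs : tsupport χ ⊆ (chartAt E₁ c).source) :
    SmoothFunctionals ψ.target fun b f => ∫ a, χ a * f (extChartAt 𝓘(ℝ, E₁) c a) ∂μ (ψ.symm b) := by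
  have hprob := hμ.isProbability
  have hs : ∀ f : E₁ → ℝ, ContDiff ℝ ∞ f →
      ContMDiff 𝓘(ℝ, E₁) 𝓘(ℝ, ℝ) ∞ fun a => χ a * f (extChartAt 𝓘(ℝ, E₁) c a) := fun f hf =>
    ContMDiffOn.contMDiff_of_eq_zero
      (hχ.contMDiffOn.mul (hf.contMDiff.comp_contMDiffOn contMDiffOn_extChartAt))
      (chartAt E₁ c).open_source (isClosed_tsupport χ) hχs
      fun x hx => by rw [image_eq_zero_of_notMem_tsupport hx, zero_mul]
  have hc : ∀ f : E₁ → ℝ, HasCompactSupport fun a => χ a * f (extChartAt 𝓘(ℝ, E₁) c a) :=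
    fun f => hχc.mul_right
  have hint : ∀ f : E₁ → ℝ, ContDiff ℝ ∞ f → ∀ x,
      Integrable (fun a => χ a * f (extChartAt 𝓘(ℝ, E₁) c a)) (μ x) := fun f hf x =>
    (hs f hf).continuous.integrable_of_hasCompactSupport (hc f)
  have hadd : ∀ b (f f' : E₁ → ℝ), ContDiff ℝ ∞ f → ContDiff ℝ ∞ f' →
      ∫ a, χ a * (f (extChartAt 𝓘(ℝ, E₁) c a) + f' (extChartAt 𝓘(ℝ, E₁) c a)) ∂μ (ψ.symm b) =
        (∫ a, χ a * f (extChartAt 𝓘(ℝ, E₁) c a) ∂μ (ψ.symm b)) +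
          ∫ a, χ a * f' (extChartAt 𝓘(ℝ, E₁) c a) ∂μ (ψ.symm b) := fun b f f' hf hf' => by
    rw [← integral_add (hint f hf _) (hint f' hf' _)]
    simp only [mul_add]
  have hsmul : ∀ b (r : ℝ) (f : E₁ → ℝ),
      ∫ a, χ a * (r * f (extChartAt 𝓘(ℝ, E₁) c a)) ∂μ (ψ.symm b) =
        r * ∫ a, χ a * f (extChartAt 𝓘(ℝ, E₁) c a) ∂μ (ψ.symm b) := fun b r f => by
    rw [← integral_const_mul]
    simp only [mul_left_comm]
  refine ⟨fun f hf => ?_, fun b _ f f' => hadd b f f', fun b _ r f _ => hsmul b r f,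
    fun b _ F hF => ?_⟩
  · exact ((hμ.smooth _ (hs f hf) (hc f)).comp_contMDiffOn hψ).contDiffOn
  · obtain ⟨M, hM⟩ := hF.exists_norm_le
    obtain ⟨N, hN⟩ := hχc.exists_bound_of_continuous hχ.continuous
    have hsum : ∀ (d : SummableSeq) y, Summable fun i => d i * F i y := fun d y =>
      Summable.of_norm_bounded (d.summable.mul_right M) fun i => by
        rw [norm_mul]
        exact mul_le_mul_of_nonneg_left (hM i y) (norm_nonneg _)
    refine ⟨LinearMap.mkContinuous
      { toFun := fun d => ∫ a, χ a * ∑' i, d i * F i (extChartAt 𝓘(ℝ, E₁) c a) ∂μ (ψ.symm b)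
        map_add' := fun d d' => ?_
        map_smul' := fun r d => ?_ } (N * M) fun d => ?_, fun d => rfl⟩
    · rw [← hadd b (fun y => ∑' i, d i * F i y) (fun y => ∑' i, d' i * F i y)
        (hF.contDiff_tsum d.summable) (hF.contDiff_tsum d'.summable)]
      congr 1
      funext a
      rw [← (hsum d _).tsum_add (hsum d' _)]
      simp only [← add_mul]
      rfl
    · rw [RingHom.id_apply, smul_eq_mul, ← hsmul b r fun y => ∑' i, d i * F i y]
      congr 1
      funext a
      simp only [lp.coeFn_smul, Pi.smul_apply, smul_eq_mul, mul_assoc, tsum_mul_left]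
    · refine (norm_integral_le_of_norm_le_const (C := N * M * ‖d‖)
        (Filter.Eventually.of_forall fun a => ?_)).trans (by simp)
      rw [norm_mul, mul_assoc]
      refine mul_le_mul (hN a) ?_ (norm_nonneg _) ((norm_nonneg _).trans (hN a))
      rw [SummableSeq.norm_eq, mul_comm, ← tsum_mul_right]
      refine tsum_of_norm_bounded (d.summable.mul_right M).hasSum fun i => ?_
      rw [norm_mul]
      exact mul_le_mul_of_nonneg_left (hM i _) (norm_nonneg _)

lemma contDiffAt_integral_mul {c : X₁} {ρ : X₁ → ℝ} (hρ : ContMDiff 𝓘(ℝ, E₁) 𝓘(ℝ, ℝ) ∞ ρ)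
    (hρc : HasCompactSupport ρ) {A : Set X₁} (hA : IsOpen A)
    (hρs : tsupport ρ ⊆ (chartAt E₁ c).source ∩ A) {O : Set C} (hO : IsOpen O) {H : C → X₁ → ℝ}
    (hH : ContDiffOn ℝ ∞ (fun y : C × E₁ => H y.1 ((extChartAt 𝓘(ℝ, E₁) c).symm y.2))
      (O ×ˢ ((extChartAt 𝓘(ℝ, E₁) c).target ∩ (extChartAt 𝓘(ℝ, E₁) c).symm ⁻¹' A)))
    {b₀ : E₀} (hb₀ : b₀ ∈ ψ.target) {z₀ : C} (hz₀ : z₀ ∈ O) :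
    ContDiffAt ℝ ∞ (fun q : E₀ × C => ∫ a, ρ a * H q.2 a ∂μ (ψ.symm q.1)) (b₀, z₀) := by
  have : LocallyCompactSpace X₁ := Manifold.locallyCompact_of_finiteDimensional 𝓘(ℝ, E₁)
  set e := extChartAt 𝓘(ℝ, E₁) c with he
  have hes : e.source = (chartAt E₁ c).source := extChartAt_source _ _
  have hesym : ContinuousOn e.symm e.target := continuousOn_extChartAt_symm c
  have hsrc : tsupport ρ ⊆ e.source := fun x hx => hes ▸ (hρs hx).1
  set V : Set E₁ := e.target ∩ e.symm ⁻¹' A with hV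
  have hVo : IsOpen V := hesym.isOpen_inter_preimage (isOpen_extChartAt_target c) hA
  set K : Set E₁ := e '' tsupport ρ with hK
  have hKc : IsCompact K := hρc.isCompact.image_of_continuousOn
    ((continuousOn_extChartAt c).mono hsrc)
  have hKV : K ⊆ V := by
    rintro _ ⟨a, ha, rfl⟩
    exact ⟨e.map_source (hsrc ha), by simpa [e.left_inv (hsrc ha)] using (hρs ha).2⟩
  obtain ⟨S, hSc, hρS, hSs⟩ := exists_compact_between hρc.isCompact (chartAt E₁ c).open_source
    fun x hx => (hρs hx).1
  obtain ⟨χ, hχ1, hχ0, -⟩ := exists_contMDiffMap_one_nhds_of_subset_interior (n := ⊤) 𝓘(ℝ, E₁)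
    (isClosed_tsupport ρ) hρS
  have hχS : tsupport χ ⊆ S := closure_minimal
    (fun x hx => by_contra fun h => hx (hχ0 x h)) hSc.isClosed
  have hT := hμ.smoothFunctionals hψ χ.contMDiff
    (hSc.of_isClosed_subset (isClosed_tsupport _) hχS) (hχS.trans hSs)
  obtain ⟨r, hr, hrO⟩ := Metric.nhds_basis_closedBall.mem_iff.1 (hO.mem_nhds hz₀)
  let θ : ContDiffBump z₀ := ⟨r / 2, r, by positivity, by linarith⟩
  have hρK : ∀ y ∈ e.target, K.indicator (fun y => ρ (e.symm y)) y = ρ (e.symm y) := by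
    intro y hy
    by_cases hyK : y ∈ K
    · exact Set.indicator_of_mem hyK _
    · have hn : e.symm y ∉ tsupport ρ := fun h => hyK ⟨_, h, e.right_inv hy⟩
      rw [Set.indicator_of_notMem hyK, image_eq_zero_of_notMem_tsupport hn]
  set g : C × E₁ → ℝ := fun p =>
    θ p.1 * (K.indicator (fun y => ρ (e.symm y)) p.2 * H p.1 (e.symm p.2)) with hg
  have hUo : IsOpen (O ×ˢ V) := hO.prod hVo
  have hcpt : IsCompact (tsupport θ ×ˢ K) := θ.hasCompactSupport.isCompact.prod hKc
  have hzero : ∀ p ∉ tsupport θ ×ˢ K, g p = 0 := by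
    intro p hp
    by_cases h1 : p.1 ∈ tsupport θ
    · have h2 : p.2 ∉ K := fun h => hp ⟨h1, h⟩
      simp [hg, Set.indicator_of_notMem h2]
    · simp [hg, image_eq_zero_of_notMem_tsupport h1]
  have hρe : ContDiffOn ℝ ∞ (fun y => ρ (e.symm y)) e.target :=
    (hρ.comp_contMDiffOn (contMDiffOn_extChartAt_symm c)).contDiffOn
  have hgs : ContDiff ℝ ∞ g := by
    refine (ContMDiffOn.contMDiff_of_eq_zero (U := O ×ˢ V) (contMDiffOn_iff_contDiffOn.2 ?_) hUo
      hcpt.isClosed ?_ hzero).contDiff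
    · refine ((θ.contDiff.comp contDiff_fst).contDiffOn.mul
        ((hρe.comp contDiffOn_snd fun p hp => hp.2.1).mul hH)).congr fun p hp => ?_
      simp only [hg, hρK _ hp.2.1]
      rfl
    · refine Set.prod_mono ?_ hKV
      rw [θ.tsupport_eq]
      exact hrO
  have hgc : HasCompactSupport g := HasCompactSupport.intro hcpt hzero
  refine ((hT.contDiffOn_uncurry ψ.open_target hgs hgc).contDiffAt
    ((ψ.open_target.prod isOpen_univ).mem_nhds ⟨hb₀, Set.mem_univ _⟩)).congr_of_eventuallyEq ?_
  have hθ1 : ∀ᶠ q : E₀ × C in 𝓝 (b₀, z₀), θ q.2 = 1 :=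
    (continuous_snd.tendsto (b₀, z₀)).eventually θ.eventuallyEq_one
  filter_upwards [hθ1] with q hq
  refine integral_congr_ae (Filter.Eventually.of_forall fun a => ?_)
  change ρ a * H q.2 a = χ a * (θ q.2 * (K.indicator (fun y => ρ (e.symm y)) (e a) *
    H q.2 (e.symm (e a))))
  rw [hq, one_mul]
  by_cases ha : a ∈ e.source
  · rw [hρK _ (e.map_source ha), e.left_inv ha]
    by_cases ha' : a ∈ tsupport ρ
    · rw [hχ1.self_of_nhdsSet a ha', one_mul]
    · simp [image_eq_zero_of_notMem_tsupport ha']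
  · rw [image_eq_zero_of_notMem_tsupport fun h => ha (hsrc h),
      image_eq_zero_of_notMem_tsupport fun h => ha (hes ▸ hSs (hχS h))]
    simp

/-- Integrals of a smooth function of a parameter and a point depend smoothly on the parameter and
on the measure, provided that the measures are concentrated on a common compact set. -/
lemma contDiffAt_integral {W : Type*} [NormedAddCommGroup W] [NormedSpace ℝ W]
    [FiniteDimensional ℝ W] {A L : Set X₁} (hA : IsOpen A) (hL : IsCompact L) (hLA : L ⊆ A)
    {O : Set C} (hO : IsOpen O) {H : C → X₁ → W}
    (hH : ∀ c, ContDiffOn ℝ ∞ (fun y : C × E₁ => H y.1 ((extChartAt 𝓘(ℝ, E₁) c).symm y.2))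
      (O ×ˢ ((extChartAt 𝓘(ℝ, E₁) c).target ∩ (extChartAt 𝓘(ℝ, E₁) c).symm ⁻¹' A)))
    {b₀ : E₀} (hb₀ : b₀ ∈ ψ.target) {z₀ : C} (hz₀ : z₀ ∈ O)
    (hLμ : ∀ᶠ b in 𝓝 b₀, μ (ψ.symm b) Lᶜ = 0) :
    ContDiffAt ℝ ∞ (fun q : E₀ × C => ∫ a, H q.2 a ∂μ (ψ.symm q.1)) (b₀, z₀) := by
  have hprob := hμ.isProbability
  obtain ⟨ι, J, ρ, c, hρ, hsum⟩ := exists_finite_partition (E₁ := E₁) hL hA hLA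
  let B := Module.finBasis ℝ W
  have hcoord : ∀ i, Continuous (B.coord i) := fun i =>
    LinearMap.continuous_of_finiteDimensional _
  let ℓ : ∀ i, W →L[ℝ] ℝ := fun i => LinearMap.toContinuousLinearMap (B.coord i)
  have h1 : ContDiffAt ℝ ∞ (fun q : E₀ × C =>
      ∑ i, (∑ j ∈ J, ∫ a, ρ j a * ℓ i (H q.2 a) ∂μ (ψ.symm q.1)) • B i) (b₀, z₀) := by
    refine ContDiffAt.sum fun i _ => (ContDiffAt.sum fun j _ => ?_).smul contDiffAt_const
    exact hμ.contDiffAt_integral_mul hψ (hρ j).1 (hρ j).2.1 hA (hρ j).2.2 hO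
      (H := fun z a => ℓ i (H z a)) ((ℓ i).contDiff.comp_contDiffOn (hH (c j))) hb₀ hz₀
  refine h1.congr_of_eventuallyEq ?_
  filter_upwards [continuousAt_fst.eventually hLμ,
    (continuous_snd.tendsto (b₀, z₀)).eventually (hO.mem_nhds hz₀)] with q hqL hqO
  have hq : Integrable (H q.2) (μ (ψ.symm q.1)) :=
    ((continuousOn_of_contDiffOn_charts hA hqO hH).mono hLA).integrable_of_isCompact hL hqL
  rw [← B.sum_repr (∫ a, H q.2 a ∂μ (ψ.symm q.1))]
  refine Finset.sum_congr rfl fun i _ => ?_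
  congr 1
  have h2 : ∀ j ∈ J, Integrable (fun a => ρ j a * ℓ i (H q.2 a)) (μ (ψ.symm q.1)) := fun j _ => by
    obtain ⟨M, hM⟩ := (hρ j).2.1.exists_bound_of_continuous (hρ j).1.continuous
    exact ((ℓ i).integrable_comp hq).bdd_mul (hρ j).1.continuous.aestronglyMeasurable
      (Filter.Eventually.of_forall hM)
  rw [← integral_finsetSum _ h2]
  change ℓ i (∫ a, H q.2 a ∂μ (ψ.symm q.1)) = _
  rw [← (ℓ i).integral_comp_comm hq]
  refine integral_congr_ae ?_
  filter_upwards [mem_ae_iff.2 hqL] with a ha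
  rw [← Finset.sum_mul, hsum a ha, one_mul]

end IsSmoothProbabilityFamily

end ParametricIntegrals

/-! ### Smoothness of averages -/

namespace ArrowGroupoid

section Averages

universe u

variable {E₀ : Type*} [NormedAddCommGroup E₀] [NormedSpace ℝ E₀]
  {E₁ : Type u} [NormedAddCommGroup E₁] [NormedSpace ℝ E₁]
  {X₀ : Type*} [TopologicalSpace X₀] [ChartedSpace E₀ X₀] [IsManifold 𝓘(ℝ, E₀) ∞ X₀]
  {X₁ : Type*} [TopologicalSpace X₁] [ChartedSpace E₁ X₁] [IsManifold 𝓘(ℝ, E₁) ∞ X₁]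
  {G : ArrowGroupoid X₀ X₁}
  {E₂ : Type*} [NormedAddCommGroup E₂] [NormedSpace ℝ E₂] [ChartedSpace E₂ G.Comp]
  [IsManifold 𝓘(ℝ, E₂) ∞ G.Comp]

/-- In submersion coordinates for the source map, an arrow near the centre is determined by its
source and its fibre coordinate. -/
lemma src_top_symm {C : Type*} [NormedAddCommGroup C] [NormedSpace ℝ C] {p₀ : X₁}
    (S : SubmersionCoords E₁ E₀ C G.src p₀) {x : X₀} {z : C} (hx : x ∈ S.base.source)
    (hz : (S.base x, z) ∈ S.top.target) : G.src (S.top.symm (S.base x, z)) = x := by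
  have h1 := S.top.map_target hz
  have h2 := S.fst_top _ h1
  rw [S.top.right_inv hz] at h2
  exact (S.base.injOn hx (S.mapsTo h1) h2).symm

lemma top_symm_src {C : Type*} [NormedAddCommGroup C] [NormedSpace ℝ C] {p₀ : X₁}
    (S : SubmersionCoords E₁ E₀ C G.src p₀) {p : X₁} (hp : p ∈ S.top.source) :
    S.top.symm (S.base (G.src p), (S.top p).2) = p := by
  rw [← S.fst_top p hp]
  exact S.top.left_inv hp

/-- The division `(q, a) ↦ q a⁻¹` of arrows with the same source extends, in coordinates, to a
smooth map on an open set of pairs of arrows. -/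
lemma IsLie.exists_division_extension (hG : G.IsLie (E₀ := E₀) (E₁ := E₁) E₂) {q₀ a₀ p₀ : X₁}
    (h : G.src q₀ = G.src a₀) (hp : G.comp q₀ (G.inv a₀) ∈ (extChartAt 𝓘(ℝ, E₁) p₀).source) :
    ∃ (D : E₁ × E₁ → E₁) (U : Set (E₁ × E₁)), IsOpen U ∧
      (extChartAt 𝓘(ℝ, E₁) q₀ q₀, extChartAt 𝓘(ℝ, E₁) a₀ a₀) ∈ U ∧ ContDiffOn ℝ ∞ D U ∧
      ∀ q ∈ (extChartAt 𝓘(ℝ, E₁) q₀).source, ∀ a ∈ (extChartAt 𝓘(ℝ, E₁) a₀).source,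
        (extChartAt 𝓘(ℝ, E₁) q₀ q, extChartAt 𝓘(ℝ, E₁) a₀ a) ∈ U → G.src q = G.src a →
          G.comp q (G.inv a) ∈ (extChartAt 𝓘(ℝ, E₁) p₀).source ∧
          D (extChartAt 𝓘(ℝ, E₁) q₀ q, extChartAt 𝓘(ℝ, E₁) a₀ a) =
            extChartAt 𝓘(ℝ, E₁) p₀ (G.comp q (G.inv a)) := by
  obtain ⟨C, _, _, ⟨S⟩, -⟩ := exists_submersionCoords (hG.submersion_src.isSubmersionAt q₀)
  set κ := extChartAt 𝓘(ℝ, E₁) q₀ with hκ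
  set κ' := extChartAt 𝓘(ℝ, E₁) a₀ with hκ'
  set y₀ : E₁ × E₁ := (κ q₀, κ' a₀) with hy₀
  have hq₀ : κ.symm y₀.1 = q₀ := extChartAt_to_inv q₀
  have ha₀ : κ'.symm y₀.2 = a₀ := extChartAt_to_inv a₀
  -- `b y` is the pair consisting of the source of the second arrow and the fibre coordinate of
  -- the first one; `f y` is the arrow with these data
  set b : E₁ × E₁ → E₀ × C := fun y => (S.base (G.src (κ'.symm y.2)), (S.top (κ.symm y.1)).2)
  set f : E₁ × E₁ → X₁ := fun y => S.top.symm (b y)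
  set g : E₁ × E₁ → X₁ := fun y => G.inv (κ'.symm y.2)
  set R : E₁ × E₁ → Prop := fun y => y.1 ∈ κ.target ∧ y.2 ∈ κ'.target ∧ κ.symm y.1 ∈ S.top.source ∧
    G.src (κ'.symm y.2) ∈ S.base.source ∧ b y ∈ S.top.target with hR
  have smooth : ∀ y, R y → ContMDiffAt 𝓘(ℝ, E₁ × E₁) 𝓘(ℝ, E₁) ∞ f y ∧
      ContMDiffAt 𝓘(ℝ, E₁ × E₁) 𝓘(ℝ, E₁) ∞ g y ∧
      ContMDiffAt 𝓘(ℝ, E₁ × E₁) 𝓘(ℝ, E₁) ∞ (fun y => κ.symm y.1) y ∧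
      ContMDiffAt 𝓘(ℝ, E₁ × E₁) 𝓘(ℝ, E₀) ∞ (fun y => G.src (κ'.symm y.2)) y ∧
      ContMDiffAt 𝓘(ℝ, E₁ × E₁) 𝓘(ℝ, E₀ × C) ∞ b y := by
    rintro y ⟨h1, h2, h3, h4, h5⟩
    have s1 : ContMDiffAt 𝓘(ℝ, E₁ × E₁) 𝓘(ℝ, E₁) ∞ (fun y : E₁ × E₁ => κ.symm y.1) y :=
      ((contMDiffOn_extChartAt_symm q₀).contMDiffAt
        ((isOpen_extChartAt_target q₀).mem_nhds h1)).comp y contDiff_fst.contMDiff.contMDiffAt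
    have s2 : ContMDiffAt 𝓘(ℝ, E₁ × E₁) 𝓘(ℝ, E₁) ∞ (fun y : E₁ × E₁ => κ'.symm y.2) y :=
      ((contMDiffOn_extChartAt_symm a₀).contMDiffAt
        ((isOpen_extChartAt_target a₀).mem_nhds h2)).comp y contDiff_snd.contMDiff.contMDiffAt
    have s3 : ContMDiffAt 𝓘(ℝ, E₁ × E₁) 𝓘(ℝ, E₀) ∞ (fun y => G.src (κ'.symm y.2)) y :=
      hG.contMDiff_src.contMDiffAt.comp y s2
    have s4 : ContMDiffAt 𝓘(ℝ, E₁ × E₁) 𝓘(ℝ, E₀ × C) ∞ (fun y => S.top (κ.symm y.1)) y :=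
      (S.top_smooth.contMDiffAt (S.top.open_source.mem_nhds h3)).comp y s1
    have s5 : ContMDiffAt 𝓘(ℝ, E₁ × E₁) 𝓘(ℝ, E₀) ∞ (fun y => S.base (G.src (κ'.symm y.2))) y :=
      (S.base_smooth.contMDiffAt (S.base.open_source.mem_nhds h4)).comp y s3
    have s6 : ContMDiffAt 𝓘(ℝ, E₁ × E₁) 𝓘(ℝ, E₀ × C) ∞ b y :=
      (s5.contDiffAt.prodMk s4.contDiffAt.snd).contMDiffAt
    exact ⟨(S.top_symm_smooth.contMDiffAt (S.top.open_target.mem_nhds h5)).comp y s6,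
      hG.smooth_inv.contMDiffAt.comp y s2, s1, s3, s6⟩
  have hsrc : ∀ y, R y → G.src (f y) = G.tgt (g y) := fun y hy =>
    (src_top_symm S hy.2.2.2.1 hy.2.2.2.2).trans (G.tgt_inv _).symm
  have hfg : ∀ q ∈ κ.source, ∀ a ∈ κ'.source, q ∈ S.top.source → G.src q = G.src a →
      b (κ q, κ' a) = S.top q ∧ f (κ q, κ' a) = q ∧ g (κ q, κ' a) = G.inv a := by
    intro q hq a ha hqS hqa
    have hb : b (κ q, κ' a) = (S.base (G.src q), (S.top q).2) := by
      simp only [b, κ.left_inv hq, κ'.left_inv ha, hqa]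
    refine ⟨?_, ?_, ?_⟩
    · rw [hb, ← S.fst_top q hqS]
    · change S.top.symm (b (κ q, κ' a)) = q
      rw [hb, top_symm_src S hqS]
    · simp only [g, κ'.left_inv ha]
  have h₀ := hfg q₀ (mem_extChartAt_source q₀) a₀ (mem_extChartAt_source a₀) S.mem_source h
  have hR₀ : R y₀ := by
    refine ⟨mem_extChartAt_target q₀, mem_extChartAt_target a₀, ?_, ?_, ?_⟩
    · rw [hq₀]; exact S.mem_source
    · rw [ha₀, ← h]; exact S.mapsTo S.mem_source
    · rw [hy₀, h₀.1]; exact S.top.map_source S.mem_source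
  have hRnhds : ∀ᶠ y in 𝓝 y₀, R y := by
    obtain ⟨-, -, s1, s3, s6⟩ := smooth y₀ hR₀
    filter_upwards [continuousAt_fst.eventually ((isOpen_extChartAt_target q₀).mem_nhds hR₀.1),
      continuousAt_snd.eventually ((isOpen_extChartAt_target a₀).mem_nhds hR₀.2.1),
      s1.continuousAt.eventually (S.top.open_source.mem_nhds hR₀.2.2.1),
      s3.continuousAt.eventually (S.base.open_source.mem_nhds hR₀.2.2.2.1),
      s6.continuousAt.eventually (S.top.open_target.mem_nhds hR₀.2.2.2.2)] with y h1 h2 h3 h4 h5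
    exact ⟨h1, h2, h3, h4, h5⟩
  obtain ⟨V, hVR, hVo, hV₀⟩ := eventually_nhds_iff.1 hRnhds
  have hcomp : ∀ y ∈ V, ContMDiffAt 𝓘(ℝ, E₁ × E₁) 𝓘(ℝ, E₁) ∞ (fun y => G.comp (f y) (g y)) y :=
    fun y hy => hG.contMDiffAt_comp (smooth y (hVR y hy)).1 (smooth y (hVR y hy)).2.1 <| by
      filter_upwards [hVo.mem_nhds hy] with y' hy' using hsrc y' (hVR y' hy')
  have hcont : ContinuousOn (fun y => G.comp (f y) (g y)) V := fun y hy =>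
    (hcomp y hy).continuousAt.continuousWithinAt
  refine ⟨fun y => extChartAt 𝓘(ℝ, E₁) p₀ (G.comp (f y) (g y)),
    V ∩ (fun y => G.comp (f y) (g y)) ⁻¹' (extChartAt 𝓘(ℝ, E₁) p₀).source,
    hcont.isOpen_inter_preimage hVo (isOpen_extChartAt_source p₀), ⟨hV₀, ?_⟩, ?_, ?_⟩
  · rw [Set.mem_preimage, hy₀, h₀.2.1, h₀.2.2]
    exact hp
  · intro y hy
    exact ((contMDiffAt_extChartAt' (by simpa using hy.2)).comp y
      (hcomp y hy.1)).contDiffAt.contDiffWithinAt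
  · rintro q hq a ha ⟨hV, hS⟩ hqa
    have hqS : q ∈ S.top.source := by
      have := (hVR _ hV).2.2.1
      rwa [κ.left_inv hq] at this
    obtain ⟨-, h1, h2⟩ := hfg q hq a ha hqS hqa
    rw [Set.mem_preimage, h1, h2] at hS
    exact ⟨hS, by simp only [h1, h2]⟩

/-- The derivative of a smooth extension of the division computes the division of tangent
vectors. -/
lemma IsLie.tderiv_chart_tdiv (hG : G.IsLie (E₀ := E₀) (E₁ := E₁) E₂) {q₀ a₀ p₀ : X₁}
    {D : E₁ × E₁ → E₁} {U : Set (E₁ × E₁)} (hU : IsOpen U) (hD : ContDiffOn ℝ ∞ D U)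
    (hDU : ∀ q ∈ (extChartAt 𝓘(ℝ, E₁) q₀).source, ∀ a ∈ (extChartAt 𝓘(ℝ, E₁) a₀).source,
        (extChartAt 𝓘(ℝ, E₁) q₀ q, extChartAt 𝓘(ℝ, E₁) a₀ a) ∈ U → G.src q = G.src a →
          G.comp q (G.inv a) ∈ (extChartAt 𝓘(ℝ, E₁) p₀).source ∧
          D (extChartAt 𝓘(ℝ, E₁) q₀ q, extChartAt 𝓘(ℝ, E₁) a₀ a) =
            extChartAt 𝓘(ℝ, E₁) p₀ (G.comp q (G.inv a)))
    {q a : X₁} (hq : q ∈ (extChartAt 𝓘(ℝ, E₁) q₀).source)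
    (ha : a ∈ (extChartAt 𝓘(ℝ, E₁) a₀).source)
    (hqa : (extChartAt 𝓘(ℝ, E₁) q₀ q, extChartAt 𝓘(ℝ, E₁) a₀ a) ∈ U) (h : G.src q = G.src a)
    {w w' : E₁} (hw : tderiv E₁ E₀ G.src q w = tderiv E₁ E₀ G.src a w') :
    tderiv E₁ E₁ (extChartAt 𝓘(ℝ, E₁) p₀) (G.comp q (G.inv a)) (G.tdiv E₂ q a w w') =
      fderiv ℝ D (extChartAt 𝓘(ℝ, E₁) q₀ q, extChartAt 𝓘(ℝ, E₁) a₀ a)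
        (tderiv E₁ E₁ (extChartAt 𝓘(ℝ, E₁) q₀) q w,
          tderiv E₁ E₁ (extChartAt 𝓘(ℝ, E₁) a₀) a w') := by
  obtain ⟨c, hc, hcc⟩ := exists_common_curves (ι := Bool) hG.submersion_src
    (p := fun i => cond i q a) (w := fun i => cond i w w')
    (x := G.src q) (u := tderiv E₁ E₀ G.src q w)
    (by rintro (_ | _); exacts [h.symm, rfl]) (by rintro (_ | _); exacts [hw.symm, rfl])
  obtain ⟨h1, h2, h3⟩ := hc true
  obtain ⟨h1', h2', h3'⟩ := hc false
  simp only [cond_true, cond_false] at h2 h3 h2' h3'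
  have hv : HasVelocityAt (fun ε => G.comp (c true ε) (G.inv (c false ε)))
      (G.tdiv E₂ q a w w') 0 := by
    have h4 := HasVelocityAt.comp_left (hG.hasTDerivAt_inv (c false 0)) h3'
    have h5 := hG.hasVelocityAt_comp h1 (hG.smooth_inv.contMDiffAt.comp 0 h1') h3 h4
      fun ε => (hcc true false ε).trans (G.tgt_inv _).symm
    rw [Function.comp_apply, h2, h2'] at h5
    exact h5
  have e1 := HasVelocityAt.comp_left (f := extChartAt 𝓘(ℝ, E₁) p₀)
    (by
      rw [h2, h2']
      exact hasTDerivAt_extChartAt (hDU q hq a ha hqa h).1) hv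
  have k1 := HasVelocityAt.comp_left (f := extChartAt 𝓘(ℝ, E₁) q₀)
    (by
      rw [h2]
      exact hasTDerivAt_extChartAt hq) h3
  have k2 := HasVelocityAt.comp_left (f := extChartAt 𝓘(ℝ, E₁) a₀)
    (by
      rw [h2']
      exact hasTDerivAt_extChartAt ha) h3'
  have hDd : HasFDerivAt D (fderiv ℝ D (extChartAt 𝓘(ℝ, E₁) q₀ (c true 0),
      extChartAt 𝓘(ℝ, E₁) a₀ (c false 0)))
      (extChartAt 𝓘(ℝ, E₁) q₀ (c true 0), extChartAt 𝓘(ℝ, E₁) a₀ (c false 0)) := by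
    rw [h2, h2']
    exact ((hD.contDiffAt (hU.mem_nhds hqa)).differentiableAt (by simp)).hasFDerivAt
  have hk : ContinuousAt (fun ε => (extChartAt 𝓘(ℝ, E₁) q₀ (c true ε),
      extChartAt 𝓘(ℝ, E₁) a₀ (c false ε))) 0 :=
    (HasTDerivAt.continuousAt k1).prodMk (HasTDerivAt.continuousAt k2)
  have e2 := hDd.comp (0 : ℝ) (f := fun ε => (extChartAt 𝓘(ℝ, E₁) q₀ (c true ε),
    extChartAt 𝓘(ℝ, E₁) a₀ (c false ε))) (k1.hasFDerivAt.prodMk k2.hasFDerivAt)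
  have heq : (D ∘ fun ε => (extChartAt 𝓘(ℝ, E₁) q₀ (c true ε),
      extChartAt 𝓘(ℝ, E₁) a₀ (c false ε))) =ᶠ[𝓝 0]
      fun ε => extChartAt 𝓘(ℝ, E₁) p₀ (G.comp (c true ε) (G.inv (c false ε))) := by
    filter_upwards [h1.continuousAt.eventually ((isOpen_extChartAt_source q₀).mem_nhds
        (by rw [h2]; exact hq)), h1'.continuousAt.eventually ((isOpen_extChartAt_source
        a₀).mem_nhds (by rw [h2']; exact ha)), hk.eventually (hU.mem_nhds
        (by simp only [h2, h2']; exact hqa))] with ε t1 t2 t3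
    exact (hDU _ t1 _ t2 t3 (hcc true false ε)).2
  have e3 := congrArg (fun L : ℝ →L[ℝ] E₁ => L 1)
    ((e2.congr_of_eventuallyEq heq.symm).unique e1.hasFDerivAt)
  simp only [h2, h2'] at e3
  simpa using e3.symm

/-- The arrow with source `tgt a` and fibre coordinate `z`. -/
def arrowTo {C : Type*} [NormedAddCommGroup C] [NormedSpace ℝ C] {p₀ : X₁}
    (S : SubmersionCoords E₁ E₀ C G.src p₀) (z : C) (a : X₁) : X₁ :=
  S.top.symm (S.base (G.tgt a), z)

/-- The coordinate expression at `p₀` of the integrand of the average of the vector field `ξ`, as a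
function of an arrow `a` and of the fibre coordinate of an arrow composable with `a`. -/
def averageCoord (E₂ : Type*) [NormedAddCommGroup E₂] [NormedSpace ℝ E₂] [ChartedSpace E₂ G.Comp]
    {C : Type*} [NormedAddCommGroup C] [NormedSpace ℝ C] {p₀ : X₁}
    (S : SubmersionCoords E₁ E₀ C G.src p₀) (ξ : SmoothVectorField E₁ X₁) (z : C) (a : X₁) : E₁ :=
  tderiv E₁ E₁ (extChartAt 𝓘(ℝ, E₁) p₀) (arrowTo S z a)
    (G.tdiv E₂ (G.comp (arrowTo S z a) a) a (fieldAt ξ (G.comp (arrowTo S z a) a)) (fieldAt ξ a))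

lemma IsLie.contDiffOn_averageCoord (hG : G.IsLie (E₀ := E₀) (E₁ := E₁) E₂)
    {C : Type*} [NormedAddCommGroup C] [NormedSpace ℝ C] {p₀ : X₁}
    (S : SubmersionCoords E₁ E₀ C G.src p₀) {ξ : SmoothVectorField E₁ X₁}
    (hξ : ∀ p q, G.src p = G.src q →
      tderiv E₁ E₀ G.src p (fieldAt ξ p) = tderiv E₁ E₀ G.src q (fieldAt ξ q))
    {O : Set C} {N : Set X₀} (hO : IsOpen O) (hN : IsOpen N)
    (hON : ∀ z ∈ O, ∀ x ∈ N, x ∈ S.base.source ∧ (S.base x, z) ∈ S.top.target ∧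
      S.top.symm (S.base x, z) ∈ (extChartAt 𝓘(ℝ, E₁) p₀).source) (c : X₁) :
    ContDiffOn ℝ ∞ (fun y : C × E₁ => averageCoord E₂ S ξ y.1 ((extChartAt 𝓘(ℝ, E₁) c).symm y.2))
      (O ×ˢ ((extChartAt 𝓘(ℝ, E₁) c).target ∩ (extChartAt 𝓘(ℝ, E₁) c).symm ⁻¹' (G.tgt ⁻¹' N))) := by
  set e := extChartAt 𝓘(ℝ, E₁) c with he
  set W := O ×ˢ (e.target ∩ e.symm ⁻¹' (G.tgt ⁻¹' N)) with hW
  have hWo : IsOpen W := hO.prod ((continuousOn_extChartAt_symm c).isOpen_inter_preimage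
    (isOpen_extChartAt_target c) (hN.preimage hG.contMDiff_tgt.continuous))
  set α : C × E₁ → X₁ := fun y => e.symm y.2 with hα
  set π : C × E₁ → X₁ := fun y => arrowTo S y.1 (α y) with hπ
  set q : C × E₁ → X₁ := fun y => G.comp (π y) (α y) with hq
  have hαs : ∀ y ∈ W, ContMDiffAt 𝓘(ℝ, C × E₁) 𝓘(ℝ, E₁) ∞ α y := fun y hy =>
    ((contMDiffOn_extChartAt_symm c).contMDiffAt
      ((isOpen_extChartAt_target c).mem_nhds hy.2.1)).comp y contDiff_snd.contMDiff.contMDiffAt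
  have hsrc : ∀ y ∈ W, G.src (π y) = G.tgt (α y) := fun y hy =>
    src_top_symm S (hON _ hy.1 _ hy.2.2).1 (hON _ hy.1 _ hy.2.2).2.1
  have hπs : ∀ y ∈ W, ContMDiffAt 𝓘(ℝ, C × E₁) 𝓘(ℝ, E₁) ∞ π y := by
    intro y hy
    obtain ⟨h1, h2, -⟩ := hON _ hy.1 _ hy.2.2
    have s1 : ContMDiffAt 𝓘(ℝ, C × E₁) 𝓘(ℝ, E₀) ∞ (fun y => S.base (G.tgt (α y))) y :=
      (S.base_smooth.contMDiffAt (S.base.open_source.mem_nhds h1)).comp y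
        (hG.contMDiff_tgt.contMDiffAt.comp y (hαs y hy))
    have s2 : ContMDiffAt 𝓘(ℝ, C × E₁) 𝓘(ℝ, E₀ × C) ∞ (fun y => (S.base (G.tgt (α y)), y.1)) y :=
      (s1.contDiffAt.prodMk contDiffAt_fst).contMDiffAt
    exact (S.top_symm_smooth.contMDiffAt (S.top.open_target.mem_nhds h2)).comp y s2
  have hqs : ∀ y ∈ W, ContMDiffAt 𝓘(ℝ, C × E₁) 𝓘(ℝ, E₁) ∞ q y := fun y hy =>
    hG.contMDiffAt_comp (hπs y hy) (hαs y hy) <| by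
      filter_upwards [hWo.mem_nhds hy] with y' hy' using hsrc y' hy'
  intro y hy
  have hqα : ∀ y ∈ W, G.src (q y) = G.src (α y) := fun y hy => src_comp (hsrc y hy)
  have hqπ : ∀ y ∈ W, G.comp (q y) (G.inv (α y)) = π y := fun y hy => comp_comp_inv (hsrc y hy)
  obtain ⟨D, U, hU, hyU, hD, hDU⟩ := hG.exists_division_extension (hqα y hy) (p₀ := p₀)
    (by rw [hqπ y hy]; exact (hON _ hy.1 _ hy.2.2).2.2)
  have t1 : ContMDiffAt 𝓘(ℝ, C × E₁) 𝓘(ℝ, E₁) ∞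
      (fun y' => extChartAt 𝓘(ℝ, E₁) (q y) (q y')) y :=
    (contMDiffAt_extChartAt (x := q y)).comp y (hqs y hy)
  have t2 : ContMDiffAt 𝓘(ℝ, C × E₁) 𝓘(ℝ, E₁) ∞
      (fun y' => extChartAt 𝓘(ℝ, E₁) (α y) (α y')) y :=
    (contMDiffAt_extChartAt (x := α y)).comp y (hαs y hy)
  have t3 : ContMDiffAt 𝓘(ℝ, C × E₁) 𝓘(ℝ, E₁) ∞
      (fun y' => tderiv E₁ E₁ (extChartAt 𝓘(ℝ, E₁) (q y)) (q y') (fieldAt ξ (q y'))) y :=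
    ((contMDiffOn_tderiv_fieldAt ξ (q y)).contMDiffAt (extChartAt_source_mem_nhds _)).comp y
      (hqs y hy)
  have t4 : ContMDiffAt 𝓘(ℝ, C × E₁) 𝓘(ℝ, E₁) ∞
      (fun y' => tderiv E₁ E₁ (extChartAt 𝓘(ℝ, E₁) (α y)) (α y') (fieldAt ξ (α y'))) y :=
    ((contMDiffOn_tderiv_fieldAt ξ (α y)).contMDiffAt (extChartAt_source_mem_nhds _)).comp y
      (hαs y hy)
  have t5 : ContDiffAt ℝ ∞ (fun y' => fderiv ℝ D (extChartAt 𝓘(ℝ, E₁) (q y) (q y'),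
      extChartAt 𝓘(ℝ, E₁) (α y) (α y'))) y :=
    ((hD.fderiv_of_isOpen (m := ∞) hU (by simp)).contDiffAt (hU.mem_nhds hyU)).comp
      (f := fun y' => (extChartAt 𝓘(ℝ, E₁) (q y) (q y'), extChartAt 𝓘(ℝ, E₁) (α y) (α y'))) y
      (t1.contDiffAt.prodMk t2.contDiffAt)
  refine ((t5.clm_apply (t3.contDiffAt.prodMk t4.contDiffAt)).congr_of_eventuallyEq
    ?_).contDiffWithinAt
  filter_upwards [hWo.mem_nhds hy,
    (hqs y hy).continuousAt.eventually (extChartAt_source_mem_nhds (I := 𝓘(ℝ, E₁)) (q y)),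
    (hαs y hy).continuousAt.eventually (extChartAt_source_mem_nhds (I := 𝓘(ℝ, E₁)) (α y)),
    (t1.continuousAt.prodMk t2.continuousAt).eventually (hU.mem_nhds hyU)] with y' h1 h2 h3 h4
  rw [← hG.tderiv_chart_tdiv hU hD hDU h2 h3 h4 (hqα y' h1) (hξ _ _ (hqα y' h1)), hqπ y' h1]
  rfl

end Averages

end ArrowGroupoid

namespace ArrowGroupoid

/-- A vector field that is both source and target related to `v`. -/
structure IsRelatedTo {E₀ E₁ X₀ X₁ : Type*} [NormedAddCommGroup E₀] [NormedSpace ℝ E₀]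
    [NormedAddCommGroup E₁] [NormedSpace ℝ E₁]
    [TopologicalSpace X₀] [ChartedSpace E₀ X₀] [IsManifold 𝓘(ℝ, E₀) ∞ X₀]
    [TopologicalSpace X₁] [ChartedSpace E₁ X₁] [IsManifold 𝓘(ℝ, E₁) ∞ X₁]
    (G : ArrowGroupoid X₀ X₁) (ξ : SmoothVectorField E₁ X₁) (v : SmoothVectorField E₀ X₀) :
    Prop where
  src : ∀ p, tderiv E₁ E₀ G.src p (fieldAt ξ p) = fieldAt v (G.src p)
  tgt : ∀ p, tderiv E₁ E₀ G.tgt p (fieldAt ξ p) = fieldAt v (G.tgt p)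

section Averages

universe u

variable {E₀ : Type*} [NormedAddCommGroup E₀] [NormedSpace ℝ E₀] [FiniteDimensional ℝ E₀]
  {E₁ : Type u} [NormedAddCommGroup E₁] [NormedSpace ℝ E₁] [FiniteDimensional ℝ E₁]
  {X₀ : Type*} [TopologicalSpace X₀] [ChartedSpace E₀ X₀] [IsManifold 𝓘(ℝ, E₀) ∞ X₀] [T2Space X₀]
  {X₁ : Type*} [TopologicalSpace X₁] [ChartedSpace E₁ X₁] [IsManifold 𝓘(ℝ, E₁) ∞ X₁] [T2Space X₁]
  {G : ArrowGroupoid X₀ X₁}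
  {E₂ : Type*} [NormedAddCommGroup E₂] [NormedSpace ℝ E₂] [ChartedSpace E₂ G.Comp]
  [IsManifold 𝓘(ℝ, E₂) ∞ G.Comp]

lemma averageIntegrand_eq (ξ : SmoothVectorField E₁ X₁) {p a : X₁} (h : G.src p = G.tgt a) :
    G.averageIntegrand E₂ ξ p a =
      G.tdiv E₂ (G.comp p a) a (fieldAt ξ (G.comp p a)) (fieldAt ξ a) := by
  have h' : G.src (G.comp p a) = G.tgt (G.inv a) := (src_comp h).trans (G.tgt_inv a).symm
  have key : ∀ r, r = G.comp p a →
      G.tmul E₂ r (G.inv a) (fieldAt ξ r) (tderiv E₁ E₁ G.inv a (fieldAt ξ a)) =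
        G.tdiv E₂ (G.comp p a) a (fieldAt ξ (G.comp p a)) (fieldAt ξ a) := by
    rintro _ rfl
    rfl
  refine (dif_pos h).trans ?_
  exact (tmul_eq _ _ (by rw [← comp_eq h, h']) _ _).symm.trans (key _ (comp_eq h).symm)

lemma averageIntegrand_of_ne (ξ : SmoothVectorField E₁ X₁) {p a : X₁} (h : G.src p ≠ G.tgt a) :
    G.averageIntegrand E₂ ξ p a = 0 := dif_neg h

variable {ξ : SmoothVectorField E₁ X₁} {v : SmoothVectorField E₀ X₀}

lemma IsRelatedTo.src_eq (h : G.IsRelatedTo ξ v) {p q : X₁} (hpq : G.src p = G.src q) :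
    tderiv E₁ E₀ G.src p (fieldAt ξ p) = tderiv E₁ E₀ G.src q (fieldAt ξ q) := by
  rw [h.src, h.src, hpq]

lemma IsLie.tderiv_src_averageIntegrand (hG : G.IsLie (E₀ := E₀) (E₁ := E₁) E₂)
    (hξ : G.IsRelatedTo ξ v) {p a : X₁} (h : G.src p = G.tgt a) :
    tderiv E₁ E₀ G.src p (G.averageIntegrand E₂ ξ p a) = fieldAt v (G.src p) := by
  have h1 := hG.tderiv_src_tdiv (src_comp h) (hξ.src_eq (src_comp h))
  rwa [comp_comp_inv h, ← averageIntegrand_eq ξ h, hξ.tgt, ← h] at h1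

lemma IsLie.tderiv_tgt_averageIntegrand (hG : G.IsLie (E₀ := E₀) (E₁ := E₁) E₂)
    (hξ : G.IsRelatedTo ξ v) {p a : X₁} (h : G.src p = G.tgt a) :
    tderiv E₁ E₀ G.tgt p (G.averageIntegrand E₂ ξ p a) = fieldAt v (G.tgt p) := by
  have h1 := hG.tderiv_tgt_tdiv (src_comp h) (hξ.src_eq (src_comp h))
  rwa [comp_comp_inv h, ← averageIntegrand_eq ξ h, hξ.tgt, tgt_comp h] at h1

/-- The integrands at composable arrows multiply, by the change of variables `b ↦ q b`. -/
lemma IsLie.tmul_averageIntegrand (hG : G.IsLie (E₀ := E₀) (E₁ := E₁) E₂)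
    (hξ : G.IsRelatedTo ξ v) {p q b : X₁} (h : G.src p = G.tgt q) (h' : G.src q = G.tgt b) :
    G.tmul E₂ p q (G.averageIntegrand E₂ ξ p (G.comp q b)) (G.averageIntegrand E₂ ξ q b) =
      G.averageIntegrand E₂ ξ (G.comp p q) b := by
  have hqb : G.src p = G.tgt (G.comp q b) := h.trans (tgt_comp h').symm
  have hpq : G.src (G.comp p q) = G.tgt b := (src_comp h).trans h'
  have hs : ∀ i, G.src (![G.comp p (G.comp q b), G.comp q b, b] i) = G.src b := by
    intro i
    fin_cases i
    · exact (src_comp hqb).trans (src_comp h')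
    · exact src_comp h'
    · rfl
  have h1 := hG.tmul_tdiv_tdiv (p := ![G.comp p (G.comp q b), G.comp q b, b])
    (w := fun i => fieldAt ξ (![G.comp p (G.comp q b), G.comp q b, b] i))
    (u := fieldAt v (G.src b)) hs fun i => by rw [hξ.src, hs]
  simp only [Matrix.cons_val_zero, Matrix.cons_val_one, Matrix.cons_val] at h1
  rw [comp_comp_inv hqb, comp_comp_inv h'] at h1
  rw [averageIntegrand_eq ξ hqb, averageIntegrand_eq ξ h', averageIntegrand_eq ξ hpq, h1,
    comp_assoc h h']

/-- The integrand is, over related vector fields, a linear function of two values of the field. -/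
lemma IsLie.exists_averageIntegrand_eq (hG : G.IsLie (E₀ := E₀) (E₁ := E₁) E₂) (p a : X₁) :
    ∃ L : E₁ × E₁ →L[ℝ] E₁, ∀ (ξ : SmoothVectorField E₁ X₁) (v : SmoothVectorField E₀ X₀),
      G.IsRelatedTo ξ v →
        G.averageIntegrand E₂ ξ p a = L (fieldAt ξ (G.comp p a), fieldAt ξ a) := by
  by_cases h : G.src p = G.tgt a
  · have h' : G.src (G.comp p a) = G.tgt (G.inv a) := (src_comp h).trans (G.tgt_inv a).symm
    obtain ⟨L, hL⟩ := hG.exists_tmul_eq h'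
    refine ⟨L.comp ((ContinuousLinearMap.id ℝ E₁).prodMap (tderiv E₁ E₁ G.inv a)),
      fun ξ v hξ => ?_⟩
    rw [averageIntegrand_eq ξ h, tdiv, hL]
    · rfl
    · rw [hG.tderiv_tgt_inv, hξ.src_eq (src_comp h)]
  · exact ⟨0, fun ξ v _ => by rw [averageIntegrand_of_ne ξ h]; rfl⟩

lemma IsRelatedTo.add {ξ' : SmoothVectorField E₁ X₁} {v' : SmoothVectorField E₀ X₀}
    (hξ : G.IsRelatedTo ξ v) (hξ' : G.IsRelatedTo ξ' v') : G.IsRelatedTo (ξ + ξ') (v + v') :=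
  ⟨fun p => (map_add (tderiv E₁ E₀ G.src p) (fieldAt ξ p) (fieldAt ξ' p)).trans
      (congrArg₂ (· + ·) (hξ.src p) (hξ'.src p)),
    fun p => (map_add (tderiv E₁ E₀ G.tgt p) (fieldAt ξ p) (fieldAt ξ' p)).trans
      (congrArg₂ (· + ·) (hξ.tgt p) (hξ'.tgt p))⟩

lemma IsRelatedTo.smul (r : ℝ) (hξ : G.IsRelatedTo ξ v) : G.IsRelatedTo (r • ξ) (r • v) :=
  ⟨fun p => (map_smul (tderiv E₁ E₀ G.src p) r (fieldAt ξ p)).trans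
      (congrArg (r • ·) (hξ.src p)),
    fun p => (map_smul (tderiv E₁ E₀ G.tgt p) r (fieldAt ξ p)).trans
      (congrArg (r • ·) (hξ.tgt p))⟩

lemma IsLie.averageIntegrand_add (hG : G.IsLie (E₀ := E₀) (E₁ := E₁) E₂)
    {ξ' : SmoothVectorField E₁ X₁} {v' : SmoothVectorField E₀ X₀}
    (hξ : G.IsRelatedTo ξ v) (hξ' : G.IsRelatedTo ξ' v') (p a : X₁) :
    G.averageIntegrand E₂ (ξ + ξ') p a =
      G.averageIntegrand E₂ ξ p a + G.averageIntegrand E₂ ξ' p a := by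
  obtain ⟨L, hL⟩ := hG.exists_averageIntegrand_eq p a
  rw [hL _ _ hξ, hL _ _ hξ', hL _ _ (hξ.add hξ'), ← map_add]
  rfl

lemma IsLie.averageIntegrand_smul (hG : G.IsLie (E₀ := E₀) (E₁ := E₁) E₂)
    (r : ℝ) (hξ : G.IsRelatedTo ξ v) (p a : X₁) :
    G.averageIntegrand E₂ (r • ξ) p a = r • G.averageIntegrand E₂ ξ p a := by
  obtain ⟨L, hL⟩ := hG.exists_averageIntegrand_eq p a
  rw [hL _ _ hξ, hL _ _ (hξ.smul r), ← map_smul]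
  rfl

/-- Submersion coordinates of the source map at `p₀`, with product neighbourhoods on which the
inverse coordinate map is defined and takes values in the chart at `p₀`. -/
lemma IsLie.exists_source_coords (hG : G.IsLie (E₀ := E₀) (E₁ := E₁) E₂) (p₀ : X₁) :
    ∃ (C : Type u) (_ : NormedAddCommGroup C) (_ : NormedSpace ℝ C) (_ : FiniteDimensional ℝ C)
      (S : SubmersionCoords E₁ E₀ C G.src p₀) (O : Set C) (N : Set X₀), IsOpen O ∧ IsOpen N ∧
      (S.top p₀).2 ∈ O ∧ G.src p₀ ∈ N ∧ ∀ z ∈ O, ∀ x ∈ N, x ∈ S.base.source ∧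
        (S.base x, z) ∈ S.top.target ∧
        S.top.symm (S.base x, z) ∈ (extChartAt 𝓘(ℝ, E₁) p₀).source := by
  obtain ⟨C, _, _, ⟨S⟩, ⟨e⟩⟩ := exists_submersionCoords (hG.submersion_src.isSubmersionAt p₀)
  have : FiniteDimensional ℝ (E₀ × C) := LinearEquiv.finiteDimensional e.toLinearEquiv
  have : FiniteDimensional ℝ C :=
    Module.Finite.of_surjective (LinearMap.snd ℝ E₀ C) Prod.snd_surjective
  have hx₀ := S.mapsTo S.mem_source
  have hp₀ : (S.base (G.src p₀), (S.top p₀).2) = S.top p₀ := by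
    rw [← S.fst_top p₀ S.mem_source]
  have h1 : ContinuousAt (fun y : C × X₀ => (S.base y.2, y.1)) ((S.top p₀).2, G.src p₀) :=
    ((S.base.continuousAt hx₀).comp (f := fun y : C × X₀ => y.2) continuousAt_snd).prodMk
      continuousAt_fst
  have ht : S.top p₀ ∈ S.top.target := S.top.map_source S.mem_source
  have h2 : ContinuousAt (fun y : C × X₀ => S.top.symm (S.base y.2, y.1))
      ((S.top p₀).2, G.src p₀) := by
    refine ContinuousAt.comp (g := S.top.symm) (f := fun y : C × X₀ => (S.base y.2, y.1)) ?_ h1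
    simp only [hp₀]
    exact S.top.symm.continuousAt ht
  have h3 : ∀ᶠ y : C × X₀ in 𝓝 ((S.top p₀).2, G.src p₀), y.2 ∈ S.base.source ∧
      (S.base y.2, y.1) ∈ S.top.target ∧
      S.top.symm (S.base y.2, y.1) ∈ (extChartAt 𝓘(ℝ, E₁) p₀).source := by
    filter_upwards [continuousAt_snd.eventually (S.base.open_source.mem_nhds hx₀),
      h1.eventually (S.top.open_target.mem_nhds (by simpa only [hp₀] using ht)),
      h2.eventually ((isOpen_extChartAt_source p₀).mem_nhds (by
        simp only [hp₀, S.top.left_inv S.mem_source]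
        exact mem_extChartAt_source (I := 𝓘(ℝ, E₁)) p₀))] with y a b c using ⟨a, b, c⟩
  obtain ⟨O, N, hO, hz, hN, hx, hON⟩ := mem_nhds_prod_iff'.1 h3
  exact ⟨C, _, _, this, S, O, N, hO, hN, hz, hx, fun z hz x hx => by
    simpa using hON (Set.mk_mem_prod hz hx)⟩

lemma tderiv_averageIntegrand {C : Type*} [NormedAddCommGroup C] [NormedSpace ℝ C] {p₀ : X₁}
    (S : SubmersionCoords E₁ E₀ C G.src p₀) (ξ : SmoothVectorField E₁ X₁) {p a : X₁}
    (hp : p ∈ S.top.source) (h : G.src p = G.tgt a) :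
    tderiv E₁ E₁ (extChartAt 𝓘(ℝ, E₁) p₀) p (G.averageIntegrand E₂ ξ p a) =
      averageCoord E₂ S ξ (S.top p).2 a := by
  have h1 : arrowTo S (S.top p).2 a = p := by rw [arrowTo, ← h, top_symm_src S hp]
  rw [averageCoord, h1, averageIntegrand_eq ξ h]

lemma IsLie.continuousOn_comp_left (hG : G.IsLie (E₀ := E₀) (E₁ := E₁) E₂) (g : X₁) :
    ContinuousOn (G.comp g) {a | G.src g = G.tgt a} := by
  rw [continuousOn_iff_continuous_domRestrict]
  have h1 : Continuous fun a : {a | G.src g = G.tgt a} => G.mul ⟨(g, a), a.2⟩ :=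
    hG.smooth_mul.continuous.comp
      ((continuous_const.prodMk continuous_subtype_val).subtype_mk fun a => a.2)
  exact h1.congr fun a => (comp_eq a.2).symm

variable [SecondCountableTopology X₁] [MeasurableSpace X₁] [BorelSpace X₁] {μ : X₀ → Measure X₁}

lemma IsLie.measurable_comp_left (hG : G.IsLie (E₀ := E₀) (E₁ := E₁) E₂) (g : X₁) :
    Measurable (G.comp g) := by
  classical
  have hm : MeasurableSet {a | G.src g = G.tgt a} :=
    (isClosed_eq continuous_const hG.contMDiff_tgt.continuous).measurableSet
  have h1 := (hG.continuousOn_comp_left g).measurable_piecewise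
    (continuousOn_const (c := g) (s := {a | G.src g = G.tgt a}ᶜ)) hm
  convert h1 using 1
  funext a
  by_cases ha : G.src g = G.tgt a
  · exact (Set.piecewise_eq_of_mem {a | G.src g = G.tgt a} _ _ ha).symm
  · rw [comp, dif_neg ha]
    exact (Set.piecewise_eq_of_notMem {a | G.src g = G.tgt a} _ (fun _ => g) ha).symm

/-- The average of a vector field at an arrow. -/
def average (G : ArrowGroupoid X₀ X₁) (E₂ : Type*) [NormedAddCommGroup E₂] [NormedSpace ℝ E₂] [ChartedSpace E₂ G.Comp]
    (μ : X₀ → Measure X₁) (ξ : SmoothVectorField E₁ X₁) (p : X₁) : E₁ :=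
  ∫ a, G.averageIntegrand E₂ ξ p a ∂μ (G.src p)

namespace IsProperHaarSystem

variable (hμ : G.IsProperHaarSystem (E₀ := E₀) (E₁ := E₁) μ)
include hμ

lemma isSmoothProbabilityFamily : IsSmoothProbabilityFamily E₀ E₁ μ :=
  ⟨hμ.isProbability, hμ.smooth⟩

lemma ae_tgt_eq (x : X₀) : ∀ᵐ a ∂μ x, G.tgt a = x := by
  rw [ae_iff]
  exact hμ.fibre x

/-- Left translation by `g` carries the measure at the source of `g` to the one at its target. -/
lemma map_comp_left (hG : G.IsLie (E₀ := E₀) (E₁ := E₁) E₂) (g : X₁) :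
    (μ (G.src g)).map (G.comp g) = μ (G.tgt g) := by
  ext A hA
  rw [Measure.map_apply (hG.measurable_comp_left g) hA, hμ.leftInvariant g A hA]
  refine measure_congr ?_
  filter_upwards [hμ.ae_tgt_eq (G.src g)] with a ha
  refine propext ⟨fun h => ⟨ha.symm, ?_⟩, fun ⟨h, h'⟩ => ?_⟩
  · rw [← comp_eq ha.symm]
    exact h
  · rw [← comp_eq h] at h'
    exact h'

lemma exists_isCompact (hG : G.IsLie (E₀ := E₀) (E₁ := E₁) E₂) {N : Set X₀} (hN : IsOpen N)
    {x₀ : X₀} (hx₀ : x₀ ∈ N) :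
    ∃ L, IsCompact L ∧ L ⊆ G.tgt ⁻¹' N ∧ ∀ᶠ x in 𝓝 x₀, μ x Lᶜ = 0 := by
  have : LocallyCompactSpace X₀ := Manifold.locallyCompact_of_finiteDimensional 𝓘(ℝ, E₀)
  obtain ⟨K, hK, hx₀K, hKN⟩ := exists_compact_subset hN hx₀
  obtain ⟨L, hL, hLμ⟩ := hμ.proper K hK
  refine ⟨L ∩ G.tgt ⁻¹' K, hL.inter_right (hK.isClosed.preimage hG.contMDiff_tgt.continuous),
    fun a ha => hKN ha.2, ?_⟩
  filter_upwards [mem_interior_iff_mem_nhds.1 hx₀K] with x hx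
  rw [← mem_ae_iff]
  filter_upwards [hμ.ae_tgt_eq x, mem_ae_iff.2 (hLμ x hx)] with a ha ha'
  exact ⟨ha', by rw [Set.mem_preimage, ha]; exact hx⟩

lemma integrable_averageIntegrand (hG : G.IsLie (E₀ := E₀) (E₁ := E₁) E₂)
    (hξ : G.IsRelatedTo ξ v) (p : X₁) :
    Integrable (G.averageIntegrand E₂ ξ p) (μ (G.src p)) := by
  have hprob := hμ.isProbability
  obtain ⟨C, _, _, _, S, O, N, hO, hN, hz, hx, hON⟩ := hG.exists_source_coords p
  obtain ⟨L, hL, hLN, hLμ⟩ := hμ.exists_isCompact hG hN hx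
  have h1 := continuousOn_of_contDiffOn_charts (hN.preimage hG.contMDiff_tgt.continuous) hz
    (hG.contDiffOn_averageCoord S (fun _ _ => hξ.src_eq) hO hN hON)
  refine ((h1.mono hLN).integrable_of_isCompact hL hLμ.self_of_nhds).congr ?_
  filter_upwards [hμ.ae_tgt_eq (G.src p)] with a ha
  rw [← tderiv_averageIntegrand S ξ S.mem_source ha.symm, tderiv_extChartAt_self]

lemma contMDiffAt_average (hG : G.IsLie (E₀ := E₀) (E₁ := E₁) E₂)
    (hξ : G.IsRelatedTo ξ v) (p₀ : X₁) :
    ContMDiffAt 𝓘(ℝ, E₁) 𝓘(ℝ, E₁) ∞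
      (fun p => tderiv E₁ E₁ (extChartAt 𝓘(ℝ, E₁) p₀) p (G.average E₂ μ ξ p)) p₀ := by
  obtain ⟨C, _, _, _, S, O, N, hO, hN, hz, hx, hON⟩ := hG.exists_source_coords p₀
  obtain ⟨L, hL, hLN, hLμ⟩ := hμ.exists_isCompact hG hN hx
  have hx₀ := S.mapsTo S.mem_source
  have hb : (S.top p₀).1 ∈ S.base.target := by
    rw [S.fst_top p₀ S.mem_source]
    exact S.base.map_source hx₀
  have hsymm : ∀ p ∈ S.top.source, S.base.symm (S.top p).1 = G.src p := fun p hp => by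
    rw [S.fst_top p hp]
    exact S.base.left_inv (S.mapsTo hp)
  have h1 := hμ.isSmoothProbabilityFamily.contDiffAt_integral S.base_symm_smooth
    (hN.preimage hG.contMDiff_tgt.continuous) hL hLN hO
    (hG.contDiffOn_averageCoord S (fun _ _ => hξ.src_eq) hO hN hON) hb hz
    ((S.base.symm.continuousAt hb).eventually (by rwa [hsymm p₀ S.mem_source]))
  have h2 := h1.contMDiffAt.comp p₀
    (S.top_smooth.contMDiffAt (S.top.open_source.mem_nhds S.mem_source))
  refine h2.congr_of_eventuallyEq ?_
  filter_upwards [S.top.open_source.mem_nhds S.mem_source] with p hp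
  rw [average, ← ContinuousLinearMap.integral_comp_comm _
    (hμ.integrable_averageIntegrand hG hξ p), Function.comp_apply, hsymm p hp]
  refine integral_congr_ae ?_
  filter_upwards [hμ.ae_tgt_eq (G.src p)] with a ha
  exact tderiv_averageIntegrand S ξ hp ha.symm

lemma tderiv_src_average (hG : G.IsLie (E₀ := E₀) (E₁ := E₁) E₂)
    (hξ : G.IsRelatedTo ξ v) (p : X₁) :
    tderiv E₁ E₀ G.src p (G.average E₂ μ ξ p) = fieldAt v (G.src p) := by
  have hprob := hμ.isProbability
  rw [average, ← ContinuousLinearMap.integral_comp_comm _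
    (hμ.integrable_averageIntegrand hG hξ p)]
  refine (integral_congr_ae (g := fun _ => fieldAt v (G.src p)) ?_).trans (by simp)
  filter_upwards [hμ.ae_tgt_eq (G.src p)] with a ha
  exact hG.tderiv_src_averageIntegrand hξ ha.symm

lemma tderiv_tgt_average (hG : G.IsLie (E₀ := E₀) (E₁ := E₁) E₂)
    (hξ : G.IsRelatedTo ξ v) (p : X₁) :
    tderiv E₁ E₀ G.tgt p (G.average E₂ μ ξ p) = fieldAt v (G.tgt p) := by
  have hprob := hμ.isProbability
  rw [average, ← ContinuousLinearMap.integral_comp_comm _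
    (hμ.integrable_averageIntegrand hG hξ p)]
  refine (integral_congr_ae (g := fun _ => fieldAt v (G.tgt p)) ?_).trans (by simp)
  filter_upwards [hμ.ae_tgt_eq (G.src p)] with a ha
  exact hG.tderiv_tgt_averageIntegrand hξ ha.symm

/-- The average is multiplicative: after a left translation of the variable of integration of one
factor, the integrands multiply pointwise. -/
lemma tmul_average (hG : G.IsLie (E₀ := E₀) (E₁ := E₁) E₂) (hξ : G.IsRelatedTo ξ v) {p q : X₁}
    (h : G.src p = G.tgt q) :
    G.tmul E₂ p q (G.average E₂ μ ξ p) (G.average E₂ μ ξ q) = G.average E₂ μ ξ (G.comp p q) := by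
  obtain ⟨L, hL⟩ := hG.exists_tmul_eq h
  have hmap := hμ.map_comp_left hG q
  have hip := hμ.integrable_averageIntegrand hG hξ p
  have hiq := hμ.integrable_averageIntegrand hG hξ q
  rw [h, ← hmap] at hip
  have hip' : Integrable (fun b => G.averageIntegrand E₂ ξ p (G.comp q b)) (μ (G.src q)) :=
    hip.comp_measurable (hG.measurable_comp_left q)
  have h1 : G.average E₂ μ ξ p =
      ∫ b, G.averageIntegrand E₂ ξ p (G.comp q b) ∂μ (G.src q) := by
    rw [average, h, ← hmap, integral_map (hG.measurable_comp_left q).aemeasurable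
      hip.aestronglyMeasurable]
  rw [hL _ _ (by rw [hμ.tderiv_src_average hG hξ, hμ.tderiv_tgt_average hG hξ, h]), h1, average,
    average, ← integral_pair hip' hiq, ← L.integral_comp_comm (hip'.prodMk hiq), src_comp h]
  refine integral_congr_ae ?_
  filter_upwards [hμ.ae_tgt_eq (G.src q)] with b hb
  have hqb : G.src p = G.tgt (G.comp q b) := h.trans (tgt_comp hb.symm).symm
  rw [← hG.tmul_averageIntegrand hξ h hb.symm, hL]
  rw [hG.tderiv_src_averageIntegrand hξ hqb, hG.tderiv_tgt_averageIntegrand hξ hb.symm, h]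

end IsProperHaarSystem

end Averages

end ArrowGroupoid

/-! ### The averaging operator -/

namespace ArrowGroupoid

section AveragingOperator

universe u

variable {E₀ : Type*} [NormedAddCommGroup E₀] [NormedSpace ℝ E₀] [FiniteDimensional ℝ E₀]
  {E₁ : Type u} [NormedAddCommGroup E₁] [NormedSpace ℝ E₁] [FiniteDimensional ℝ E₁]
  {X₀ : Type*} [TopologicalSpace X₀] [ChartedSpace E₀ X₀] [IsManifold 𝓘(ℝ, E₀) ∞ X₀] [T2Space X₀]
  {X₁ : Type*} [TopologicalSpace X₁] [ChartedSpace E₁ X₁] [IsManifold 𝓘(ℝ, E₁) ∞ X₁] [T2Space X₁]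
  {G : ArrowGroupoid X₀ X₁}
  {E₂ : Type*} [NormedAddCommGroup E₂] [NormedSpace ℝ E₂] [ChartedSpace E₂ G.Comp]
  [IsManifold 𝓘(ℝ, E₂) ∞ G.Comp]
  {ξ ξ' : SmoothVectorField E₁ X₁} {v v' : SmoothVectorField E₀ X₀}
  {η : G.RiemannianStructure (E₀ := E₀) (E₁ := E₁) E₂} {η₀ : SmoothRiemannianMetric E₀ X₀}

lemma IsInfinitesimallyIsometric.add (h : G.IsInfinitesimallyIsometric E₁ η₀ v)
    (h' : G.IsInfinitesimallyIsometric E₁ η₀ v') :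
    G.IsInfinitesimallyIsometric E₁ η₀ (v + v') := fun y n n' hn => by
  rw [lieMetric_add, h y n n' hn, h' y n n' hn, add_zero]

lemma IsInfinitesimallyIsometric.smul (r : ℝ) (h : G.IsInfinitesimallyIsometric E₁ η₀ v) :
    G.IsInfinitesimallyIsometric E₁ η₀ (r • v) := fun y n n' hn => by
  rw [lieMetric_smul, h y n n' hn, mul_zero]

lemma isInfinitesimallyIsometric_zero : G.IsInfinitesimallyIsometric E₁ η₀ 0 :=
  fun y n n' _ => lieMetric_zero η₀ y n n'

lemma isRelatedTo_zero : G.IsRelatedTo (0 : SmoothVectorField E₁ X₁) (0 : SmoothVectorField E₀ X₀) :=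
  ⟨fun p => map_zero (tderiv E₁ E₀ G.src p), fun p => map_zero (tderiv E₁ E₀ G.tgt p)⟩

lemma IsRelatedTo.fieldAt_eq (h : G.IsRelatedTo ξ v) (x : X₀) :
    fieldAt v x = tderiv E₁ E₀ G.src (G.unit x) (fieldAt ξ (G.unit x)) := by
  rw [h.src, G.src_unit]

lemma IsRelatedTo.unique (h : G.IsRelatedTo ξ v) (h' : G.IsRelatedTo ξ v') : v = v' :=
  ContMDiffSection.ext fun x => (h.fieldAt_eq x).trans (h'.fieldAt_eq x).symm

lemma IsLie.isProjectableOfKillingType_iff (hG : G.IsLie (E₀ := E₀) (E₁ := E₁) E₂) :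
    IsProjectableOfKillingType η ξ ↔
      ∃ v, G.IsRelatedTo ξ v ∧ G.IsInfinitesimallyIsometric E₁ η.η₀ v := by
  refine exists_congr fun v => ⟨fun ⟨hs, ht, h⟩ => ⟨⟨hs, ht⟩, ?_⟩, fun ⟨hr, h⟩ => ⟨hr.src, hr.tgt, ?_⟩⟩
  · exact (hG.isTransversallyIsometric_iff hs ht η.η₀).1 h
  · exact (hG.isTransversallyIsometric_iff hr.src hr.tgt η.η₀).2 h

lemma IsLie.isWeakMultiplicativeKilling_iff (hG : G.IsLie (E₀ := E₀) (E₁ := E₁) E₂) :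
    IsWeakMultiplicativeKilling η ξ v ↔ G.IsRelatedTo ξ v ∧
      (∀ p q, G.src p = G.tgt q →
        G.tmul E₂ p q (fieldAt ξ p) (fieldAt ξ q) = fieldAt ξ (G.comp p q)) ∧
      G.IsInfinitesimallyIsometric E₁ η.η₀ v := by
  constructor
  · rintro ⟨⟨hs, ht, hm⟩, h⟩
    refine ⟨⟨hs, ht⟩, fun p q hpq => ?_, (hG.isTransversallyIsometric_iff hs ht η.η₀).1 h⟩
    rw [tmul_eq p q hpq, comp_eq hpq]
    exact hm ⟨(p, q), hpq⟩
  · rintro ⟨hr, hm, h⟩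
    refine ⟨⟨hr.src, hr.tgt, fun c => ?_⟩, (hG.isTransversallyIsometric_iff hr.src hr.tgt η.η₀).2 h⟩
    have h1 := hm c.1.1 c.1.2 c.2
    rw [tmul_eq _ _ c.2, comp_eq c.2] at h1
    exact h1

/-- The space of projectable vector fields of Killing type. -/
def IsLie.projectableOfKillingType (hG : G.IsLie (E₀ := E₀) (E₁ := E₁) E₂)
    (η : G.RiemannianStructure (E₀ := E₀) (E₁ := E₁) E₂) :
    Submodule ℝ (SmoothVectorField E₁ X₁) where
  carrier := {ξ | IsProjectableOfKillingType η ξ}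
  add_mem' h h' := by
    obtain ⟨v, hr, hv⟩ := hG.isProjectableOfKillingType_iff.1 h
    obtain ⟨v', hr', hv'⟩ := hG.isProjectableOfKillingType_iff.1 h'
    exact hG.isProjectableOfKillingType_iff.2 ⟨v + v', hr.add hr', hv.add hv'⟩
  zero_mem' := hG.isProjectableOfKillingType_iff.2
    ⟨0, isRelatedTo_zero, isInfinitesimallyIsometric_zero⟩
  smul_mem' r ξ h := by
    obtain ⟨v, hr, hv⟩ := hG.isProjectableOfKillingType_iff.1 h
    exact hG.isProjectableOfKillingType_iff.2 ⟨r • v, hr.smul r, hv.smul r⟩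

/-- The space of weak multiplicative Killing vector fields. -/
def IsLie.weakMultiplicativeKilling (hG : G.IsLie (E₀ := E₀) (E₁ := E₁) E₂)
    (η : G.RiemannianStructure (E₀ := E₀) (E₁ := E₁) E₂) :
    Submodule ℝ (SmoothVectorField E₁ X₁ × SmoothVectorField E₀ X₀) where
  carrier := {ζ | IsWeakMultiplicativeKilling η ζ.1 ζ.2}
  add_mem' {ζ ζ'} h h' := by
    obtain ⟨hr, hm, hv⟩ := hG.isWeakMultiplicativeKilling_iff.1 h
    obtain ⟨hr', hm', hv'⟩ := hG.isWeakMultiplicativeKilling_iff.1 h'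
    refine hG.isWeakMultiplicativeKilling_iff.2 ⟨hr.add hr', fun p q hpq => ?_, hv.add hv'⟩
    obtain ⟨L, hL⟩ := hG.exists_tmul_eq hpq
    have h1 := hm p q hpq
    have h2 := hm' p q hpq
    rw [hL _ _ (by rw [hr.src, hr.tgt, hpq])] at h1
    rw [hL _ _ (by rw [hr'.src, hr'.tgt, hpq])] at h2
    have h3 := hr.add hr'
    change G.tmul E₂ p q (fieldAt (ζ.1 + ζ'.1) p) (fieldAt (ζ.1 + ζ'.1) q) =
      fieldAt ζ.1 (G.comp p q) + fieldAt ζ'.1 (G.comp p q)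
    rw [hL _ _ (by rw [h3.src, h3.tgt, hpq]), ← h1, ← h2, ← map_add]
    rfl
  zero_mem' := by
    refine hG.isWeakMultiplicativeKilling_iff.2
      ⟨isRelatedTo_zero, fun p q hpq => ?_, isInfinitesimallyIsometric_zero⟩
    obtain ⟨L, hL⟩ := hG.exists_tmul_eq hpq
    have h3 := isRelatedTo_zero (G := G) (E₀ := E₀) (E₁ := E₁)
    exact (hL _ _ (((h3.src p).trans (by rw [hpq])).trans (h3.tgt q).symm)).trans (map_zero L)
  smul_mem' r ζ h := by
    obtain ⟨hr, hm, hv⟩ := hG.isWeakMultiplicativeKilling_iff.1 h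
    refine hG.isWeakMultiplicativeKilling_iff.2 ⟨hr.smul r, fun p q hpq => ?_, hv.smul r⟩
    obtain ⟨L, hL⟩ := hG.exists_tmul_eq hpq
    have h1 := hm p q hpq
    rw [hL _ _ (by rw [hr.src, hr.tgt, hpq])] at h1
    have h3 := hr.smul r
    change G.tmul E₂ p q (fieldAt (r • ζ.1) p) (fieldAt (r • ζ.1) q) =
      r • fieldAt ζ.1 (G.comp p q)
    rw [hL _ _ (by rw [h3.src, h3.tgt, hpq]), ← h1, ← map_smul]
    rfl

variable [SecondCountableTopology X₁] [MeasurableSpace X₁] [BorelSpace X₁] {μ : X₀ → Measure X₁}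

namespace IsProperHaarSystem

variable (hμ : G.IsProperHaarSystem (E₀ := E₀) (E₁ := E₁) μ)
include hμ

/-- The average of a related vector field, as a smooth vector field. -/
def averageField (hG : G.IsLie (E₀ := E₀) (E₁ := E₁) E₂) (hξ : G.IsRelatedTo ξ v) :
    SmoothVectorField E₁ X₁ where
  toFun p := G.average (E₁ := E₁) E₂ μ ξ p
  contMDiff_toFun p := contMDiffAt_section_of_tderiv (hμ.contMDiffAt_average hG hξ p)

lemma isRelatedTo_averageField (hG : G.IsLie (E₀ := E₀) (E₁ := E₁) E₂) (hξ : G.IsRelatedTo ξ v) :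
    G.IsRelatedTo (hμ.averageField hG hξ) v :=
  ⟨hμ.tderiv_src_average hG hξ, hμ.tderiv_tgt_average hG hξ⟩

lemma isWeakMultiplicativeKilling_averageField (hG : G.IsLie (E₀ := E₀) (E₁ := E₁) E₂)
    (hξ : G.IsRelatedTo ξ v) (hv : G.IsInfinitesimallyIsometric E₁ η.η₀ v) :
    IsWeakMultiplicativeKilling η (hμ.averageField hG hξ) v :=
  hG.isWeakMultiplicativeKilling_iff.2
    ⟨hμ.isRelatedTo_averageField hG hξ, fun _ _ h => hμ.tmul_average hG hξ h, hv⟩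

lemma averageField_add (hG : G.IsLie (E₀ := E₀) (E₁ := E₁) E₂) (hξ : G.IsRelatedTo ξ v)
    (hξ' : G.IsRelatedTo ξ' v') {u : SmoothVectorField E₀ X₀} (h : G.IsRelatedTo (ξ + ξ') u) :
    hμ.averageField hG h = hμ.averageField hG hξ + hμ.averageField hG hξ' := by
  refine ContMDiffSection.ext fun p => ?_
  change G.average E₂ μ (ξ + ξ') p = G.average E₂ μ ξ p + G.average E₂ μ ξ' p
  rw [average, average, average, ← integral_add (hμ.integrable_averageIntegrand hG hξ p)
    (hμ.integrable_averageIntegrand hG hξ' p)]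
  exact integral_congr_ae (.of_forall (hG.averageIntegrand_add hξ hξ' p))

lemma averageField_smul (hG : G.IsLie (E₀ := E₀) (E₁ := E₁) E₂) (r : ℝ) (hξ : G.IsRelatedTo ξ v)
    {u : SmoothVectorField E₀ X₀} (h : G.IsRelatedTo (r • ξ) u) :
    hμ.averageField hG h = r • hμ.averageField hG hξ := by
  refine ContMDiffSection.ext fun p => ?_
  change G.average E₂ μ (r • ξ) p = r • G.average E₂ μ ξ p
  rw [average, average, ← integral_smul]
  exact integral_congr_ae (.of_forall (hG.averageIntegrand_smul r hξ p))

/-- The integrand over the objects is almost everywhere constant. -/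
lemma averageIntegrandBase_ae_eq (hξ : G.IsRelatedTo ξ v) (x : X₀) :
    G.averageIntegrandBase (E₀ := E₀) ξ =ᵐ[μ x] fun _ => fieldAt v x := by
  filter_upwards [hμ.ae_tgt_eq x] with a ha
  rw [← ha]
  exact hξ.tgt a

end IsProperHaarSystem

end AveragingOperator

end ArrowGroupoid

end

/-- Averaging against a proper Haar measure system is a linear map from the space of projectable
vector fields of Killing type to the space of weak multiplicative Killing vector fields. -/
theorem mainTheorem7
    {E₀ : Type*} [NormedAddCommGroup E₀] [NormedSpace ℝ E₀] [FiniteDimensional ℝ E₀]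
    {E₁ : Type*} [NormedAddCommGroup E₁] [NormedSpace ℝ E₁] [FiniteDimensional ℝ E₁]
    {E₂ : Type*} [NormedAddCommGroup E₂] [NormedSpace ℝ E₂] [FiniteDimensional ℝ E₂]
    {X₀ : Type*} [TopologicalSpace X₀] [T2Space X₀] [SecondCountableTopology X₀]
    [ChartedSpace E₀ X₀] [IsManifold 𝓘(ℝ, E₀) ∞ X₀]
    {X₁ : Type*} [TopologicalSpace X₁] [T2Space X₁] [SecondCountableTopology X₁]
    [ChartedSpace E₁ X₁] [IsManifold 𝓘(ℝ, E₁) ∞ X₁]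
    [MeasurableSpace X₁] [BorelSpace X₁]
    (G : ArrowGroupoid X₀ X₁)
    [ChartedSpace E₂ G.Comp] [IsManifold 𝓘(ℝ, E₂) ∞ G.Comp]
    (hG : G.IsLie (E₀ := E₀) (E₁ := E₁) E₂) (hproper : G.IsProper)
    (η : G.RiemannianStructure (E₀ := E₀) (E₁ := E₁) E₂)
    (μ : X₀ → Measure X₁) (hμ : G.IsProperHaarSystem (E₀ := E₀) (E₁ := E₁) μ) :
    ∃ (P : Submodule ℝ (SmoothVectorField E₁ X₁))
      (Q : Submodule ℝ (SmoothVectorField E₁ X₁ × SmoothVectorField E₀ X₀)),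
      (∀ ξ, ξ ∈ P ↔ ArrowGroupoid.IsProjectableOfKillingType η ξ) ∧
      (∀ ζ, ζ ∈ Q ↔ ArrowGroupoid.IsWeakMultiplicativeKilling η ζ.1 ζ.2) ∧
      ∃ A : P →ₗ[ℝ] Q, ∀ ξ : P,
        (∀ p : X₁, Integrable (G.averageIntegrand E₂ ξ.1 p) (μ (G.src p)) ∧
          (A ξ).1.1 p = ∫ a, G.averageIntegrand E₂ ξ.1 p a ∂(μ (G.src p))) ∧
        (∀ x : X₀, Integrable (G.averageIntegrandBase (E₀ := E₀) ξ.1) (μ x) ∧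
          (A ξ).1.2 x = ∫ a, G.averageIntegrandBase (E₀ := E₀) ξ.1 a ∂(μ x)) := by
  choose! v hr hv using fun (ξ : SmoothVectorField E₁ X₁)
    (hξ : ArrowGroupoid.IsProjectableOfKillingType η ξ) => hG.isProjectableOfKillingType_iff.1 hξ
  refine ⟨hG.projectableOfKillingType η, hG.weakMultiplicativeKilling η, fun _ => Iff.rfl,
    fun _ => Iff.rfl,
    { toFun := fun ξ => ⟨(hμ.averageField hG (hr ξ.1 ξ.2), v ξ.1),
        hμ.isWeakMultiplicativeKilling_averageField hG (hr ξ.1 ξ.2) (hv ξ.1 ξ.2)⟩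
      map_add' := fun ξ ξ' => Subtype.ext <| Prod.ext
        (hμ.averageField_add hG (hr ξ.1 ξ.2) (hr ξ'.1 ξ'.2) (hr _ (ξ + ξ').2))
        ((hr _ (ξ + ξ').2).unique ((hr ξ.1 ξ.2).add (hr ξ'.1 ξ'.2)))
      map_smul' := fun r ξ => Subtype.ext <| Prod.ext
        (hμ.averageField_smul hG r (hr ξ.1 ξ.2) (hr _ (r • ξ).2))
        ((hr _ (r • ξ).2).unique ((hr ξ.1 ξ.2).smul r)) },
    fun ξ => ⟨fun p => ⟨hμ.integrable_averageIntegrand hG (hr ξ.1 ξ.2) p, rfl⟩, fun x => ?_⟩⟩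
  have hprob := hμ.isProbability
  have hae := hμ.averageIntegrandBase_ae_eq (hr ξ.1 ξ.2) x
  refine ⟨(integrable_const _).congr hae.symm, ?_⟩
  rw [integral_congr_ae hae, integral_const, probReal_univ, one_smul]
  rfl
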